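/- **Theorem 1.2 (uniqueness theorem).** Let $V\subset\mathbb P^n(\mathbb C)$ be a projective subvariety (irreducible, nonempty and Zariski closed) of dimension $k$, with homogeneous ideal $I(V)$. For a positive integer $d$ let $H_d$ be the space of homogeneous polynomials of degree $d$ in $\mathbb C[x_0,\dots,x_n]$, let $I_d(V):=H_d/(I(V)\cap H_d)$ and let $H_V(d):=\dim_{\mathbb C} I_d(V)$ be the Hilbert function of $V$. A holomorphic map $f:\mathbb C\to V$ is called nondegenerate over $I_d(V)$ if there is no $Q\in H_d\setminus I(V)$ with $Q(\tilde f)\equiv 0$ for a reduced representation $\tilde f=(f_0,\dots,f_n)$ of $f$ (entire functions without common zeros that are homogeneous coordinates of $f$). Let $D_1,\dots,D_q$ be hypersurfaces of $\mathbb P^n(\mathbb C)$, where $D_i$ is the zero set of a nonzero homogeneous polynomial of degree $\deg D_i\ge 1$, and let $d=\mathrm{lcm}(\deg D_1,\dots,\deg D_q)$. Let $$\Delta:=\max_{\varnothing\ne\Gamma\subset\{1,\dots,q\}}\frac{\#\Gamma}{k-\dim\big(\bigcap_{j\in\Gamma}D_j\cap V\big)}\in[0,\infty]$$ be the distributive constant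 of the family with respect to $V$. Here $\dim\varnothing=-\infty$, so that the quotient is $0$ if the intersection is empty, and the quotient is $\infty$ if $V\subset\bigcap_{j\in\Gamma}D_j$. Let $f,g:\mathbb C\to V$ be holomorphic maps that are nondegenerate over $I_d(V)$, and assume that $f=g$ on $\bigcup_{i=1}^q\big(f^{-1}(D_i)\cup g^{-1}(D_i)\big)$. (a) If $q>\Delta\left(\dfrac{2k(H_V(d)-1)}{d}+H_V(d)\right)$, then $f=g$. (b) If $f^{-1}(D_i\cap D_j)=\varnothing$ for all $1\le i<j\le q$ and $q>\dfrac{2(H_V(d)-1)}{d}+\Delta H_V(d)$, then $f=g$. -/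

import Mathlib

open scoped LinearAlgebra.Projectivization ENNReal Topology

namespace ProjCurve

noncomputable section

/-- The complex projective space of dimension `n`. -/
abbrev PSpace (n : ℕ) : Type := ℙ ℂ (Fin (n + 1) → ℂ)

/-- Polynomials in the homogeneous coordinates `x₀, …, xₙ`. -/
abbrev Poly (n : ℕ) : Type := MvPolynomial (Fin (n + 1)) ℂ

/-- `P` vanishes at the point `x`. This is used for homogeneous `P` only, where it does not depend
on the homogeneous coordinates of `x`, see `vanishesAt_mk`. -/
def VanishesAt {n : ℕ} (P : Poly n) (x : PSpace n) : Prop :=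
  MvPolynomial.eval x.rep P = 0

theorem vanishesAt_mk {n e : ℕ} {P : Poly n} (hP : P.IsHomogeneous e) (v : Fin (n + 1) → ℂ)
    (hv : v ≠ 0) :
    VanishesAt P (Projectivization.mk ℂ v hv) ↔ MvPolynomial.eval v P = 0 := by
  obtain ⟨a, ha⟩ := Projectivization.exists_smul_eq_mk_rep ℂ v hv
  have h : MvPolynomial.eval ((a : ℂ) • v) P = (a : ℂ) ^ e * MvPolynomial.eval v P := by
    rw [MvPolynomial.eval_eq, MvPolynomial.eval_eq, Finset.mul_sum]
    refine Finset.sum_congr rfl fun m hm => ?_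
    have hdeg : ∑ i ∈ m.support, m i = e := by
      have := hP (MvPolynomial.mem_support_iff.mp hm)
      simpa [Finsupp.weight_apply, Finsupp.sum] using this
    simp only [Pi.smul_apply, smul_eq_mul, mul_pow, Finset.prod_mul_distrib,
      Finset.prod_pow_eq_pow_sum, hdeg]
    ring
  unfold VanishesAt
  rw [← ha, Units.smul_def, h]
  simp

/-! ### Projective algebraic sets, varieties and dimension -/

/-- The common zero set of a set of (homogeneous) polynomials. -/
def zeroLocus {n : ℕ} (S : Set (Poly n)) : Set (PSpace n) :=
  {x | ∀ P ∈ S, VanishesAt P x}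

/-- Zariski closed subsets of projective space. -/
def IsAlgebraicSet {n : ℕ} (X : Set (PSpace n)) : Prop :=
  ∃ S : Set (Poly n), (∀ P ∈ S, ∃ e : ℕ, P.IsHomogeneous e) ∧ X = zeroLocus S

/-- Projective subvarieties: nonempty irreducible Zariski closed subsets. -/
structure IsProjectiveVariety {n : ℕ} (X : Set (PSpace n)) : Prop where
  isAlgebraicSet : IsAlgebraicSet X
  nonempty : X.Nonempty
  irreducible : ∀ A B : Set (PSpace n), IsAlgebraicSet A → IsAlgebraicSet B →
    X ⊆ A ∪ B → X ⊆ A ∨ X ⊆ B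

/-- The dimension of an algebraic set: the supremum of the lengths of the strictly increasing
chains `Z₀ ⊂ Z₁ ⊂ ⋯ ⊂ Zₘ` of irreducible closed subsets; it is `⊥` for the empty set. -/
def dim {n : ℕ} (X : Set (PSpace n)) : WithBot ℕ∞ :=
  Order.krullDim {Z : Set (PSpace n) // IsProjectiveVariety Z ∧ Z ⊆ X}

/-- The number `dim V - dim W` for `W ⊆ V`, with the convention `dim ∅ = -∞`. -/
def codimIn {n : ℕ} (V W : Set (PSpace n)) : ℕ∞ :=
  open Classical in if W = ∅ then ⊤ else (dim V).unbotD 0 - (dim W).unbotD 0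

/-! ### Hypersurfaces and the distributive constant -/

/-- A hypersurface of positive degree, given by its defining homogeneous polynomial. -/
structure Hypersurface (n : ℕ) where
  poly : Poly n
  degree : ℕ
  degree_pos : 0 < degree
  isHomogeneous : poly.IsHomogeneous degree
  poly_ne_zero : poly ≠ 0

/-- The set of points of a hypersurface. -/
def Hypersurface.locus {n : ℕ} (D : Hypersurface n) : Set (PSpace n) :=
  {x | VanishesAt D.poly x}

/-- The distributive constant of `D₁, …, D_q` with respect to `V`: the maximum over nonempty `Γ` of
`#Γ / (dim V - dim (V ∩ ⋂ j ∈ Γ, D j))`. The quotient is `0` if the intersection is empty, and `∞`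
if it is all of `V`. -/
def distributiveConstant {n q : ℕ} (V : Set (PSpace n)) (D : Fin q → Hypersurface n) : ℝ≥0∞ :=
  ⨆ Γ : {Γ : Finset (Fin q) // Γ.Nonempty},
    (Γ.1.card : ℝ≥0∞) / (codimIn V ((⋂ j ∈ Γ.1, (D j).locus) ∩ V) : ℝ≥0∞)

/-! ### The Hilbert function -/

/-- The homogeneous ideal `I(V)`: all polynomials that vanish at all homogeneous coordinates of all
points of `V`. -/
def vanishingIdeal {n : ℕ} (V : Set (PSpace n)) : Ideal (Poly n) where
  carrier := {P | ∀ (v : Fin (n + 1) → ℂ) (hv : v ≠ 0),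
    Projectivization.mk ℂ v hv ∈ V → MvPolynomial.eval v P = 0}
  zero_mem' := by intro v hv _; simp
  add_mem' := by
    intro P Q hP hQ v hv hvV
    simp [hP v hv hvV, hQ v hv hvV]
  smul_mem' := by
    intro R P hP v hv hvV
    simp [hP v hv hvV]

/-- `H_d`, the space of homogeneous polynomials of degree `d`. -/
abbrev Forms (n d : ℕ) : Submodule ℂ (Poly n) :=
  MvPolynomial.homogeneousSubmodule (Fin (n + 1)) ℂ d

/-- `I(V) ∩ H_d` as a subspace of `H_d`. -/
def vanishingForms {n : ℕ} (V : Set (PSpace n)) (d : ℕ) : Submodule ℂ (Forms n d) :=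
  ((vanishingIdeal V).restrictScalars ℂ).comap (Forms n d).subtype

/-- `I_d(V) = H_d / (I(V) ∩ H_d)`. -/
abbrev CoordPart {n : ℕ} (V : Set (PSpace n)) (d : ℕ) : Type :=
  Forms n d ⧸ vanishingForms V d

/-- The Hilbert function `H_V(d) = dim I_d(V)`. -/
def hilbertFunction {n : ℕ} (V : Set (PSpace n)) (d : ℕ) : ℕ :=
  Module.finrank ℂ (CoordPart V d)

/-! ### Holomorphic curves -/

/-- `f : ℂ → ℙⁿ(ℂ)` is holomorphic: near every point it is given in homogeneous coordinates by
holomorphic functions without common zeros. -/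
def IsHolomorphicMap {n : ℕ} (f : ℂ → PSpace n) : Prop :=
  ∀ z₀ : ℂ, ∃ F : ℂ → Fin (n + 1) → ℂ, AnalyticAt ℂ F z₀ ∧
    ∀ᶠ z in 𝓝 z₀, ∃ h : F z ≠ 0, f z = Projectivization.mk ℂ (F z) h

/-- `F` is a reduced representation of `f`: entire functions without common zeros that are
homogeneous coordinates of `f`. -/
def IsReducedRepresentation {n : ℕ} (F : ℂ → Fin (n + 1) → ℂ) (f : ℂ → PSpace n) : Prop :=
  Differentiable ℂ F ∧ ∀ z, ∃ h : F z ≠ 0, f z = Projectivization.mk ℂ (F z) h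

/-- `f` is degenerate over `I_d(V)`: some `Q` with `[Q] ≠ 0` in `I_d(V)` vanishes identically along
`f`. By `vanishesAlong_iff` the latter means `Q(F) ≡ 0` for a reduced representation `F`. -/
def DegenerateOver {n : ℕ} (V : Set (PSpace n)) (d : ℕ) (f : ℂ → PSpace n) : Prop :=
  ∃ Q : Forms n d, (Submodule.Quotient.mk Q : CoordPart V d) ≠ 0 ∧
    ∀ z, VanishesAt (Q : Poly n) (f z)

theorem vanishesAlong_iff {n d : ℕ} {f : ℂ → PSpace n} {F : ℂ → Fin (n + 1) → ℂ}
    (hF : IsReducedRepresentation F f) (Q : Forms n d) :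
    (∀ z, VanishesAt (Q : Poly n) (f z)) ↔ ∀ z, MvPolynomial.eval (F z) (Q : Poly n) = 0 := by
  refine forall_congr' fun z => ?_
  obtain ⟨h, hz⟩ := hF.2 z
  rw [hz]
  exact vanishesAt_mk Q.2 _ h

/-- `f` is nondegenerate over `I_d(V)`. -/
def NondegenerateOver {n : ℕ} (V : Set (PSpace n)) (d : ℕ) (f : ℂ → PSpace n) : Prop :=
  ¬ DegenerateOver V d f

end

end ProjCurve

open ProjCurve

/-! Suppose f ≠ g and take reduced representations F, G. Some minor P = F_i G_j - F_j G_i is not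
identically zero, yet it vanishes wherever f = g, hence on all preimages of the D_i. Write T_f(r),
T_g(r) for the means of log ‖F‖, log ‖G‖ over |z| = r. The mean of log |P| is at most T_f + T_g +
log 2, so P cannot have many zeros.

In the other direction stands a second main theorem. Let M = H_V(d), and replace each D_i by a form
Q_i of degree d with the same zeros. If at most κ of the D_i pass through any point f(a) = g(a),
then (q - ΔM) d T_f(r) ≤ (M - 1) κ · mean of log |P| + error, and likewise for g. Adding the two
contradicts 2(M - 1)κ < (q - ΔM)d. Part (a) uses κ = Δk, part (b) uses κ = 1.

For the second main theorem, evaluation along F embeds I_d(V) into the entire functions; injectivity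
is nondegeneracy, so a basis has a nonzero Wronskian W. The constant Δ enters through linear
algebra. If the D_i with i ∈ Γ meet on V and the classes of B ⊆ Γ span those of Γ, then B already
cuts out the same subset of V. By Krull's height theorem its codimension is at most #B
(`codimIn_le_card`), whence #Γ ≤ Δ #B. A greedy selection (`exists_linearIndepOn_sum_le`) turns this
into a bound of a weighted sum over all i by Δ times the sum over an independent subfamily. It is
used twice: for the orders of vanishing in excess of M - 1, which are absorbed by the zeros of W,
and for log (‖F‖^d / |Q_i(F)|), which is compared with log |W|. A compactness argument shows that
simultaneously small Q_i have a common zero on V.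

The error consists of logarithmic derivatives of quotients. They are estimated through the Poisson
representation of a zero-free quotient, with explicit dependence on a larger radius. A growth
argument in the style of Borel then yields one radius at which the error is smaller than any fixed
multiple of T_f + T_g; a single radius suffices for the contradiction. -/

open ProjCurve

/-! ### Zeros of entire functions, Jensen's formula and circle averages. -/

section EntireFunctions

open Real MeromorphicOn Metric Filter

theorem analyticOrderAt_ne_top_of_entire {h : ℂ → ℂ} (hh : Differentiable ℂ h) (h0 : h ≠ 0)
    (a : ℂ) : analyticOrderAt h a ≠ ⊤ := by
  intro ht
  rw [analyticOrderAt_eq_top] at ht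
  apply h0
  have hA : AnalyticOnNhd ℂ h Set.univ := fun z _ => hh.analyticAt z
  have := hA.eqOn_zero_of_preconnected_of_eventuallyEq_zero isPreconnected_univ (Set.mem_univ a) ht
  funext z
  exact this (Set.mem_univ z)

theorem divisor_eq_analyticOrderNatAt {h : ℂ → ℂ} (hh : Differentiable ℂ h) {U : Set ℂ}
    {a : ℂ} (ha : a ∈ U) : divisor h U a = (analyticOrderNatAt h a : ℤ) := by
  have hA : AnalyticOnNhd ℂ h U := fun z _ => hh.analyticAt z
  rw [AnalyticOnNhd.divisor_apply hA ha, analyticOrderNatAt]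
  cases analyticOrderAt h a <;> simp

theorem analyticOrderNatAt_eq_zero_iff {h : ℂ → ℂ} (hh : Differentiable ℂ h) (h0 : h ≠ 0) (a : ℂ) :
    analyticOrderNatAt h a = 0 ↔ h a ≠ 0 := by
  rw [← (hh.analyticAt a).analyticOrderAt_eq_zero,
    ← Nat.cast_analyticOrderNatAt (analyticOrderAt_ne_top_of_entire hh h0 a)]
  simp

theorem finite_zeros_closedBall {h : ℂ → ℂ} (hh : Differentiable ℂ h) (h0 : h ≠ 0) (r : ℝ) :
    {a | a ∈ closedBall (0 : ℂ) r ∧ h a = 0}.Finite := by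
  refine ((divisor h (closedBall 0 r)).finiteSupport (isCompact_closedBall 0 r)).subset ?_
  rintro a ⟨ha, hz⟩
  rw [Function.mem_support, divisor_eq_analyticOrderNatAt hh ha]
  have := (analyticOrderNatAt_eq_zero_iff hh h0 a).not_left.2 hz
  exact_mod_cast this

theorem countable_zeros {h : ℂ → ℂ} (hh : Differentiable ℂ h) (h0 : h ≠ 0) :
    {a | h a = 0}.Countable := by
  have : {a | h a = 0} = ⋃ n : ℕ, {a | a ∈ closedBall (0 : ℂ) n ∧ h a = 0} := by
    ext a
    simp only [Set.mem_ofPred_eq, Set.mem_iUnion, mem_closedBall, dist_zero_right]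
    obtain ⟨n, hn⟩ := exists_nat_ge ‖a‖
    exact ⟨fun h => ⟨n, hn, h⟩, fun ⟨_, _, h⟩ => h⟩
  rw [this]
  exact Set.countable_iUnion fun n => (finite_zeros_closedBall hh h0 n).countable

/-- Jensen's formula, as a sum over any finite set containing the zeros. -/
theorem circleAverage_log_norm_entire {h : ℂ → ℂ} (hh : Differentiable ℂ h) (h0 : h ≠ 0) {r : ℝ}
    (hr : 0 < r) (s : Finset ℂ) (hs : ∀ a ∈ closedBall (0 : ℂ) r, h a = 0 → a ∈ s)
    (hs' : ∀ a ∈ s, a ∈ closedBall (0 : ℂ) r) :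
    circleAverage (fun z => log ‖h z‖) 0 r =
      ∑ a ∈ s, (analyticOrderNatAt h a : ℝ) * log (r * ‖a‖⁻¹) +
        (analyticOrderNatAt h 0 : ℝ) * log r + log ‖meromorphicTrailingCoeffAt h 0‖ := by
  have hA : MeromorphicOn h (closedBall 0 |r|) := fun z _ => (hh.analyticAt z).meromorphicAt
  have := MeromorphicOn.circleAverage_log_norm hr.ne' hA
  rw [this, divisor_eq_analyticOrderNatAt hh (by simp)]
  rw [abs_of_pos hr]
  congr 2
  rw [finsum_eq_sum_of_support_subset (s := s)]
  · refine Finset.sum_congr rfl fun a ha => ?_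
    rw [divisor_eq_analyticOrderNatAt hh (hs' a ha)]
    simp
  · intro a ha
    rw [Function.mem_support] at ha
    have h1 : divisor h (closedBall 0 r) a ≠ 0 := by
      intro h1; simp [h1] at ha
    have h2 := (divisor h (closedBall 0 r)).supportWithinDomain (Function.mem_support.2 h1)
    refine hs a h2 ?_
    rw [divisor_eq_analyticOrderNatAt hh h2] at h1
    exact (analyticOrderNatAt_eq_zero_iff hh h0 a).not_left.1 (by exact_mod_cast h1)

/-- If a real combination of the zero divisors of entire functions is effective, then the
corresponding combination of the mean values of `log |h|` is bounded below. -/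
theorem exists_le_sum_circleAverage_log_norm {ι : Type*} (s : Finset ι) (h : ι → ℂ → ℂ) (c : ι → ℝ)
    (hh : ∀ i ∈ s, Differentiable ℂ (h i)) (h0 : ∀ i ∈ s, h i ≠ 0)
    (hc : ∀ a, 0 ≤ ∑ i ∈ s, c i * (analyticOrderNatAt (h i) a : ℝ)) :
    ∃ C : ℝ, ∀ r : ℝ, 1 ≤ r → C ≤ ∑ i ∈ s, c i * circleAverage (fun z => log ‖h i z‖) 0 r := by
  -- The constant terms of Jensen's formula. The other terms pair the effective combination with log
  -- (r/|a|) and log r, which are nonnegative for |a| ≤ r and r ≥ 1.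
  refine ⟨∑ i ∈ s, c i * log ‖meromorphicTrailingCoeffAt (h i) 0‖, fun r hr => ?_⟩
  have hr0 : 0 < r := by linarith
  let t : Finset ℂ := (s.finite_toSet.biUnion (t := fun i =>
    {a | a ∈ closedBall (0 : ℂ) r ∧ h i a = 0}) (fun i hi => finite_zeros_closedBall (hh i hi) (h0 i hi) r)).toFinset
  have ht : ∀ i ∈ s, circleAverage (fun z => log ‖h i z‖) 0 r =
      ∑ a ∈ t, (analyticOrderNatAt (h i) a : ℝ) * log (r * ‖a‖⁻¹) +
        (analyticOrderNatAt (h i) 0 : ℝ) * log r + log ‖meromorphicTrailingCoeffAt (h i) 0‖ := by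
    intro i hi
    refine circleAverage_log_norm_entire (hh i hi) (h0 i hi) hr0 t ?_ ?_
    · intro a ha hz
      simp only [t, Set.Finite.mem_toFinset, Set.mem_iUnion]
      exact ⟨i, hi, ha, hz⟩
    · intro a ha
      simp only [t, Set.Finite.mem_toFinset, Set.mem_iUnion] at ha
      obtain ⟨i, hi, ha, hz⟩ := ha
      exact ha
  have e0 : ∑ i ∈ s, c i * circleAverage (fun z => log ‖h i z‖) 0 r = _ :=
    Finset.sum_congr rfl fun i hi => by rw [ht i hi]
  have e : ∑ i ∈ s, c i * (∑ a ∈ t, (analyticOrderNatAt (h i) a : ℝ) * log (r * ‖a‖⁻¹) +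
        (analyticOrderNatAt (h i) 0 : ℝ) * log r + log ‖meromorphicTrailingCoeffAt (h i) 0‖)
      = ∑ a ∈ t, (∑ i ∈ s, c i * (analyticOrderNatAt (h i) a : ℝ)) * log (r * ‖a‖⁻¹) +
        (∑ i ∈ s, c i * (analyticOrderNatAt (h i) 0 : ℝ)) * log r +
          ∑ i ∈ s, c i * log ‖meromorphicTrailingCoeffAt (h i) 0‖ := by
    simp only [Finset.sum_mul, mul_add, Finset.sum_add_distrib, Finset.mul_sum, mul_assoc]
    rw [Finset.sum_comm]
  rw [e0, e]
  have h1 : 0 ≤ (∑ i ∈ s, c i * (analyticOrderNatAt (h i) 0 : ℝ)) * log r :=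
    mul_nonneg (hc 0) (log_nonneg hr)
  have h2 : 0 ≤ ∑ a ∈ t, (∑ i ∈ s, c i * (analyticOrderNatAt (h i) a : ℝ)) * log (r * ‖a‖⁻¹) := by
    refine Finset.sum_nonneg fun a ha => mul_nonneg (hc a) ?_
    simp only [t, Set.Finite.mem_toFinset, Set.mem_iUnion] at ha
    obtain ⟨i, hi, ha, hz⟩ := ha
    rcases eq_or_ne a 0 with rfl | ha0
    · simp
    · apply log_nonneg
      have : ‖a‖ ≤ r := by simpa using ha
      rw [← div_eq_mul_inv, le_div_iff₀ (norm_pos_iff.2 ha0)]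
      linarith
  linarith

theorem exists_le_circleAverage_log_norm {h : ℂ → ℂ} (hh : Differentiable ℂ h) (h0 : h ≠ 0) :
    ∃ C : ℝ, ∀ r : ℝ, 1 ≤ r → C ≤ circleAverage (fun z => log ‖h z‖) 0 r := by
  simpa using exists_le_sum_circleAverage_log_norm {()} (fun _ => h) (fun _ => 1)
    (by simpa using hh) (by simpa using h0) (by intro a; simp)

theorem circleIntegrable_log_norm_entire {h : ℂ → ℂ} (hh : Differentiable ℂ h) (r : ℝ) :
    CircleIntegrable (fun z => log ‖h z‖) 0 r :=
  MeromorphicOn.circleIntegrable_log_norm fun z _ => (hh.analyticAt z).meromorphicAt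

theorem circleIntegrable_posLog_norm_div {h k : ℂ → ℂ} (hh : Differentiable ℂ h)
    (hk : Differentiable ℂ k) (r : ℝ) :
    CircleIntegrable (fun z => log⁺ ‖h z / k z‖) 0 r :=
  MeromorphicOn.circleIntegrable_posLog_norm fun z _ =>
    (hh.analyticAt z).meromorphicAt.div (hk.analyticAt z).meromorphicAt

/-- Monotonicity of circle averages for functions compared off a countable set. -/
theorem circleAverage_mono_off_countable {f g : ℂ → ℝ} {r : ℝ} (hr : r ≠ 0)
    (hf : CircleIntegrable f 0 r) (hg : CircleIntegrable g 0 r) {s : Set ℂ} (hs : s.Countable)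
    (h : ∀ z, z ∉ s → ‖z‖ = |r| → f z ≤ g z) : circleAverage f 0 r ≤ circleAverage g 0 r := by
  rw [circleAverage, circleAverage]
  simp only [smul_eq_mul]
  refine mul_le_mul_of_nonneg_left ?_ (by positivity)
  refine intervalIntegral.integral_mono_ae (by positivity) hf hg ?_
  have : (circleMap 0 r ⁻¹' s).Countable := hs.preimage_circleMap 0 hr
  filter_upwards [this.ae_notMem MeasureTheory.volume] with θ hθ
  exact h _ hθ (by simp)

/-- The tangent line estimate for the logarithm: an integral form of its concavity. -/
theorem circleAverage_log_le_of_le {f y : ℂ → ℝ} {r Y : ℝ} (hr : r ≠ 0)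
    (hf : CircleIntegrable f 0 r) (hy : CircleIntegrable y 0 r) (hY : 0 < Y)
    (hav : circleAverage y 0 r ≤ Y) {s : Set ℂ} (hs : s.Countable)
    (h : ∀ z, z ∉ s → ‖z‖ = |r| → 0 < y z ∧ f z ≤ log (y z)) :
    circleAverage f 0 r ≤ log Y := by
  -- The tangent of the logarithm at Y: log y ≤ log Y - 1 + y/Y.
  have h1 : circleAverage f 0 r ≤ circleAverage (fun z => (log Y - 1) + Y⁻¹ • y z) 0 r := by
    refine circleAverage_mono_off_countable hr hf
      ((circleIntegrable_const _ _ _).add (hy.const_smul)) hs fun z hz hzr => ?_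
    obtain ⟨h0, h1⟩ := h z hz hzr
    have h2 : log (y z) = log Y + log (Y⁻¹ * y z) := by
      rw [log_mul (by positivity) (by positivity), log_inv]; ring
    have h3 := log_le_sub_one_of_pos (show 0 < Y⁻¹ * y z by positivity)
    simp only [smul_eq_mul]
    linarith
  refine h1.trans ?_
  rw [circleAverage_fun_add (f₂ := fun z => Y⁻¹ • y z) (circleIntegrable_const _ _ _)
    (hy.const_smul), circleAverage_const,
    circleAverage_fun_smul, smul_eq_mul]
  have : Y⁻¹ * circleAverage y 0 r ≤ 1 := by
    rw [inv_mul_le_iff₀ hY]; linarith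
  linarith

end EntireFunctions

/-! ### Local estimates for the logarithmic derivative. -/

section LogarithmicDerivative

open Real MeromorphicOn Metric Filter

/-- Rotate a to the positive axis and put c = 1 - cos t. The squared distance is (r - |a|)² +
2r|a|c; since c ≤ 2, this is at least (c/2)(r + |a|)² ≥ cr²/2, and c ≥ 2t²/π². The bound does not
involve |a|. -/
theorem sq_mul_sq_le_norm_circleMap_sub_sq {r : ℝ} (hr : 0 ≤ r) (a : ℂ) {t : ℝ} (ht : |t| ≤ π) :
    (r * |t| / π) ^ 2 ≤ ‖circleMap 0 r (t + a.arg) - a‖ ^ 2 := by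
  have e : circleMap 0 r (t + a.arg) - a
      = Complex.exp (a.arg * Complex.I) * (r * Complex.exp (t * Complex.I) - ‖a‖) := by
    have ha := Complex.norm_mul_exp_arg_mul_I a
    simp only [circleMap, zero_add, Complex.ofReal_add, add_mul, Complex.exp_add]
    linear_combination ha
  rw [e, norm_mul, Complex.norm_exp_ofReal_mul_I, one_mul, Complex.sq_norm, Complex.normSq_apply]
  have h1 : (r * Complex.exp (t * Complex.I) - ‖a‖ : ℂ).re = r * cos t - ‖a‖ := by
    simp [Complex.exp_ofReal_mul_I_re]
  have h2 : (r * Complex.exp (t * Complex.I) - ‖a‖ : ℂ).im = r * sin t := by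
    simp [Complex.exp_ofReal_mul_I_im]
  rw [h1, h2]
  have h3 := cos_le_one_sub_mul_cos_sq ht
  have h4 := sin_sq_add_cos_sq t
  have h5 : (r * |t| / π) ^ 2 = r ^ 2 * ((2 / π ^ 2 * t ^ 2) / 2) := by
    rw [div_pow, mul_pow, sq_abs]; field_simp
  rw [h5]
  set c := 1 - cos t with hc
  have hc0 : 0 ≤ c := by linarith [cos_le_one t]
  have hc2 : c ≤ 2 := by linarith [neg_one_le_cos t]
  have h6 : r ^ 2 * ((2 / π ^ 2 * t ^ 2) / 2) ≤ r ^ 2 * (c / 2) := by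
    gcongr; linarith
  have ha := norm_nonneg a
  have h7 : cos t = 1 - c := by linarith
  have h8 : (r * cos t - ‖a‖) * (r * cos t - ‖a‖) + r * sin t * (r * sin t)
      = (r - ‖a‖) ^ 2 + 2 * r * ‖a‖ * c := by
    have : sin t ^ 2 = 1 - cos t ^ 2 := by linarith
    rw [h7] at this ⊢
    linear_combination r ^ 2 * this
  rw [h8]
  have h9 : 0 ≤ (1 - c / 2) * (r - ‖a‖) ^ 2 := mul_nonneg (by linarith) (sq_nonneg _)
  have h10 : 0 ≤ c * r * ‖a‖ := by positivity
  have h11 : 0 ≤ c * ‖a‖ ^ 2 := by positivity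
  nlinarith

/-- The exponent -1/2 makes the singularity integrable, and for r ≥ 1 the preceding bound dominates
the integrand by the fixed function (|t|/π)^(-1/2), with t measured from the argument of a.
Uniformity in a allows sums over zeros to be averaged term by term. -/
theorem exists_circleAverage_norm_sub_rpow_le :
    ∃ C : ℝ, 0 < C ∧ ∀ r : ℝ, 1 ≤ r → ∀ a : ℂ,
      CircleIntegrable (fun z => ‖z - a‖ ^ (-(1 / 2) : ℝ)) 0 r ∧
        circleAverage (fun z => ‖z - a‖ ^ (-(1 / 2) : ℝ)) 0 r ≤ C := by
  set k : ℝ → ℝ := fun t => (|t| / π) ^ (-(1 / 2) : ℝ) with hk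
  have hπ := pi_pos
  have hkint : IntervalIntegrable k MeasureTheory.volume (-π) π := by
    have h0 : IntervalIntegrable k MeasureTheory.volume 0 π := by
      have := (intervalIntegral.intervalIntegrable_rpow' (a := 0) (b := π)
        (r := (-(1 / 2) : ℝ)) (by norm_num)).const_mul ((1 / π) ^ (-(1 / 2) : ℝ))
      refine this.congr ?_
      intro t ht
      rw [Set.uIoc_of_le hπ.le] at ht
      simp only [hk]
      rw [abs_of_pos ht.1, ← mul_rpow (by positivity) ht.1.le]
      congr 1; ring
    refine IntervalIntegrable.trans (b := 0) ?_ h0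
    have := (IntervalIntegrable.iff_comp_neg (f := k) (a := 0) (b := π)).1 h0
    simp only [hk, abs_neg, neg_zero] at this ⊢
    exact this.symm
  refine ⟨(2 * π)⁻¹ * (∫ t in (-π)..π, k t) + 1, ?_, fun r hr a => ?_⟩
  · have : 0 ≤ ∫ t in (-π)..π, k t :=
      intervalIntegral.integral_nonneg (by linarith) fun t _ => by positivity
    positivity
  set f : ℝ → ℝ := fun θ => ‖circleMap 0 r θ - a‖ ^ (-(1 / 2) : ℝ) with hf
  have hper : Function.Periodic f (2 * π) := fun θ => by
    simp only [hf]; rw [periodic_circleMap]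
  have hle : ∀ t, t ≠ 0 → |t| ≤ π → f (t + a.arg) ≤ k t := by
    intro t ht0 ht
    simp only [hf, hk]
    have h1 := sq_mul_sq_le_norm_circleMap_sub_sq (by linarith : (0 : ℝ) ≤ r) a ht
    have h2 : r * |t| / π ≤ ‖circleMap 0 r (t + a.arg) - a‖ :=
      (pow_le_pow_iff_left₀ (by positivity) (norm_nonneg _) two_ne_zero).1 h1
    have h3 : |t| / π ≤ r * |t| / π := by
      gcongr; nlinarith [abs_nonneg t]
    exact rpow_le_rpow_of_nonpos (by positivity) (h3.trans h2) (by norm_num)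
  have hae : ∀ᵐ t ∂(MeasureTheory.volume.restrict (Set.uIoc (-π) π)), f (t + a.arg) ≤ k t := by
    rw [MeasureTheory.ae_restrict_iff' measurableSet_uIoc]
    filter_upwards [(Set.countable_singleton (0 : ℝ)).ae_notMem MeasureTheory.volume] with t h0 ht
    rw [Set.uIoc_of_le (by linarith)] at ht
    exact hle t (by simpa using h0) (abs_le.2 ⟨ht.1.le, ht.2⟩)
  have hmeas : Measurable f := by
    simp only [hf]
    exact (((continuous_circleMap 0 r).sub continuous_const).norm).measurable.pow_const _
  have hint : IntervalIntegrable (fun t => f (t + a.arg)) MeasureTheory.volume (-π) π := by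
    refine hkint.mono_fun' ((hmeas.comp (measurable_id.add_const _)).aestronglyMeasurable) ?_
    filter_upwards [hae] with t ht
    rw [norm_of_nonneg (by simp only [hf]; positivity)]
    exact ht
  have hint2 : IntervalIntegrable f MeasureTheory.volume (-π + a.arg) (-π + a.arg + 2 * π) := by
    have := (IntervalIntegrable.comp_add_right_iff (f := f) (a := -π) (b := π) (c := a.arg)).1 hint
    convert this using 1; ring
  refine ⟨hper.intervalIntegrable (by positivity) hint2 _ _, ?_⟩
  rw [circleAverage]
  have e : ∫ θ in (0 : ℝ)..2 * π, ‖circleMap 0 r θ - a‖ ^ (-(1 / 2) : ℝ)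
      = ∫ t in (-π)..π, f (t + a.arg) := by
    rw [intervalIntegral.integral_comp_add_right]
    have := hper.intervalIntegral_add_eq 0 (-π + a.arg)
    rw [zero_add] at this
    rw [show π + a.arg = -π + a.arg + 2 * π by ring]
    exact this
  rw [e, smul_eq_mul]
  have : ∫ t in (-π)..π, f (t + a.arg) ≤ ∫ t in (-π)..π, k t :=
    intervalIntegral.integral_mono_ae_restrict (by linarith) hint hkint (by
      rw [Set.uIoc_of_le (by linarith)] at hae
      rwa [← MeasureTheory.Measure.restrict_congr_set MeasureTheory.Ioc_ae_eq_Icc])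
  have h2 : (2 * π)⁻¹ * ∫ t in (-π)..π, f (t + a.arg) ≤ (2 * π)⁻¹ * ∫ t in (-π)..π, k t := by
    gcongr
  linarith

/-- The derivative of the Poisson representation of `log |g|`. -/
theorem norm_deriv_div_le_of_ne_zero {g : ℂ → ℂ} {R r : ℝ} (hg : AnalyticOnNhd ℂ g (closedBall 0 R))
    (hrR : r < R) (h0 : ∀ z ∈ closedBall (0 : ℂ) R, g z ≠ 0) {z : ℂ} (hz : ‖z‖ ≤ r) :
    ‖deriv g z / g z‖ ≤ 2 * R / (R - r) ^ 2 * circleAverage (fun ζ => |log ‖g ζ‖|) 0 R := by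
  have hr0 : 0 ≤ r := (norm_nonneg z).trans hz
  have hR : 0 < R := by linarith
  have hzB : z ∈ ball (0 : ℂ) R := by simpa using hz.trans_lt hrR
  set u : ℂ → ℝ := fun ζ => log ‖g ζ‖ with hu
  have hui : CircleIntegrable u 0 R := MeromorphicOn.circleIntegrable_log_norm fun z hz =>
    (hg z (by rw [abs_of_pos hR] at hz; exact sphere_subset_closedBall hz)).meromorphicAt
  have huc : CircleIntegrable (fun ζ => (u ζ : ℂ)) 0 R := by
    simp only [CircleIntegrable, intervalIntegrable_iff] at hui ⊢
    exact Complex.ofRealCLM.integrable_comp hui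
  -- The Herglotz integral of log |g|: holomorphic in the disc, with real part log |g|.
  set G : ℂ → ℂ := fun w => circleAverage (fun ζ => herglotzRieszKernel 0 w ζ • (u ζ : ℂ)) 0 R with hG
  have hre : ∀ w ∈ ball (0 : ℂ) R, (G w).re = u w := by
    intro w hw
    simp only [hG]
    rw [re_circleAverage_herglotzRieszKernel_smul hui hw]
    refine InnerProductSpace.HarmonicOnNhd.circleAverage_re_herglotzRieszKernel_smul ?_ hw
    exact fun x hx => (hg x hx).harmonicAt_log_norm (h0 x hx)
  have hder : ∀ w ∈ ball (0 : ℂ) R, HasDerivAt G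
      (circleAverage (fun ζ => (2 * ζ / (ζ - w) ^ 2) • (u ζ : ℂ)) 0 R) w := fun w hw =>
    hasDerivAt_circleAverage_herglotzRieszKernel_smul huc hw
  have hGd : DifferentiableOn ℂ G (ball 0 R) := fun w hw =>
    (hder w hw).differentiableAt.differentiableWithinAt
  -- This function has modulus 1, so it is constant by the maximum principle. Its vanishing
  -- derivative says that g'/g = G'.
  set Φ : ℂ → ℂ := fun w => g w * Complex.exp (-G w) with hΦ
  have hΦd : DifferentiableOn ℂ Φ (ball 0 R) :=
    (hg.differentiableOn.mono ball_subset_closedBall).mul hGd.neg.cexp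
  have hnorm : ∀ w ∈ ball (0 : ℂ) R, ‖Φ w‖ = 1 := by
    intro w hw
    have hgw : 0 < ‖g w‖ := norm_pos_iff.2 (h0 w (ball_subset_closedBall hw))
    simp only [hΦ, norm_mul, Complex.norm_exp, Complex.neg_re, hre w hw, hu]
    rw [exp_neg, exp_log hgw, mul_inv_cancel₀ hgw.ne']
  have hconst : Set.EqOn Φ (Function.const ℂ (Φ z)) (ball 0 R) := by
    refine Complex.eqOn_of_isPreconnected_of_isMaxOn_norm (convex_ball _ _).isPreconnected
      isOpen_ball hΦd hzB ?_
    intro w hw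
    simp [hnorm w hw, hnorm z hzB]
  have hd1 : HasDerivAt Φ 0 z := by
    refine (hasDerivAt_const z (Φ z)).congr_of_eventuallyEq ?_
    filter_upwards [isOpen_ball.mem_nhds hzB] with w hw using hconst hw
  have hd2 : HasDerivAt Φ _ z :=
    (hg z (ball_subset_closedBall hzB)).differentiableAt.hasDerivAt.mul ((hder z hzB).neg.cexp)
  have hd3 := hd1.unique hd2
  have hgz : g z ≠ 0 := h0 z (ball_subset_closedBall hzB)
  have hkey : deriv g z / g z = circleAverage (fun ζ => (2 * ζ / (ζ - z) ^ 2) • (u ζ : ℂ)) 0 R := by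
    rw [div_eq_iff hgz]
    have := Complex.exp_ne_zero (-G z)
    apply mul_right_cancel₀ this
    linear_combination -hd3
  rw [hkey]
  have hle : ‖circleAverage (fun ζ => (2 * ζ / (ζ - z) ^ 2) • (u ζ : ℂ)) 0 R‖ ≤
      circleAverage (fun ζ => 2 * R / (R - r) ^ 2 * |u ζ|) 0 R := by
    simp only [circleAverage]
    rw [norm_smul, norm_of_nonneg (by positivity : 0 ≤ (2 * π)⁻¹), smul_eq_mul]
    refine mul_le_mul_of_nonneg_left ?_ (by positivity)
    refine intervalIntegral.norm_integral_le_of_norm_le (by positivity) (Eventually.of_forall ?_) ?_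
    · intro θ _
      have h1 : ‖circleMap 0 R θ‖ = R := by simp [abs_of_pos hR]
      have h2 : R - r ≤ ‖circleMap 0 R θ - z‖ := by
        have := norm_sub_norm_le (circleMap 0 R θ) z
        linarith
      have h3 : 0 < R - r := by linarith
      rw [norm_smul, norm_div, norm_mul, norm_pow, h1, Complex.norm_real, Complex.norm_ofNat,
        norm_eq_abs]
      gcongr
    · exact (hui.abs).const_smul (a := 2 * R / (R - r) ^ 2)
  refine hle.trans ?_
  have := circleAverage_fun_smul (a := 2 * R / (R - r) ^ 2) (f := fun ζ => |u ζ|) (c := 0) (R := R)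
  simp only [smul_eq_mul] at this
  rw [this]

/-- Division of an entire function by its zeros in a finite set. -/
theorem exists_entire_factorization {h : ℂ → ℂ} (hh : Differentiable ℂ h) (h0 : h ≠ 0)
    (Z : Finset ℂ) : ∃ g : ℂ → ℂ, Differentiable ℂ g ∧
      (∀ z, h z = (∏ a ∈ Z, (z - a) ^ analyticOrderNatAt h a) * g z) ∧ ∀ a ∈ Z, g a ≠ 0 := by
  classical
  induction Z using Finset.induction_on with
  | empty => exact ⟨h, hh, by simp, by simp⟩
  | insert b Z hb ih =>
    obtain ⟨g, hg, hfac, hne⟩ := ih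
    have hob := analyticOrderAt_ne_top_of_entire hh h0 b
    obtain ⟨k, hk, hkb, hkeq⟩ := (hh.analyticAt b).analyticOrderAt_ne_top.1 hob
    set n := analyticOrderNatAt h b
    set p : ℂ → ℂ := fun z => ∏ a ∈ Z, (z - a) ^ analyticOrderNatAt h a with hp
    have hpd : Differentiable ℂ p := by
      simp only [hp]; fun_prop
    have hpb : p b ≠ 0 := Finset.prod_ne_zero_iff.2 fun a ha =>
      pow_ne_zero _ (sub_ne_zero.2 fun hab => hb (hab ▸ ha))
    set q : ℂ → ℂ := fun z => k z / p z with hq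
    have hqa : AnalyticAt ℂ q b := hk.div (hpd.analyticAt b) hpb
    have hgq : ∀ᶠ z in 𝓝 b, g z = (z - b) ^ n * q z := by
      filter_upwards [hkeq, hpd.continuous.continuousAt.eventually_ne hpb] with z hz hpz
      have := hfac z
      rw [hz, smul_eq_mul] at this
      simp only [hq]
      rw [mul_div_assoc', this, mul_div_cancel_left₀ _ hpz]
    -- The quotient by (z - b)^n, with its removable singularity at b filled by the local factor q.
    set g' : ℂ → ℂ := fun z => if z = b then q b else g z / (z - b) ^ n with hg'
    have hg'q : g' =ᶠ[𝓝 b] q := by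
      filter_upwards [hgq] with z hz
      by_cases hzb : z = b
      · simp [hg', hzb]
      · have : z - b ≠ 0 := sub_ne_zero.2 hzb
        simp only [hg', hzb, if_false, hz]
        field_simp
    have hg'ne : ∀ z, z ≠ b → g' =ᶠ[𝓝 z] fun w => g w / (w - b) ^ n := by
      intro z hz
      filter_upwards [isOpen_ne.mem_nhds hz] with w hw
      simp only [hg', if_neg hw]
    refine ⟨g', fun z => ?_, fun z => ?_, fun a ha => ?_⟩
    · by_cases hzb : z = b
      · subst hzb
        exact hqa.differentiableAt.congr_of_eventuallyEq hg'q
      · refine DifferentiableAt.congr_of_eventuallyEq ?_ (hg'ne z hzb)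
        exact (hg z).div (by fun_prop) (pow_ne_zero _ (sub_ne_zero.2 hzb))
    · rw [Finset.prod_insert hb]
      by_cases hzb : z = b
      · subst hzb
        have h1 := hfac z
        rw [hgq.self_of_nhds] at h1
        simp only [hg', if_true]
        rw [h1]; ring
      · have : z - b ≠ 0 := sub_ne_zero.2 hzb
        simp only [hg', hzb, if_false]
        rw [hfac z, show analyticOrderNatAt h b = n from rfl]
        field_simp
    · rcases Finset.mem_insert.1 ha with rfl | ha
      · simp only [hg', if_true, hq]
        exact div_ne_zero hkb hpb
      · have hab : a ≠ b := fun hab => hb (hab ▸ ha)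
        simp only [hg', if_neg hab]
        exact div_ne_zero (hne a ha) (pow_ne_zero _ (sub_ne_zero.2 hab))

end LogarithmicDerivative

/-! ### The lemma on the logarithmic derivative. -/

section LogarithmicDerivativeLemma

open Real MeromorphicOn Metric Filter

theorem abs_log_eq_two_mul_posLog_sub (x : ℝ) : |log x| = 2 * log⁺ x - log x := by
  have := posLog_sub_posLog_inv (x := x)
  have h2 := half_mul_log_add_log_abs (x := x)
  linarith

theorem logDeriv_eq_sum_add {h g : ℂ → ℂ} {Z : Finset ℂ} {n : ℂ → ℕ} (hg : Differentiable ℂ g)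
    (hfac : ∀ z, h z = (∏ a ∈ Z, (z - a) ^ n a) * g z) {z : ℂ} (hz : z ∉ Z) (hgz : g z ≠ 0) :
    deriv h z / h z = ∑ a ∈ Z, (n a : ℂ) / (z - a) + deriv g z / g z := by
  have hza : ∀ a ∈ Z, z - a ≠ 0 := fun a ha => sub_ne_zero.2 fun e => hz (e ▸ ha)
  have h1 : h = fun z => (∏ a ∈ Z, (z - a) ^ n a) * g z := funext hfac
  have e1 : ∀ f : ℂ → ℂ, deriv f z / f z = logDeriv f z := fun f => by rw [logDeriv_apply]
  rw [e1, e1, h1, logDeriv_mul z (Finset.prod_ne_zero_iff.2 fun a ha => pow_ne_zero _ (hza a ha)) hgz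
    (by fun_prop) (hg z)]
  congr 1
  rw [logDeriv_prod (s := Z) (f := fun a w => (w - a) ^ n a) (x := z)
    (hf := fun a ha => pow_ne_zero _ (hza a ha)) (hd := fun a _ => by fun_prop)]
  refine Finset.sum_congr rfl fun a ha => ?_
  rw [logDeriv_fun_pow (by fun_prop), logDeriv_apply]
  simp [div_eq_mul_inv]

/-- The number of zeros in a disc is controlled by the mean on a larger circle. -/
theorem sum_order_mul_log_le {h : ℂ → ℂ} (hh : Differentiable ℂ h) (h0 : h ≠ 0) {R ρ : ℝ}
    (hR : 1 ≤ R) (hRρ : R ≤ ρ) (Z : Finset ℂ)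
    (hZ : ∀ a, a ∈ Z ↔ a ∈ closedBall (0 : ℂ) R ∧ h a = 0) :
    (∑ a ∈ Z, (analyticOrderNatAt h a : ℝ)) * log (ρ / R) ≤
      circleAverage (fun z => log ‖h z‖) 0 ρ - log ‖meromorphicTrailingCoeffAt h 0‖ := by
  have hρ : 0 < ρ := by linarith
  set S := (finite_zeros_closedBall hh h0 ρ).toFinset with hS
  have hmem : ∀ a, a ∈ S ↔ a ∈ closedBall (0 : ℂ) ρ ∧ h a = 0 := fun a => by simp [hS]
  rw [circleAverage_log_norm_entire hh h0 hρ S (fun a ha hz => (hmem a).2 ⟨ha, hz⟩)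
    (fun a ha => ((hmem a).1 ha).1)]
  have hZS : Z ⊆ S := fun a ha => (hmem a).2
    ⟨closedBall_subset_closedBall hRρ ((hZ a).1 ha).1, ((hZ a).1 ha).2⟩
  have hlogρ : log (ρ / R) ≤ log ρ := log_le_log (by positivity) (div_le_self hρ.le hR)
  have hlog0 : 0 ≤ log (ρ / R) := log_nonneg ((one_le_div (by linarith)).2 hRρ)
  have hterm : ∀ a ∈ S, 0 ≤ (analyticOrderNatAt h a : ℝ) * log (ρ * ‖a‖⁻¹) := by
    intro a ha
    refine mul_nonneg (by positivity) ?_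
    rcases eq_or_ne a 0 with rfl | ha0
    · simp
    · have : ‖a‖ ≤ ρ := by simpa using ((hmem a).1 ha).1
      exact log_nonneg (by rw [← div_eq_mul_inv]; exact (one_le_div (norm_pos_iff.2 ha0)).2 this)
  have hsum : ∑ a ∈ Z, (analyticOrderNatAt h a : ℝ) * log (ρ * ‖a‖⁻¹) ≤
      ∑ a ∈ S, (analyticOrderNatAt h a : ℝ) * log (ρ * ‖a‖⁻¹) :=
    Finset.sum_le_sum_of_subset_of_nonneg hZS fun a ha _ => hterm a ha
  have hmain : (∑ a ∈ Z, (analyticOrderNatAt h a : ℝ)) * log (ρ / R) ≤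
      ∑ a ∈ Z, (analyticOrderNatAt h a : ℝ) * log (ρ * ‖a‖⁻¹) +
        (analyticOrderNatAt h 0 : ℝ) * log ρ := by
    have hle : ∀ a ∈ Z, a ≠ 0 → (analyticOrderNatAt h a : ℝ) * log (ρ / R) ≤
        (analyticOrderNatAt h a : ℝ) * log (ρ * ‖a‖⁻¹) := by
      intro a ha ha0
      have h1 : ‖a‖ ≤ R := by simpa using ((hZ a).1 ha).1
      have h2 := norm_pos_iff.2 ha0
      refine mul_le_mul_of_nonneg_left (log_le_log (by positivity) ?_) (by positivity)
      rw [← div_eq_mul_inv]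
      gcongr
    rw [Finset.sum_mul]
    by_cases h0Z : (0 : ℂ) ∈ Z
    -- A zero at the origin is counted by the log ρ term of Jensen's formula; its summand is 0,
    -- since log (ρ · 0⁻¹) = log 0 = 0 by convention.
    · rw [← Finset.add_sum_erase _ _ h0Z, ← Finset.add_sum_erase _ _ h0Z]
      have := Finset.sum_le_sum (s := Z.erase 0) fun a ha =>
        hle a (Finset.mem_of_mem_erase ha) (Finset.ne_of_mem_erase ha)
      have h3 : (analyticOrderNatAt h 0 : ℝ) * log (ρ / R) ≤ (analyticOrderNatAt h 0 : ℝ) * log ρ :=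
        mul_le_mul_of_nonneg_left hlogρ (by positivity)
      simp only [norm_zero, inv_zero, mul_zero, log_zero]
      linarith
    · have := Finset.sum_le_sum (s := Z) fun a ha => hle a ha fun e => h0Z (e ▸ ha)
      have h3 : 0 ≤ (analyticOrderNatAt h 0 : ℝ) * log ρ := by
        have : 0 ≤ log ρ := log_nonneg (hR.trans hRρ)
        positivity
      linarith
  linarith

theorem log_norm_eq_sum_add {h g : ℂ → ℂ} {Z : Finset ℂ} {n : ℂ → ℕ}
    (hfac : ∀ z, h z = (∏ a ∈ Z, (z - a) ^ n a) * g z) {z : ℂ} (hz : z ∉ Z) (hgz : g z ≠ 0) :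
    log ‖h z‖ = ∑ a ∈ Z, (n a : ℝ) * log ‖z - a‖ + log ‖g z‖ := by
  have hza : ∀ a ∈ Z, z - a ≠ 0 := fun a ha => sub_ne_zero.2 fun e => hz (e ▸ ha)
  rw [hfac z, norm_mul, norm_prod, log_mul _ (norm_ne_zero_iff.2 hgz), log_prod]
  · congr 1
    refine Finset.sum_congr rfl fun a _ => ?_
    rw [norm_pow, log_pow]
  · exact fun a ha => norm_ne_zero_iff.2 (pow_ne_zero _ (hza a ha))
  · exact Finset.prod_ne_zero_iff.2 fun a ha => norm_ne_zero_iff.2 (pow_ne_zero _ (hza a ha))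

/-- Here g and k are what remains of ψ and φ after the zeros in Z are divided out. Write |log x| = 2
log⁺ x - log x, both for |ψ/φ| and for each |z - a|. As |z - a| ≤ 2R, and log |z - a| has mean log R
≥ 0 when |a| ≤ R, each zero costs at most 2 log (2R). -/
theorem circleAverage_abs_log_quotient_le {ψ φ g k : ℂ → ℂ} (hψ : Differentiable ℂ ψ)
    (hφ : Differentiable ℂ φ) (hg : Differentiable ℂ g) (hk : Differentiable ℂ k)
    {Z : Finset ℂ} {n m : ℂ → ℕ} (hψfac : ∀ z, ψ z = (∏ a ∈ Z, (z - a) ^ n a) * g z)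
    (hφfac : ∀ z, φ z = (∏ a ∈ Z, (z - a) ^ m a) * k z) {R : ℝ} (hR1 : 1 ≤ R)
    (hZ : ∀ a ∈ Z, a ∈ closedBall (0 : ℂ) R) (hg0 : ∀ z ∈ closedBall (0 : ℂ) R, g z ≠ 0)
    (hk0 : ∀ z ∈ closedBall (0 : ℂ) R, k z ≠ 0) :
    circleAverage (fun ζ => |log ‖g ζ / k ζ‖|) 0 R ≤
      2 * circleAverage (fun z => log⁺ ‖ψ z / φ z‖) 0 R -
        (circleAverage (fun z => log ‖ψ z‖) 0 R - circleAverage (fun z => log ‖φ z‖) 0 R) +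
        (∑ a ∈ Z, ((n a + m a : ℕ) : ℝ)) * (2 * log (2 * R)) := by
  have hR0 : 0 < R := by linarith
  have hiψ := circleIntegrable_log_norm_entire hψ R
  have hiφ := circleIntegrable_log_norm_entire hφ R
  have hi0 : CircleIntegrable (fun z => 2 * log⁺ ‖ψ z / φ z‖) 0 R :=
    (circleIntegrable_posLog_norm_div hψ hφ R).const_smul (a := (2 : ℝ))
  have hi1 : CircleIntegrable (fun z => 2 * log⁺ ‖ψ z / φ z‖ - (log ‖ψ z‖ - log ‖φ z‖)) 0 R :=
    hi0.sub (hiψ.sub hiφ)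
  have hi2 : ∀ a, CircleIntegrable (fun z => 2 * log (2 * R) - log ‖z - a‖) 0 R := fun a =>
    (circleIntegrable_const _ _ _).sub (circleIntegrable_log_norm_sub_const R)
  have hi3 : CircleIntegrable
      (fun z => ∑ a ∈ Z, ((n a + m a : ℕ) : ℝ) • (2 * log (2 * R) - log ‖z - a‖)) 0 R := by
    have := CircleIntegrable.sum Z (c := 0) (R := R)
      (f := fun a z => ((n a + m a : ℕ) : ℝ) • (2 * log (2 * R) - log ‖z - a‖))
      fun a _ => (hi2 a).const_smul
    convert this using 1
    ext z; simp
  have higk : CircleIntegrable (fun ζ => log ‖g ζ / k ζ‖) 0 R :=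
    MeromorphicOn.circleIntegrable_log_norm fun z _ =>
      (hg.analyticAt z).meromorphicAt.div (hk.analyticAt z).meromorphicAt
  have hle : circleAverage (fun ζ => |log ‖g ζ / k ζ‖|) 0 R ≤
      circleAverage (fun z => (2 * log⁺ ‖ψ z / φ z‖ - (log ‖ψ z‖ - log ‖φ z‖)) +
        ∑ a ∈ Z, ((n a + m a : ℕ) : ℝ) • (2 * log (2 * R) - log ‖z - a‖)) 0 R := by
    refine circleAverage_mono_off_countable hR0.ne' higk.abs
      (hi1.add hi3) (Finset.countable_toSet Z) fun z hz hzR => ?_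
    rw [abs_of_pos hR0] at hzR
    have hzB : z ∈ closedBall (0 : ℂ) R := by simp [hzR]
    have hza : ∀ a ∈ Z, z - a ≠ 0 := fun a ha => sub_ne_zero.2 fun e => hz (e ▸ ha)
    have hψz : ψ z ≠ 0 := by
      rw [hψfac]
      exact mul_ne_zero (Finset.prod_ne_zero_iff.2 fun a ha => pow_ne_zero _ (hza a ha)) (hg0 z hzB)
    have hφz : φ z ≠ 0 := by
      rw [hφfac]
      exact mul_ne_zero (Finset.prod_ne_zero_iff.2 fun a ha => pow_ne_zero _ (hza a ha)) (hk0 z hzB)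
    have e1 := log_norm_eq_sum_add hψfac hz (hg0 z hzB)
    have e2 := log_norm_eq_sum_add hφfac hz (hk0 z hzB)
    have e3 : log ‖g z / k z‖ = log ‖g z‖ - log ‖k z‖ := by
      rw [norm_div, log_div (norm_ne_zero_iff.2 (hg0 z hzB)) (norm_ne_zero_iff.2 (hk0 z hzB))]
    have e4 : log ‖ψ z / φ z‖ = log ‖ψ z‖ - log ‖φ z‖ := by
      rw [norm_div, log_div (norm_ne_zero_iff.2 hψz) (norm_ne_zero_iff.2 hφz)]
    have e5 : log ‖g z / k z‖ = log ‖ψ z / φ z‖ -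
        ∑ a ∈ Z, ((n a : ℝ) - m a) * log ‖z - a‖ := by
      simp only [sub_mul, Finset.sum_sub_distrib]
      linarith
    rw [e5]
    refine (abs_sub _ _).trans (add_le_add ?_ ?_)
    · rw [abs_log_eq_two_mul_posLog_sub, e4]
    · refine (Finset.abs_sum_le_sum_abs _ _).trans (Finset.sum_le_sum fun a ha => ?_)
      rw [abs_mul, smul_eq_mul]
      have h0 : |(n a : ℝ) - m a| ≤ ((n a + m a : ℕ) : ℝ) := by
        refine (abs_sub _ _).trans_eq ?_
        push_cast
        rw [Nat.abs_cast, Nat.abs_cast]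
      refine mul_le_mul h0 ?_ (abs_nonneg _) (by positivity)
      rw [abs_log_eq_two_mul_posLog_sub]
      have h1 : ‖z - a‖ ≤ 2 * R := by
        have h2 := norm_sub_le z a
        have h3 : ‖a‖ ≤ R := by simpa using hZ a ha
        linarith
      have h2 : log⁺ ‖z - a‖ ≤ log (2 * R) := by
        rw [← posLog_eq_log (x := 2 * R) (by rw [abs_of_pos] <;> linarith)]
        exact posLog_le_posLog (norm_nonneg _) h1
      linarith
  refine hle.trans ?_
  rw [circleAverage_fun_add hi1 hi3, circleAverage_fun_sub (f₁ := fun z => 2 * log⁺ ‖ψ z / φ z‖)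
      (f₂ := fun z => log ‖ψ z‖ - log ‖φ z‖) hi0 (hiψ.sub hiφ), circleAverage_fun_sub hiψ hiφ,
    circleAverage_fun_sum (f := fun a z => ((n a + m a : ℕ) : ℝ) • (2 * log (2 * R) - log ‖z - a‖))
      (fun a _ => (hi2 a).const_smul)]
  have a1 := circleAverage_fun_smul (a := (2 : ℝ)) (f := fun z => log⁺ ‖ψ z / φ z‖) (c := 0) (R := R)
  simp only [smul_eq_mul] at a1
  rw [a1, Finset.sum_mul]
  gcongr with a ha
  rw [circleAverage_fun_smul, smul_eq_mul, circleAverage_fun_sub (circleIntegrable_const _ _ _)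
    (circleIntegrable_log_norm_sub_const R), circleAverage_const,
    circleAverage_log_norm_sub_const_of_mem_closedBall
      (by rw [abs_of_pos hR0]; exact hZ a ha)]
  refine mul_le_mul_of_nonneg_left ?_ (by positivity)
  have b1 : 0 ≤ log R := log_nonneg hR1
  linarith

/-- The number of zeros in a disc is controlled by the mean on a larger circle. -/
theorem sum_order_mul_log_le_of_subset {h : ℂ → ℂ} (hh : Differentiable ℂ h) (h0 : h ≠ 0) {R ρ : ℝ}
    (hR : 1 ≤ R) (hRρ : R ≤ ρ) (Z : Finset ℂ) (hZ : ∀ a ∈ Z, a ∈ closedBall (0 : ℂ) R) :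
    (∑ a ∈ Z, (analyticOrderNatAt h a : ℝ)) * log (ρ / R) ≤
      circleAverage (fun z => log ‖h z‖) 0 ρ - log ‖meromorphicTrailingCoeffAt h 0‖ := by
  have hlog : 0 ≤ log (ρ / R) := log_nonneg ((one_le_div (by linarith)).2 hRρ)
  refine le_trans (mul_le_mul_of_nonneg_right ?_ hlog) (sum_order_mul_log_le hh h0 hR hRρ
    (finite_zeros_closedBall hh h0 R).toFinset fun a => by simp)
  rw [← Finset.sum_filter_ne_zero Z]
  refine Finset.sum_le_sum_of_subset_of_nonneg (fun a haf => ?_) fun _ _ _ => by positivity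
  obtain ⟨ha, hne⟩ := Finset.mem_filter.1 haf
  have : h a = 0 := by
    by_contra h'
    exact hne (by exact_mod_cast (analyticOrderNatAt_eq_zero_iff hh h0 a).2 h')
  rw [Set.Finite.mem_toFinset]
  exact ⟨hZ a ha, this⟩

/-- The poles 1/|z - a| are not integrable on the circle, but their square roots are. One bounds |F|
by the square of y = 2 + H + ∑ n_a |z - a|^(-1/2) and applies concavity of the logarithm to y, so
only the logarithm of the number of zeros appears. -/
theorem circleAverage_posLog_le_of_le_sum_inv {F : ℂ → ℂ} {r C₀ H : ℝ} (hr0 : 0 < r) (hC₀ : 0 < C₀)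
    (hsing : ∀ a : ℂ, CircleIntegrable (fun z => ‖z - a‖ ^ (-(1 / 2) : ℝ)) 0 r ∧
      circleAverage (fun z => ‖z - a‖ ^ (-(1 / 2) : ℝ)) 0 r ≤ C₀) (hH0 : 0 ≤ H)
    (hfi : CircleIntegrable (fun z => log⁺ ‖F z‖) 0 r) {Z : Finset ℂ} {n : ℂ → ℕ}
    (hF : ∀ z, z ∉ Z → ‖z‖ = r → ‖F z‖ ≤ ∑ a ∈ Z, (n a : ℝ) * ‖z - a‖⁻¹ + H) :
    circleAverage (fun z => log⁺ ‖F z‖) 0 r ≤ 2 * log (2 + H + (∑ a ∈ Z, (n a : ℝ)) * C₀) := by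
  set y : ℂ → ℝ := fun z => (2 + H) + ∑ a ∈ Z, (n a : ℝ) • ‖z - a‖ ^ (-(1 / 2) : ℝ) with hy
  have hyi2 : CircleIntegrable (fun z => ∑ a ∈ Z, (n a : ℝ) • ‖z - a‖ ^ (-(1 / 2) : ℝ)) 0 r := by
    have := CircleIntegrable.sum Z (c := 0) (R := r)
      (f := fun a z => (n a : ℝ) • ‖z - a‖ ^ (-(1 / 2) : ℝ))
      fun a _ => ((hsing a).1).const_smul
    convert this using 1
    ext z; simp
  have hyi : CircleIntegrable y 0 r := (circleIntegrable_const _ _ _).add hyi2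
  have hyavg : circleAverage y 0 r ≤ 2 + H + (∑ a ∈ Z, (n a : ℝ)) * C₀ := by
    simp only [hy]
    rw [circleAverage_fun_add (circleIntegrable_const _ _ _) hyi2, circleAverage_const,
      circleAverage_fun_sum (f := fun a z => (n a : ℝ) • ‖z - a‖ ^ (-(1 / 2) : ℝ))
        (fun a _ => ((hsing a).1).const_smul), Finset.sum_mul]
    gcongr with a ha
    rw [circleAverage_fun_smul, smul_eq_mul]
    exact mul_le_mul_of_nonneg_left (hsing a).2 (by positivity)
  have hY0 : 0 < 2 + H + (∑ a ∈ Z, (n a : ℝ)) * C₀ := by positivity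
  have hmain : circleAverage (fun z => (1 / 2 : ℝ) • log⁺ ‖F z‖) 0 r ≤
      log (2 + H + (∑ a ∈ Z, (n a : ℝ)) * C₀) := by
    refine circleAverage_log_le_of_le hr0.ne' hfi.const_smul hyi hY0 hyavg
      (Finset.countable_toSet Z) fun z hz hzr => ?_
    rw [abs_of_pos hr0] at hzr
    have hS0 : 0 ≤ ∑ a ∈ Z, (n a : ℝ) • ‖z - a‖ ^ (-(1 / 2) : ℝ) :=
      Finset.sum_nonneg fun a _ => by rw [smul_eq_mul]; positivity
    have hy2 : 2 ≤ y z := by simp only [hy]; linarith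
    refine ⟨by linarith, ?_⟩
    have e1 : ‖F z‖ ≤ ∑ a ∈ Z, (n a : ℝ) * ‖z - a‖⁻¹ + H := hF z hz hzr
    -- A sum of squares of nonnegative terms is at most the square of the sum, and n ≤ n² for
    -- natural n.
    have e2 : ∑ a ∈ Z, (n a : ℝ) * ‖z - a‖⁻¹ ≤
        (∑ a ∈ Z, (n a : ℝ) • ‖z - a‖ ^ (-(1 / 2) : ℝ)) ^ 2 := by
      refine le_trans ?_ (Finset.sum_sq_le_sq_sum_of_nonneg fun a _ => by rw [smul_eq_mul]; positivity)
      refine Finset.sum_le_sum fun a ha => ?_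
      have h1 : (‖z - a‖ ^ (-(1 / 2) : ℝ)) ^ 2 = ‖z - a‖⁻¹ := by
        rw [← rpow_natCast, ← rpow_mul (norm_nonneg _), ← rpow_neg_one]
        norm_num
      rw [smul_eq_mul, mul_pow, h1]
      refine mul_le_mul_of_nonneg_right ?_ (by positivity)
      exact_mod_cast Nat.le_self_pow two_ne_zero (n a)
    have e3 : ‖F z‖ ≤ y z ^ 2 := by
      refine e1.trans ?_
      simp only [hy]
      nlinarith
    have e4 : log⁺ ‖F z‖ ≤ 2 * log (y z) := by
      have : log (y z ^ 2) = 2 * log (y z) := by rw [log_pow]; norm_num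
      rw [← this, ← posLog_eq_log (x := y z ^ 2) (by rw [abs_of_pos] <;> nlinarith)]
      exact posLog_le_posLog (norm_nonneg _) e3
    rw [smul_eq_mul]
    linarith
  rw [circleAverage_fun_smul, smul_eq_mul] at hmain
  linarith

/-- Bookkeeping of powers: N is of size X/ε and is multiplied by ε^(-2), so ε^(-3) suffices. -/
theorem counting_bound_le {K C₀ ε X N : ℝ} (hK0 : 0 ≤ K) (hC₀ : 0 < C₀) (hε : 0 < ε) (hε1 : ε ≤ 1)
    (hX : 1 ≤ X) (hN0 : 0 ≤ N) (hNle : N ≤ 4 * (1 + K) * X / ε) :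
    2 + 12 / ε ^ 2 * (2 * X + K + 6 * N) + N * C₀ ≤
      (2 + 12 * (2 + K + 24 * (1 + K)) + 4 * (1 + K) * C₀) * X / ε ^ 3 := by
  rw [le_div_iff₀ (by positivity)]
  have e1 : N * ε ≤ 4 * (1 + K) * X := by rwa [le_div_iff₀ hε] at hNle
  have e2 : 12 / ε ^ 2 * (2 * X + K + 6 * N) * ε ^ 3 =
      12 * (2 * X * ε + K * ε + 6 * (N * ε)) := by field_simp
  have e3 : 2 * X * ε ≤ 2 * X := mul_le_of_le_one_right (by linarith) hε1
  have e4 : K * ε ≤ K * X := mul_le_mul_of_nonneg_left (by linarith) hK0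
  have e5 : ε ^ 3 ≤ 1 := pow_le_one₀ hε.le hε1
  have e6 : ε ^ 2 ≤ 1 := pow_le_one₀ hε.le hε1
  have e7 : N * C₀ * ε ^ 3 ≤ 4 * (1 + K) * X * C₀ := by
    have : N * C₀ * ε ^ 3 = (N * ε) * C₀ * ε ^ 2 := by ring
    rw [this]
    have h8 : 0 ≤ N * ε * C₀ := by positivity
    calc N * ε * C₀ * ε ^ 2 ≤ N * ε * C₀ := mul_le_of_le_one_right h8 e6
      _ ≤ _ := by gcongr
  calc (2 + 12 / ε ^ 2 * (2 * X + K + 6 * N) + N * C₀) * ε ^ 3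
      = 2 * ε ^ 3 + 12 / ε ^ 2 * (2 * X + K + 6 * N) * ε ^ 3 + N * C₀ * ε ^ 3 := by ring
    _ ≤ 2 * X + 12 * (2 * X + K * X + 6 * (4 * (1 + K) * X)) + 4 * (1 + K) * X * C₀ := by
      rw [e2]; linarith
    _ = _ := by ring

/-- The lemma on the logarithmic derivative for a quotient of entire functions. -/
theorem exists_circleAverage_posLog_logDeriv_le {ψ φ : ℂ → ℂ} (hψ : Differentiable ℂ ψ)
    (hφ : Differentiable ℂ φ) (hψ0 : ψ ≠ 0) (hφ0 : φ ≠ 0) :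
    ∃ C : ℝ, 0 ≤ C ∧ ∀ r ε X : ℝ, 1 ≤ r → 0 < ε → ε ≤ 1 → 1 ≤ X →
      (∀ s ∈ Set.Icc r ((1 + ε) * r), circleAverage (fun z => log⁺ ‖ψ z / φ z‖) 0 s ≤ X ∧
        circleAverage (fun z => log ‖φ z‖) 0 s ≤ X) →
      circleAverage (fun z => log⁺ ‖deriv ψ z / ψ z - deriv φ z / φ z‖) 0 r ≤
        C * (1 + log (1 / ε) + log X) := by
  classical
  obtain ⟨C₀, hC₀, hsing⟩ := exists_circleAverage_norm_sub_rpow_le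
  obtain ⟨K₁, hK₁⟩ := exists_le_circleAverage_log_norm hψ hψ0
  -- One constant for all data that depend on ψ and φ alone: the lower Jensen bound for ψ and the
  -- two trailing coefficients.
  set K : ℝ := |K₁| + 1 + |log ‖meromorphicTrailingCoeffAt ψ 0‖| +
    |log ‖meromorphicTrailingCoeffAt φ 0‖| with hK
  have hK0 : 0 ≤ K := by positivity
  have hKψ : -log ‖meromorphicTrailingCoeffAt ψ 0‖ - log ‖meromorphicTrailingCoeffAt φ 0‖ ≤ K := by
    have := neg_abs_le (log ‖meromorphicTrailingCoeffAt ψ 0‖)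
    have := neg_abs_le (log ‖meromorphicTrailingCoeffAt φ 0‖)
    have := abs_nonneg K₁
    linarith
  have hKK₁ : -K₁ ≤ K := by
    have := neg_abs_le K₁
    have := abs_nonneg (log ‖meromorphicTrailingCoeffAt ψ 0‖)
    have := abs_nonneg (log ‖meromorphicTrailingCoeffAt φ 0‖)
    linarith
  have hK1 : 1 ≤ K := by
    have := abs_nonneg K₁
    have := abs_nonneg (log ‖meromorphicTrailingCoeffAt ψ 0‖)
    have := abs_nonneg (log ‖meromorphicTrailingCoeffAt φ 0‖)
    linarith
  clear_value K
  set C₁ : ℝ := 2 + 12 * (2 + K + 24 * (1 + K)) + 4 * (1 + K) * C₀ with hC₁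
  have hC₁1 : 1 ≤ C₁ := by
    have : 0 ≤ 12 * (2 + K + 24 * (1 + K)) + 4 * (1 + K) * C₀ := by positivity
    linarith
  refine ⟨2 * (log (2 * C₁) + 3), by
    have := log_nonneg (show 1 ≤ 2 * C₁ by linarith)
    positivity, ?_⟩
  intro r ε X hr hε hε1 hX hbd
  have hr0 : 0 < r := by linarith
  -- The Poisson representation is used on the circle of radius R, midway to ρ; the gap between R
  -- and ρ serves to count the zeros up to R.
  set R : ℝ := (1 + ε / 2) * r with hRdef
  set ρ : ℝ := (1 + ε) * r with hρdef
  have hrR : r < R := by rw [hRdef]; nlinarith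
  have hRρ : R ≤ ρ := by rw [hRdef, hρdef]; nlinarith
  have hR1 : 1 ≤ R := by linarith
  have hR0 : 0 < R := by linarith
  set Z := (finite_zeros_closedBall hψ hψ0 R).toFinset ∪ (finite_zeros_closedBall hφ hφ0 R).toFinset
    with hZdef
  have hZ : ∀ a, a ∈ Z ↔ a ∈ closedBall (0 : ℂ) R ∧ (ψ a = 0 ∨ φ a = 0) := fun a => by
    simp only [hZdef, Finset.mem_union, Set.Finite.mem_toFinset, Set.mem_ofPred_eq]
    tauto
  have hZR : ∀ a ∈ Z, a ∈ closedBall (0 : ℂ) R := fun a ha => ((hZ a).1 ha).1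
  obtain ⟨g, hg, hψfac, hgne⟩ := exists_entire_factorization hψ hψ0 Z
  obtain ⟨k, hk, hφfac, hkne⟩ := exists_entire_factorization hφ hφ0 Z
  have hg0 : ∀ z ∈ closedBall (0 : ℂ) R, g z ≠ 0 := by
    intro z hz hgz
    by_cases hzZ : z ∈ Z
    · exact hgne z hzZ hgz
    · exact hzZ ((hZ z).2 ⟨hz, Or.inl (by rw [hψfac, hgz, mul_zero])⟩)
  have hk0 : ∀ z ∈ closedBall (0 : ℂ) R, k z ≠ 0 := by
    intro z hz hkz
    by_cases hzZ : z ∈ Z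
    · exact hkne z hzZ hkz
    · exact hzZ ((hZ z).2 ⟨hz, Or.inr (by rw [hφfac, hkz, mul_zero])⟩)
  set n : ℂ → ℕ := fun a => analyticOrderNatAt ψ a with hn
  set m : ℂ → ℕ := fun a => analyticOrderNatAt φ a with hm
  set N : ℝ := ∑ a ∈ Z, ((n a + m a : ℕ) : ℝ) with hN
  have hN0 : 0 ≤ N := Finset.sum_nonneg fun a _ => by positivity
  have hNsum : N = ∑ a ∈ Z, (n a : ℝ) + ∑ a ∈ Z, (m a : ℝ) := by
    rw [hN, ← Finset.sum_add_distrib]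
    push_cast
    rfl
  have hψX : ∀ s ∈ Set.Icc r ρ, circleAverage (fun z => log ‖ψ z‖) 0 s ≤ 2 * X := by
    intro s hs
    have hs0 : s ≠ 0 := by linarith [hs.1]
    have h1 : circleAverage (fun z => log ‖ψ z‖) 0 s ≤
        circleAverage (fun z => log⁺ ‖ψ z / φ z‖ + log ‖φ z‖) 0 s := by
      refine circleAverage_mono_off_countable hs0 (circleIntegrable_log_norm_entire hψ s)
        ((circleIntegrable_posLog_norm_div hψ hφ s).add (circleIntegrable_log_norm_entire hφ s))
        ((countable_zeros hψ hψ0).union (countable_zeros hφ hφ0)) fun z hz _ => ?_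
      have hψz : ψ z ≠ 0 := fun h => hz (Or.inl h)
      have hφz : φ z ≠ 0 := fun h => hz (Or.inr h)
      have e4 : log ‖ψ z / φ z‖ = log ‖ψ z‖ - log ‖φ z‖ := by
        rw [norm_div, log_div (norm_ne_zero_iff.2 hψz) (norm_ne_zero_iff.2 hφz)]
      have : log ‖ψ z / φ z‖ ≤ log⁺ ‖ψ z / φ z‖ := le_max_right _ _
      linarith
    rw [circleAverage_fun_add (circleIntegrable_posLog_norm_div hψ hφ s)
      (circleIntegrable_log_norm_entire hφ s)] at h1
    linarith [(hbd s hs).1, (hbd s hs).2]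
  have hNle : N ≤ 4 * (1 + K) * (2 * X) / ε := by
    have h1 := sum_order_mul_log_le_of_subset hψ hψ0 hR1 hRρ Z hZR
    have h1' := sum_order_mul_log_le_of_subset hφ hφ0 hR1 hRρ Z hZR
    have h2 := hψX ρ ⟨by linarith, le_rfl⟩
    have h2' := (hbd ρ ⟨by linarith, le_rfl⟩).2
    -- log (ρ/R) ≥ 1 - R/ρ = (ε/2)/(1 + ε) ≥ ε/4, because ε ≤ 1.
    have h4 : ε / 4 ≤ log (ρ / R) := by
      have h5 := one_sub_inv_le_log_of_pos (show 0 < ρ / R by positivity)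
      refine le_trans ?_ h5
      rw [inv_div, hRdef, hρdef, mul_div_mul_right _ _ hr0.ne']
      rw [le_sub_iff_add_le, ← le_sub_iff_add_le', div_le_iff₀ (by linarith)]
      nlinarith
    have h6 : N * (ε / 4) ≤ 3 * X + K := by
      have : N * (ε / 4) ≤ N * log (ρ / R) := mul_le_mul_of_nonneg_left h4 hN0
      have e : N * log (ρ / R) = (∑ a ∈ Z, (n a : ℝ)) * log (ρ / R) +
        (∑ a ∈ Z, (m a : ℝ)) * log (ρ / R) := by rw [hNsum, add_mul]
      simp only [hn, hm] at e
      linarith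
    rw [le_div_iff₀ hε]
    nlinarith
  -- The crude bound log (2R) ≤ 2R - 1 costs a factor r. It is harmless: the derivative of the
  -- Poisson kernel, 2R/(R - r)², gains a factor 1/r.
  have hgavg : circleAverage (fun ζ => |log ‖g ζ / k ζ‖|) 0 R ≤ 2 * (2 * X) + K + 6 * N * r := by
    have a0 := circleAverage_abs_log_quotient_le hψ hφ hg hk hψfac hφfac hR1 hZR hg0 hk0
    have a1 := hbd R ⟨hrR.le, hRρ⟩
    have a2 := hK₁ R hR1
    have b2 : log (2 * R) ≤ 2 * R - 1 := log_le_sub_one_of_pos (by positivity)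
    have b3 : R ≤ 3 / 2 * r := by rw [hRdef]; nlinarith
    have b4 : N * (2 * log (2 * R)) ≤ N * (6 * r) := mul_le_mul_of_nonneg_left (by linarith) hN0
    linarith [a1.1, a1.2]
  -- With R - r = εr/2 one has 2Rr/(R - r)² = (8 + 4ε)/ε² ≤ 12/ε².
  set H : ℝ := 12 / ε ^ 2 * (2 * (2 * X) + K + 6 * N) with hH
  have hH0 : 0 ≤ H := by positivity
  have hgH : ∀ z : ℂ, ‖z‖ = r → ‖deriv g z / g z - deriv k z / k z‖ ≤ H := by
    intro z hz
    have hzB : z ∈ closedBall (0 : ℂ) R := by simp [hz, hrR.le]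
    have e0 : deriv g z / g z - deriv k z / k z =
        deriv (fun w => g w / k w) z / (g z / k z) := by
      have h1 := hg0 z hzB
      have h2 := hk0 z hzB
      rw [deriv_fun_div (hg z) (hk z) h2]
      field_simp
    have hq : AnalyticOnNhd ℂ (fun w => g w / k w) (closedBall 0 R) := fun w hw =>
      (hg.analyticAt w).div (hk.analyticAt w) (hk0 w hw)
    rw [e0]
    refine (norm_deriv_div_le_of_ne_zero hq hrR
      (fun w hw => div_ne_zero (hg0 w hw) (hk0 w hw)) hz.le).trans ?_
    have h1 : 2 * R / (R - r) ^ 2 * circleAverage (fun ζ => |log ‖g ζ / k ζ‖|) 0 R ≤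
        2 * R / (R - r) ^ 2 * ((2 * (2 * X) + K + 6 * N) * r) := by
      refine mul_le_mul_of_nonneg_left (hgavg.trans ?_) (by positivity)
      nlinarith
    refine h1.trans ?_
    have h2 : 2 * R / (R - r) ^ 2 * ((2 * (2 * X) + K + 6 * N) * r) =
        (8 + 4 * ε) / ε ^ 2 * (2 * (2 * X) + K + 6 * N) := by
      have : R - r = ε / 2 * r := by rw [hRdef]; ring
      rw [this, hRdef]
      field_simp
      ring
    rw [h2, hH]
    gcongr
    linarith
  have hmer : ∀ z, MeromorphicAt (fun z => deriv ψ z / ψ z - deriv φ z / φ z) z := fun z =>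
    ((hψ.deriv.analyticAt z).meromorphicAt.div (hψ.analyticAt z).meromorphicAt).sub
      ((hφ.deriv.analyticAt z).meromorphicAt.div (hφ.analyticAt z).meromorphicAt)
  have hmain := circleAverage_posLog_le_of_le_sum_inv
    (F := fun z => deriv ψ z / ψ z - deriv φ z / φ z) hr0 hC₀
    (fun a => hsing r hr a) hH0 (MeromorphicOn.circleIntegrable_posLog_norm fun z _ => hmer z)
    (Z := Z) (n := fun a => n a + m a) (by
      intro z hz hzr
      have hzB : z ∈ closedBall (0 : ℂ) R := by simp [hzr, hrR.le]
      rw [logDeriv_eq_sum_add hg hψfac hz (hg0 z hzB), logDeriv_eq_sum_add hk hφfac hz (hk0 z hzB),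
        add_sub_add_comm, ← Finset.sum_sub_distrib]
      refine (norm_add_le _ _).trans (add_le_add ?_ (hgH z hzr))
      refine (norm_sum_le _ _).trans (Finset.sum_le_sum fun a _ => ?_)
      refine (norm_sub_le _ _).trans_eq ?_
      rw [norm_div, norm_div, Complex.norm_natCast, Complex.norm_natCast]
      push_cast
      rw [add_mul, div_eq_mul_inv, div_eq_mul_inv])
  have hY0 : 0 < 2 + H + N * C₀ := by positivity
  have hYle : 2 + H + N * C₀ ≤ C₁ * (2 * X) / ε ^ 3 :=
    counting_bound_le hK0 hC₀ hε hε1 (by linarith) hN0 hNle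
  have hlogY : log (2 + H + N * C₀) ≤ log (2 * C₁) + log X + 3 * log (1 / ε) := by
    refine (log_le_log hY0 hYle).trans_eq ?_
    rw [← mul_assoc, mul_comm C₁ 2, log_div (by positivity) (by positivity),
      log_mul (by positivity) (by positivity), log_pow, one_div, log_inv]
    push_cast; ring
  have p1 : 0 ≤ log X := log_nonneg hX
  have p2 : 0 ≤ log (1 / ε) := log_nonneg ((one_le_div hε).2 hε1)
  have p3 : 0 ≤ log (2 * C₁) := log_nonneg (by linarith)
  have p4 : log (2 * C₁) + log X + 3 * log (1 / ε) ≤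
      (log (2 * C₁) + 3) * (1 + log (1 / ε) + log X) := by
    nlinarith [mul_nonneg p3 p1, mul_nonneg p3 p2]
  linarith

end LogarithmicDerivativeLemma

/-! ### Higher logarithmic derivatives and the choice of a good radius. -/

section HigherLogarithmicDerivatives

open Real MeromorphicOn Metric Filter

theorem differentiable_iteratedDeriv {h : ℂ → ℂ} (hh : Differentiable ℂ h) (l : ℕ) :
    Differentiable ℂ (iteratedDeriv l h) := by
  induction l with
  | zero => simpa using hh
  | succ l ih => rw [iteratedDeriv_succ]; exact ih.deriv

theorem circleAverage_posLog_mul_le {x y w : ℂ → ℂ} {s : ℝ} (hs : s ≠ 0)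
    (hx : CircleIntegrable (fun z => log⁺ ‖x z‖) 0 s)
    (hy : CircleIntegrable (fun z => log⁺ ‖y z‖) 0 s)
    (hw : CircleIntegrable (fun z => log⁺ ‖w z‖) 0 s) {Z : Set ℂ} (hZ : Z.Countable)
    (h : ∀ z, z ∉ Z → x z = y z * w z) :
    circleAverage (fun z => log⁺ ‖x z‖) 0 s ≤
      circleAverage (fun z => log⁺ ‖y z‖) 0 s + circleAverage (fun z => log⁺ ‖w z‖) 0 s := by
  rw [← circleAverage_fun_add hy hw]
  refine circleAverage_mono_off_countable hs hx (hy.add hw) hZ fun z hz _ => ?_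
  rw [h z hz, norm_mul]
  exact posLog_mul

/-- The numerators of the iterated derivatives of a quotient: the `l`-th derivative of `ψ / φ` is
`quotientNumerator φ ψ l / φ ^ (l + 1)`. -/
noncomputable def quotientNumerator (φ ψ : ℂ → ℂ) : ℕ → ℂ → ℂ
  | 0 => ψ
  | l + 1 => fun z => deriv (quotientNumerator φ ψ l) z * φ z -
      (l + 1 : ℕ) * quotientNumerator φ ψ l z * deriv φ z

theorem differentiable_quotientNumerator {φ ψ : ℂ → ℂ} (hφ : Differentiable ℂ φ)
    (hψ : Differentiable ℂ ψ) (l : ℕ) : Differentiable ℂ (quotientNumerator φ ψ l) := by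
  induction l with
  | zero => exact hψ
  | succ l ih => exact (ih.deriv.mul hφ).sub ((ih.const_mul _).mul hφ.deriv)

theorem circleIntegrable_posLog_quotientNumerator {φ ψ : ℂ → ℂ} (hφ : Differentiable ℂ φ)
    (hψ : Differentiable ℂ ψ) (l : ℕ) (r : ℝ) :
    CircleIntegrable (fun z => log⁺ ‖quotientNumerator φ ψ l z / (φ z ^ l * ψ z)‖) 0 r :=
  circleIntegrable_posLog_norm_div (differentiable_quotientNumerator hφ hψ l) ((hφ.pow l).mul hψ) r

/-- The lemma on the logarithmic derivative for higher derivatives of a quotient of entire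
functions. -/
theorem exists_circleAverage_posLog_quotientNumerator_le {φ ψ : ℂ → ℂ} (hφ : Differentiable ℂ φ)
    (hψ : Differentiable ℂ ψ) (hφ0 : φ ≠ 0) (hψ0 : ψ ≠ 0)
    (l : ℕ) : ∃ C : ℝ, 0 ≤ C ∧ ∀ r ε X : ℝ, 1 ≤ r → 0 < ε → ε ≤ 1 → 1 ≤ X →
      (∀ s ∈ Set.Icc r ((1 + ε) ^ l * r), circleAverage (fun z => log⁺ ‖ψ z / φ z‖) 0 s ≤ X ∧
        circleAverage (fun z => log ‖φ z‖) 0 s ≤ X) →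
      circleAverage (fun z => log⁺ ‖quotientNumerator φ ψ l z / (φ z ^ l * ψ z)‖) 0 r ≤
        C * (1 + log (1 / ε) + log X) := by
  induction l with
  | zero =>
    -- The quotient is 1, or 0 at a zero of ψ by the convention for division; log⁺ vanishes at both.
    refine ⟨0, le_rfl, fun r ε X hr _ _ _ _ => ?_⟩
    rw [zero_mul]
    refine circleAverage_mono_on_of_le_circle
      (circleIntegrable_posLog_quotientNumerator hφ hψ 0 r) fun z _ => ?_
    rw [quotientNumerator]
    by_cases hz : ψ z = 0 <;> simp [hz]
  | succ l ih =>
    obtain ⟨C, hC, ih⟩ := ih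
    set k := quotientNumerator φ ψ l with hk
    have hkd : Differentiable ℂ k := differentiable_quotientNumerator hφ hψ l
    have hφp : Differentiable ℂ (fun z => φ z ^ (l + 1)) := hφ.pow _
    rcases eq_or_ne k 0 with k0 | k0
    -- A numerator that vanishes identically has no logarithmic derivative, but then the next
    -- numerator vanishes as well.
    · refine ⟨0, le_rfl, fun r ε X _ _ _ _ _ => ?_⟩
      have : ∀ z, quotientNumerator φ ψ (l + 1) z = 0 := fun z => by
        rw [quotientNumerator, ← hk, k0]
        simp
      simp [this, circleAverage_const]
    have hφp0 : (fun z => φ z ^ (l + 1)) ≠ 0 := fun h => hφ0 (funext fun z => by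
      simpa using congrFun h z)
    obtain ⟨D, hD, hlog⟩ := exists_circleAverage_posLog_logDeriv_le hkd hφp k0 hφp0
    -- Chosen so that CΛ + (l + 1)X ≤ cX/ε, using Λ ≤ 3X/ε.
    set c : ℝ := 3 * C + 1 + (l + 1) with hc
    have hc1 : 1 ≤ c := by
      have : (0 : ℝ) ≤ l := by positivity
      linarith
    refine ⟨D * (2 + log c) + C, ?_, fun r ε X hr hε hε1 hX hbd => ?_⟩
    · have : 0 ≤ log c := log_nonneg hc1
      positivity
    have hr0 : 0 < r := by linarith
    have p1 : 0 ≤ log X := log_nonneg hX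
    have p2 : 0 ≤ log (1 / ε) := log_nonneg ((one_le_div hε).2 hε1)
    have p3 : 0 ≤ log c := log_nonneg hc1
    set Λ := 1 + log (1 / ε) + log X with hΛ
    have hcount : ({z | φ z = 0} ∪ {z | ψ z = 0}).Countable :=
      (countable_zeros hφ hφ0).union (countable_zeros hψ hψ0)
    -- Passing to the next derivative needs bounds on all of [r, (1 + ε)r]; this uses up one of the
    -- l + 1 factors 1 + ε in the hypothesis.
    have hih : ∀ s ∈ Set.Icc r ((1 + ε) * r),
        circleAverage (fun z => log⁺ ‖k z / (φ z ^ l * ψ z)‖) 0 s ≤ C * Λ := by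
      intro s hs
      refine ih s ε X (hr.trans hs.1) hε hε1 hX fun t ht => hbd t ⟨hs.1.trans ht.1, ht.2.trans ?_⟩
      rw [pow_succ, mul_assoc]
      gcongr
      exact hs.2
    have hone : 1 ≤ (1 + ε) ^ l := one_le_pow₀ (by linarith)
    have hX' : ∀ s ∈ Set.Icc r ((1 + ε) * r),
        circleAverage (fun z => log⁺ ‖k z / φ z ^ (l + 1)‖) 0 s ≤ C * Λ + (l + 1) * X ∧
        circleAverage (fun z => log ‖φ z ^ (l + 1)‖) 0 s ≤ C * Λ + (l + 1) * X := by
      intro s hs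
      have hs0 : s ≠ 0 := by linarith [hs.1]
      have hb := hbd s ⟨hs.1, hs.2.trans (by
        rw [pow_succ, mul_assoc]
        exact le_mul_of_one_le_left (by positivity) hone)⟩
      have hΛ0 : 0 ≤ C * Λ := by positivity
      have hlX : 0 ≤ (l : ℝ) * X := by positivity
      constructor
      · have := circleAverage_posLog_mul_le (x := fun z => k z / φ z ^ (l + 1))
          (y := fun z => k z / (φ z ^ l * ψ z)) (w := fun z => ψ z / φ z) hs0
          (circleIntegrable_posLog_norm_div hkd hφp s)
          (circleIntegrable_posLog_quotientNumerator hφ hψ l s)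
          (circleIntegrable_posLog_norm_div hψ hφ s) hcount fun z hz => by
            have h1 : φ z ≠ 0 := fun h => hz (Or.inl h)
            have h2 : ψ z ≠ 0 := fun h => hz (Or.inr h)
            field_simp
            ring
        linarith [hih s hs]
      · have e : (fun z => log ‖φ z ^ (l + 1)‖) = fun z => ((l + 1 : ℕ) : ℝ) • log ‖φ z‖ := by
          funext z
          rw [norm_pow, log_pow, smul_eq_mul]
        rw [e, circleAverage_fun_smul, smul_eq_mul]
        have := mul_le_mul_of_nonneg_left hb.2 (Nat.cast_nonneg' (α := ℝ) (l + 1))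
        push_cast at this ⊢
        linarith
    have h1 : 1 ≤ C * Λ + (l + 1) * X := by
      have : 0 ≤ C * Λ := by positivity
      have hlX : 0 ≤ (l : ℝ) * X := by positivity
      linarith
    have hmain := hlog r ε (C * Λ + (l + 1) * X) hr hε hε1 h1 hX'
    have hlogX' : log (C * Λ + (l + 1) * X) ≤ log c + log X + log (1 / ε) := by
      rw [← log_mul (by positivity) (by positivity), ← log_mul (by positivity) (by positivity)]
      refine log_le_log (by linarith) ?_
      have q1 : log X ≤ X := log_le_self (by linarith)
      have q2 : log (1 / ε) ≤ 1 / ε := log_le_self (by positivity)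
      have q3 : 1 ≤ 1 / ε := (one_le_div hε).2 hε1
      have q4 : Λ ≤ 3 * X * (1 / ε) := by rw [hΛ]; nlinarith
      have q5 : C * Λ ≤ C * (3 * X * (1 / ε)) := mul_le_mul_of_nonneg_left q4 hC
      have q6 : (l + 1) * X ≤ (l + 1) * X * (1 / ε) := le_mul_of_one_le_right (by positivity) q3
      have q7 : 0 ≤ X * (1 / ε) := by positivity
      rw [hc]
      linarith
    -- With k the l-th numerator, the next one is k'φ - (l + 1)kφ'. Divided by φ^(l+1)ψ it is the
    -- logarithmic derivative of k/φ^(l+1) times the previous quotient k/(φ^l ψ).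
    have hstep := circleAverage_posLog_mul_le (s := r)
      (x := fun z => quotientNumerator φ ψ (l + 1) z / (φ z ^ (l + 1) * ψ z))
      (y := fun z => deriv k z / k z - deriv (fun z => φ z ^ (l + 1)) z / φ z ^ (l + 1))
      (w := fun z => k z / (φ z ^ l * ψ z)) hr0.ne'
      (circleIntegrable_posLog_quotientNumerator hφ hψ (l + 1) r)
      (MeromorphicOn.circleIntegrable_posLog_norm fun z _ =>
        ((hkd.deriv.analyticAt z).meromorphicAt.div (hkd.analyticAt z).meromorphicAt).sub
        ((hφp.deriv.analyticAt z).meromorphicAt.div (hφp.analyticAt z).meromorphicAt))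
      (circleIntegrable_posLog_quotientNumerator hφ hψ l r)
      (hcount.union (countable_zeros hkd k0)) fun z hz => by
        have h1 : φ z ≠ 0 := fun h => hz (Or.inl (Or.inl h))
        have h2 : ψ z ≠ 0 := fun h => hz (Or.inl (Or.inr h))
        have h3 : k z ≠ 0 := fun h => hz (Or.inr h)
        rw [quotientNumerator, ← hk, deriv_fun_pow (hφ z)]
        simp only [Nat.add_sub_cancel]
        field_simp
        ring
    refine hstep.trans ?_
    have h2 := hih r ⟨le_rfl, by nlinarith⟩
    have h3 : 1 + log (1 / ε) + log (C * Λ + (l + 1) * X) ≤ (2 + log c) * Λ := by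
      rw [hΛ]; nlinarith [mul_nonneg p3 p1, mul_nonneg p3 p2]
    have h4 := mul_le_mul_of_nonneg_left h3 hD
    linarith

/-- A growth lemma in the style of Borel: an unbounded function that is bounded on compact
intervals at most doubles on suitable intervals `[r, (1 + 1 / T r) ^ L * r]`. -/
theorem exists_le_two_mul_of_unbounded {T : ℝ → ℝ} (hbdd : ∀ R, BddAbove (T '' Set.Icc 1 R))
    (hunb : ∀ B, ∃ r, 1 ≤ r ∧ B ≤ T r) (L : ℕ) (B : ℝ) :
    ∃ r, 1 ≤ r ∧ B ≤ T r ∧ 1 ≤ T r ∧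
      ∀ s ∈ Set.Icc r ((1 + 1 / T r) ^ L * r), T s ≤ 2 * T r := by
  by_contra! hcon
  obtain ⟨r₀, hr₀, hT₀⟩ := hunb (max B 1)
  let P := {r : ℝ // 1 ≤ r ∧ max B 1 ≤ T r}
  have hnext : ∀ p : P, ∃ p' : P, (p : ℝ) ≤ p' ∧ (p' : ℝ) ≤ (1 + 1 / T p) ^ L * p ∧
      2 * T p < T p' := by
    rintro ⟨r, hr, hT⟩
    obtain ⟨s, hs, hTs⟩ := hcon r hr ((le_max_left _ _).trans hT) ((le_max_right _ _).trans hT)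
    have : 1 ≤ T r := (le_max_right _ _).trans hT
    exact ⟨⟨s, hr.trans hs.1, hT.trans (by linarith)⟩, hs.1, hs.2, hTs⟩
  choose next hn1 hn2 hn3 using hnext
  -- If every large radius fails, iteration gives T(u n) ≥ 2^n, while log (u n) grows by at most L ·
  -- 2^(-n) in each step. The radii stay below r₀ exp (2L), where T is bounded.
  let u : ℕ → P := fun n => next^[n] ⟨r₀, hr₀, hT₀⟩
  have hu : ∀ n, u (n + 1) = next (u n) := fun n => Function.iterate_succ_apply' next n _
  have hTu : ∀ n, (2 : ℝ) ^ n ≤ T (u n) := by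
    intro n
    induction n with
    | zero => simpa [u] using (le_max_right _ _).trans hT₀
    | succ n ih =>
      rw [hu, pow_succ]
      have := hn3 (u n)
      linarith
  have hlog : ∀ n, log (u n) ≤ log r₀ + L * (2 - 2 * (1 / 2) ^ n) := by
    intro n
    induction n with
    | zero => simp [u]
    | succ n ih =>
      rw [hu]
      have h2 := hTu n
      have hT0 : (0 : ℝ) < T (u n) := lt_of_lt_of_le (by positivity) h2
      have hup : (0 : ℝ) < u n := lt_of_lt_of_le one_pos (u n).2.1
      have h1 : log (next (u n)) ≤ L * log (1 + 1 / T (u n)) + log (u n) := by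
        rw [← log_pow, ← log_mul (by positivity) hup.ne']
        exact log_le_log (lt_of_lt_of_le one_pos (next (u n)).2.1) (hn2 (u n))
      have h3 : log (1 + 1 / T (u n)) ≤ (1 / 2) ^ n := by
        have h4 := log_le_sub_one_of_pos (show 0 < 1 + 1 / T (u n) by positivity)
        have h5 : 1 / T (u n) ≤ (1 / 2) ^ n := by
          rw [one_div_pow]
          exact one_div_le_one_div_of_le (by positivity) h2
        linarith
      have h6 := mul_le_mul_of_nonneg_left h3 (Nat.cast_nonneg' (α := ℝ) L)
      have h7 : (L : ℝ) * (2 - 2 * (1 / 2) ^ (n + 1)) =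
          L * (2 - 2 * (1 / 2) ^ n) + L * (1 / 2) ^ n := by ring
      rw [h7]
      linarith
  obtain ⟨M, hM⟩ := hbdd (exp (log r₀ + 2 * L))
  obtain ⟨n, hn⟩ := pow_unbounded_of_one_lt M (one_lt_two (α := ℝ))
  have hup : (0 : ℝ) < u n := lt_of_lt_of_le one_pos (u n).2.1
  have hle : (u n : ℝ) ≤ exp (log r₀ + 2 * L) := by
    rw [← log_le_iff_le_exp hup]
    have h8 : (0 : ℝ) ≤ L * (2 * (1 / 2) ^ n) := by positivity
    have := hlog n
    linarith
  have := hM ⟨u n, ⟨(u n).2.1, hle⟩, rfl⟩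
  linarith [hTu n]

/-- Logarithmic derivatives are of smaller order than the characteristic function. -/
theorem exists_add_sum_logDeriv_lt {ι : Type*} (S : Finset ι) (φ ψ : ι → ℂ → ℂ) (l : ι → ℕ)
    {T : ℝ → ℝ} (hbdd : ∀ R, BddAbove (T '' Set.Icc 1 R)) (hunb : ∀ B, ∃ r, 1 ≤ r ∧ B ≤ T r)
    (hφ : ∀ i ∈ S, Differentiable ℂ (φ i)) (hψ : ∀ i ∈ S, Differentiable ℂ (ψ i))
    (hφ0 : ∀ i ∈ S, φ i ≠ 0) (hψ0 : ∀ i ∈ S, ψ i ≠ 0)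
    {A : ℝ} (hA : 0 ≤ A) (hψT : ∀ i ∈ S, ∀ r, 1 ≤ r →
      circleAverage (fun z => log⁺ ‖ψ i z / φ i z‖) 0 r ≤ A * T r + A ∧
        circleAverage (fun z => log ‖φ i z‖) 0 r ≤ A * T r + A)
    {c K : ℝ} (hc : 0 < c) (hK : 0 ≤ K) :
    ∃ r, 1 ≤ r ∧ K + K * ∑ i ∈ S,
      circleAverage (fun z => log⁺
        ‖quotientNumerator (φ i) (ψ i) (l i) z / (φ i z ^ l i * ψ i z)‖) 0 r < c * T r := by
  choose! C hC hlog using fun i (hi : i ∈ S) =>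
    exists_circleAverage_posLog_quotientNumerator_le (hφ i hi) (hψ i hi) (hφ0 i hi) (hψ0 i hi) (l i)
  set L := S.sup l with hL
  set D := K + K * ∑ i ∈ S, C i * (1 + log (3 * A + 1)) with hD
  set E := K * ∑ i ∈ S, C i * 2 with hE
  -- The error will turn out to be at most D + E log T, which cT eventually exceeds.
  have hlim : Tendsto (fun x : ℝ => c * x - E * log x) atTop atTop := by
    have h1 : (fun x : ℝ => E * log x) =o[atTop] (fun x => c * x) :=
      (isLittleO_log_id_atTop.const_mul_left E).trans_isBigO
        ((Asymptotics.isBigO_refl _ _).const_mul_right hc.ne')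
    have h2 : Tendsto (fun x : ℝ => c * x) atTop atTop := tendsto_id.const_mul_atTop hc
    have h3 := (Asymptotics.IsEquivalent.refl (u := fun x : ℝ => c * x) (l := atTop)).sub_isLittleO h1
    exact h3.symm.tendsto_atTop h2
  obtain ⟨B, hB⟩ := eventually_atTop.1 (hlim.eventually_gt_atTop D)
  obtain ⟨r, hr, hBr, hT1, hgood⟩ := exists_le_two_mul_of_unbounded hbdd hunb L B
  refine ⟨r, hr, ?_⟩
  have hTpos : 0 < T r := by linarith
  have hlast := hB (T r) hBr
  have hlogT : 0 ≤ log (T r) := log_nonneg hT1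
  have hsum : ∑ i ∈ S, circleAverage (fun z => log⁺
      ‖quotientNumerator (φ i) (ψ i) (l i) z / (φ i z ^ l i * ψ i z)‖) 0 r ≤
      ∑ i ∈ S, (C i * (1 + log (3 * A + 1)) + C i * 2 * log (T r)) := by
    refine Finset.sum_le_sum fun i hi => ?_
    have hX1 : 1 ≤ (3 * A + 1) * T r := by nlinarith
    -- The choice ε = 1/T(r) costs only log T(r). On the enlarged interval T(s) ≤ 2T(r), so AT(s) +
    -- A ≤ (3A + 1)T(r) because T(r) ≥ 1.
    have h1 := hlog i hi r (1 / T r) ((3 * A + 1) * T r) hr (by positivity)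
      ((div_le_one hTpos).2 hT1) hX1 (by
        intro s hs
        have hs1 : 1 ≤ s := hr.trans hs.1
        suffices h : A * T s + A ≤ (3 * A + 1) * T r from
          (hψT i hi s hs1).imp (le_trans · h) (le_trans · h)
        have h2 : T s ≤ 2 * T r := by
          refine hgood s ⟨hs.1, hs.2.trans ?_⟩
          have h3 : (1 : ℝ) ≤ 1 + 1 / T r := by
            have : 0 < 1 / T r := by positivity
            linarith
          exact mul_le_mul_of_nonneg_right (pow_le_pow_right₀ h3 (Finset.le_sup hi)) (by linarith)
        nlinarith)
    rw [one_div_one_div, log_mul (by positivity) (by positivity)] at h1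
    linarith
  have hsum2 := mul_le_mul_of_nonneg_left hsum hK
  have e : K * ∑ i ∈ S, (C i * (1 + log (3 * A + 1)) + C i * 2 * log (T r)) =
      (D - K) + E * log (T r) := by
    rw [Finset.sum_add_distrib, hD, hE]
    simp only [← Finset.sum_mul]
    ring
  rw [e] at hsum2
  linarith

end HigherLogarithmicDerivatives

/-! ### Wronskians: linear dependence, zeros, and pointwise bounds. -/

section Wronskian

open Metric Filter

/-- The Wronskian determinant of a finite family of functions. -/
noncomputable def wronskianDet {M : ℕ} (φ : Fin M → ℂ → ℂ) (z : ℂ) : ℂ :=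
  (Matrix.of fun i j : Fin M => iteratedDeriv i (φ j) z).det

theorem differentiableAt_det {M : ℕ} {A : ℂ → Matrix (Fin M) (Fin M) ℂ} {z : ℂ}
    (hA : ∀ i j, DifferentiableAt ℂ (fun w => A w i j) z) :
    DifferentiableAt ℂ (fun w => (A w).det) z := by
  simp only [Matrix.det_apply]
  refine DifferentiableAt.fun_sum fun σ _ => DifferentiableAt.const_smul ?_ _
  exact DifferentiableAt.fun_finsetProd fun i _ => hA _ _

theorem differentiable_wronskianDet {M : ℕ} {φ : Fin M → ℂ → ℂ} (hφ : ∀ j, Differentiable ℂ (φ j)) :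
    Differentiable ℂ (wronskianDet φ) := fun z =>
  differentiableAt_det (A := fun z => Matrix.of fun i j : Fin M => iteratedDeriv i (φ j) z)
    fun i j => differentiable_iteratedDeriv (hφ j) i z

theorem iteratedDeriv_sum_mul {ι : Type*} [Fintype ι] {φ : ι → ℂ → ℂ}
    (hφ : ∀ j, Differentiable ℂ (φ j))
    (c : ι → ℂ) (l : ℕ) (z : ℂ) :
    iteratedDeriv l (fun w => ∑ j, c j * φ j w) z = ∑ j, c j * iteratedDeriv l (φ j) z := by
  have hd : ∀ j, ContDiff ℂ l (φ j) := fun j => (hφ j).contDiff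
  rw [iteratedDeriv_fun_sum fun j _ => (contDiff_const.mul (hd j)).contDiffAt]
  refine Finset.sum_congr rfl fun j _ => ?_
  rw [iteratedDeriv_const_mul_field]

theorem wronskianDet_change {M : ℕ} {φ ψ : Fin M → ℂ → ℂ} (hφ : ∀ j, Differentiable ℂ (φ j))
    (P : Matrix (Fin M) (Fin M) ℂ) (hψ : ∀ j z, ψ j z = ∑ i, P i j * φ i z) (z : ℂ) :
    wronskianDet ψ z = P.det * wronskianDet φ z := by
  rw [mul_comm, wronskianDet, wronskianDet, ← Matrix.det_mul]
  congr 1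
  ext i j
  have : ψ j = fun w => ∑ i, P i j * φ i w := funext (hψ j)
  rw [Matrix.of_apply, this, iteratedDeriv_sum_mul hφ, Matrix.mul_apply]
  exact Finset.sum_congr rfl fun k _ => by rw [Matrix.of_apply, mul_comm]

/-- Entire functions whose Wronskian vanishes identically are linearly dependent. -/
theorem exists_relation_of_wronskianDet_eq_zero {M : ℕ} {φ : Fin M → ℂ → ℂ}
    (hφ : ∀ j, Differentiable ℂ (φ j)) (hW : ∀ z, wronskianDet φ z = 0) :
    ∃ c : Fin M → ℂ, c ≠ 0 ∧ ∀ z, ∑ j, c j * φ j z = 0 := by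
  induction M with
  | zero => simpa [wronskianDet] using hW 0
  | succ M ih =>
    by_cases hW' : ∀ z, wronskianDet (fun j : Fin M => φ j.castSucc) z = 0
    · obtain ⟨c, hc0, hc⟩ := ih (fun j => hφ j.castSucc) hW'
      refine ⟨Fin.snoc c 0, fun h => hc0 ?_, fun z => ?_⟩
      · funext j
        simpa using congrFun h j.castSucc
      · rw [Fin.sum_univ_castSucc]
        simpa using hc z
    push Not at hW'
    obtain ⟨z₀, hz₀⟩ := hW'
    set B : ℂ → Matrix (Fin M) (Fin M) ℂ := fun z =>
      Matrix.of fun i j : Fin M => iteratedDeriv i (φ j.castSucc) z with hB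
    set b : ℂ → Fin M → ℂ := fun z i => iteratedDeriv i (φ (Fin.last M)) z with hb
    have hBd : ∀ z, DifferentiableAt ℂ (fun w => (B w).det) z := fun z =>
      differentiableAt_det fun i j => differentiable_iteratedDeriv (hφ j.castSucc) i z
    have hne : ∀ᶠ z in 𝓝 z₀, (B z).det ≠ 0 := (hBd z₀).continuousAt.eventually_ne hz₀
    obtain ⟨ε, hε, hball⟩ := Metric.eventually_nhds_iff_ball.1 hne
    set c : ℂ → Fin M → ℂ := fun z j => ((B z).det)⁻¹ * (B z).cramer (b z) j with hc
    have hcd : ∀ j, ∀ z ∈ ball z₀ ε, DifferentiableAt ℂ (fun w => c w j) z := by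
      intro j z hz
      refine ((hBd z).inv (hball z hz)).mul ?_
      simp only [Matrix.cramer_apply]
      refine differentiableAt_det fun i k => ?_
      simp only [Matrix.updateCol_apply]
      by_cases hkj : k = j
      · simp only [hkj, if_true]
        exact differentiable_iteratedDeriv (hφ _) i z
      · simp only [hkj, if_false]
        exact differentiable_iteratedDeriv (hφ _) i z
    have hBc : ∀ z ∈ ball z₀ ε, (B z).mulVec (c z) = b z := by
      intro z hz
      have h1 : c z = ((B z).det)⁻¹ • (B z).cramer (b z) := rfl
      rw [h1, Matrix.mulVec_smul, Matrix.mulVec_cramer, smul_smul, inv_mul_cancel₀ (hball z hz),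
        one_smul]
    have hrel : ∀ z ∈ ball z₀ ε, ∀ i : ℕ, i ≤ M →
        ∑ j, c z j * iteratedDeriv i (φ j.castSucc) z = iteratedDeriv i (φ (Fin.last M)) z := by
      intro z hz i hi
      rcases hi.lt_or_eq with hlt | rfl
      · have := congrFun (hBc z hz) ⟨i, hlt⟩
        simp only [Matrix.mulVec, dotProduct, hB, hb, Matrix.of_apply] at this
        rw [← this]
        exact Finset.sum_congr rfl fun j _ => mul_comm _ _
      -- For the last row, the full matrix has a kernel vector. Its last entry is nonzero because
      -- the smaller matrix is invertible; normalised to last entry -1, it is (c(z), -1).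
      · obtain ⟨v, hv0, hv⟩ := Matrix.exists_mulVec_eq_zero_iff.2 (hW z)
        have hrow : ∀ k : Fin (i + 1), ∑ j : Fin i, iteratedDeriv k (φ j.castSucc) z * v j.castSucc +
            iteratedDeriv k (φ (Fin.last i)) z * v (Fin.last i) = 0 := by
          intro k
          have := congrFun hv k
          simp only [Matrix.mulVec, dotProduct, Matrix.of_apply, Fin.sum_univ_castSucc,
            Pi.zero_apply] at this
          exact this
        have hvl : v (Fin.last i) ≠ 0 := by
          intro hvl
          have h1 : (B z).mulVec (fun j => v j.castSucc) = 0 := by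
            funext k
            have := hrow k.castSucc
            rw [hvl, mul_zero, add_zero] at this
            simpa [Matrix.mulVec, dotProduct, hB] using this
          have h2 := Matrix.eq_zero_of_mulVec_eq_zero (hball z hz) h1
          apply hv0
          funext k
          refine Fin.lastCases hvl (fun j => ?_) k
          exact congrFun h2 j
        have hcv : c z = fun j : Fin i => -(v j.castSucc / v (Fin.last i)) := by
          rw [← sub_eq_zero]
          apply Matrix.eq_zero_of_mulVec_eq_zero (hball z hz)
          rw [Matrix.mulVec_sub, hBc z hz, sub_eq_zero]
          funext k
          have := hrow k.castSucc
          simp only [Matrix.mulVec, dotProduct, hB, hb, Matrix.of_apply, mul_neg,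
            Finset.sum_neg_distrib, ← mul_div_assoc]
          rw [← Finset.sum_div, eq_neg_iff_add_eq_zero]
          field_simp
          rw [add_comm, mul_zero]
          exact this
        have := hrow (Fin.last i)
        rw [hcv]
        simp only [Fin.val_last] at this
        simp only [neg_mul, Finset.sum_neg_distrib, div_mul_eq_mul_div]
        rw [← Finset.sum_div, neg_eq_iff_add_eq_zero]
        field_simp
        rw [mul_zero, ← this]
        congr 1
        · exact Finset.sum_congr rfl fun j _ => mul_comm _ _
        · exact mul_comm _ _
    -- Differentiating the i-th relation and subtracting the (i + 1)-st leaves B c' = 0 with B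
    -- invertible.
    have hcderiv : ∀ z ∈ ball z₀ ε, ∀ j, deriv (fun w => c w j) z = 0 := by
      intro z hz
      have h0 : (B z).mulVec (fun j => deriv (fun w => c w j) z) = 0 := by
        funext i
        have hdl : HasDerivAt (fun w => ∑ j, c w j * iteratedDeriv i (φ j.castSucc) w)
            (∑ j, (deriv (fun w => c w j) z * iteratedDeriv i (φ j.castSucc) z +
              c z j * iteratedDeriv (i + 1) (φ j.castSucc) z)) z := by
          refine HasDerivAt.fun_sum fun j _ => ?_
          refine (hcd j z hz).hasDerivAt.mul ?_
          rw [iteratedDeriv_succ]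
          exact (differentiable_iteratedDeriv (hφ _) i z).hasDerivAt
        have hdr : HasDerivAt (fun w => ∑ j, c w j * iteratedDeriv i (φ j.castSucc) w)
            (iteratedDeriv (i + 1) (φ (Fin.last M)) z) z := by
          have : HasDerivAt (iteratedDeriv i (φ (Fin.last M)))
              (iteratedDeriv (i + 1) (φ (Fin.last M)) z) z := by
            rw [iteratedDeriv_succ]
            exact (differentiable_iteratedDeriv (hφ _) i z).hasDerivAt
          refine this.congr_of_eventuallyEq ?_
          filter_upwards [isOpen_ball.mem_nhds hz] with w hw
          exact hrel w hw i i.2.le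
        have h1 := hdl.unique hdr
        rw [Finset.sum_add_distrib, hrel z hz (i + 1) i.2] at h1
        have h2 := add_eq_right.1 h1
        simp only [Matrix.mulVec, dotProduct, hB, Matrix.of_apply, Pi.zero_apply]
        rw [← h2]
        exact Finset.sum_congr rfl fun j _ => mul_comm _ _
      exact fun j => congrFun (Matrix.eq_zero_of_mulVec_eq_zero (hball z hz) h0) j
    have hconst : ∀ z ∈ ball z₀ ε, c z = c z₀ := by
      intro z hz
      funext j
      have hz₀b : z₀ ∈ ball z₀ ε := mem_ball_self hε
      refine (convex_ball z₀ ε).is_const_of_fderivWithin_eq_zero (𝕜 := ℂ) (f := fun w => c w j)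
        (fun w hw => (hcd j w hw).differentiableWithinAt) (fun w hw => ?_) hz hz₀b
      rw [fderivWithin_of_isOpen isOpen_ball hw]
      ext
      simp [hcderiv w hw j]
    refine ⟨Fin.snoc (c z₀) (-1), fun h => ?_, ?_⟩
    · simpa using congrFun h (Fin.last M)
    · have hA : AnalyticOnNhd ℂ (fun z => ∑ j, (Fin.snoc (c z₀) (-1) : Fin (M + 1) → ℂ) j * φ j z)
          Set.univ := fun z _ => by
        refine Differentiable.analyticAt ?_ z
        fun_prop
      have := hA.eqOn_zero_of_preconnected_of_eventuallyEq_zero isPreconnected_univ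
        (Set.mem_univ z₀) (by
          filter_upwards [ball_mem_nhds z₀ hε] with z hz
          have h1 := hrel z hz 0 (Nat.zero_le _)
          rw [hconst z hz] at h1
          simp only [iteratedDeriv_zero] at h1
          rw [Fin.sum_univ_castSucc]
          simp [h1])
      exact fun z => this (Set.mem_univ z)

theorem natCast_sub_le_analyticOrderAt_iteratedDeriv {h : ℂ → ℂ} {a : ℂ} (hh : Differentiable ℂ h)
    {n : ℕ} (hn : (n : ℕ∞) ≤ analyticOrderAt h a) (l : ℕ) :
    ((n - l : ℕ) : ℕ∞) ≤ analyticOrderAt (iteratedDeriv l h) a := by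
  rw [natCast_le_analyticOrderAt_iff_iteratedDeriv_eq_zero (hh.analyticAt a)] at hn
  rw [natCast_le_analyticOrderAt_iff_iteratedDeriv_eq_zero
    ((differentiable_iteratedDeriv hh l).analyticAt a)]
  intro i hi
  have : iteratedDeriv i (iteratedDeriv l h) = iteratedDeriv (i + l) h := by
    simp only [iteratedDeriv_eq_iterate, Function.iterate_add_apply]
  rw [this]
  exact hn _ (by omega)

/-- At most M - 1 derivatives are taken, so column j is divisible by (z - a) to the order of φ_j
minus M - 1. This is the origin of the truncation; the natural subtraction discards smaller orders.
-/
theorem sum_order_sub_le_order_wronskianDet {M : ℕ} {φ : Fin M → ℂ → ℂ}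
    (hφ : ∀ j, Differentiable ℂ (φ j)) (h0 : ∀ j, φ j ≠ 0) (hW : wronskianDet φ ≠ 0) (a : ℂ) :
    ∑ j, (analyticOrderNatAt (φ j) a - (M - 1)) ≤ analyticOrderNatAt (wronskianDet φ) a := by
  have hWd := differentiable_wronskianDet hφ
  have hfac : ∀ i j : Fin M, ∃ k, AnalyticAt ℂ k a ∧ ∀ᶠ z in 𝓝 a, iteratedDeriv i (φ j) z =
      (z - a) ^ (analyticOrderNatAt (φ j) a - (M - 1)) • k z := by
    intro i j
    rw [← natCast_le_analyticOrderAt ((differentiable_iteratedDeriv (hφ j) i).analyticAt a)]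
    refine le_trans ?_ (natCast_sub_le_analyticOrderAt_iteratedDeriv (hφ j)
      (Nat.cast_analyticOrderNatAt (analyticOrderAt_ne_top_of_entire (hφ j) (h0 j) a)).le i)
    have := i.2
    exact_mod_cast Nat.sub_le_sub_left (by omega) _
  choose k hk hkeq using hfac
  rw [← ENat.natCast_le_natCast,
    Nat.cast_analyticOrderNatAt (analyticOrderAt_ne_top_of_entire hWd hW a),
    natCast_le_analyticOrderAt (hWd.analyticAt a)]
  have hall : ∀ᶠ z in 𝓝 a, ∀ i j : Fin M, iteratedDeriv i (φ j) z =
      (z - a) ^ (analyticOrderNatAt (φ j) a - (M - 1)) • k i j z :=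
    eventually_all.2 fun i => eventually_all.2 fun j => hkeq i j
  refine ⟨fun z => (Matrix.of fun i j => k i j z).det, ?_, ?_⟩
  · have : ∀ᶠ z in 𝓝 a, ∀ i j : Fin M, AnalyticAt ℂ (k i j) z :=
      eventually_all.2 fun i => eventually_all.2 fun j => (hk i j).eventually_analyticAt
    refine Complex.analyticAt_iff_eventually_differentiableAt.2 ?_
    filter_upwards [this] with z hz
    exact differentiableAt_det fun i j => (hz i j).differentiableAt
  · filter_upwards [hall] with z hz
    rw [wronskianDet, smul_eq_mul, ← Finset.prod_pow_eq_pow_sum]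
    rw [← Matrix.det_mul_row]
    congr 1
    ext i j
    simp [hz i j]

/-- In the Leibniz expansion each of the M! products is at most the product of max (1, |A_ij|) over
all entries. -/
theorem log_norm_det_le {M : ℕ} (A : Matrix (Fin M) (Fin M) ℂ) (hA : A.det ≠ 0) :
    Real.log ‖A.det‖ ≤ Real.log (M.factorial) + ∑ i, ∑ j, Real.posLog ‖A i j‖ := by
  have hle : ∀ i j, ‖A i j‖ ≤ Real.exp (Real.posLog ‖A i j‖) := by
    intro i j
    rcases (norm_nonneg (A i j)).eq_or_lt with h | h
    · rw [← h]; positivity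
    · rw [← Real.log_le_iff_le_exp h]
      exact le_max_right _ _
  have hone : ∀ i j, 1 ≤ Real.exp (Real.posLog ‖A i j‖) := fun i j =>
    Real.one_le_exp Real.posLog_nonneg
  have hprod : ∀ σ : Equiv.Perm (Fin M), ‖Equiv.Perm.sign σ • ∏ i, A (σ i) i‖ ≤
      Real.exp (∑ i, ∑ j, Real.posLog ‖A i j‖) := by
    intro σ
    have h1 : ‖Equiv.Perm.sign σ • ∏ i, A (σ i) i‖ = ∏ i, ‖A (σ i) i‖ := by
      rcases Int.units_eq_one_or (Equiv.Perm.sign σ) with h | h <;> simp [h]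
    rw [h1, Real.exp_sum]
    rw [← Equiv.prod_comp σ fun i => Real.exp (∑ j, Real.posLog ‖A i j‖)]
    refine Finset.prod_le_prod (fun i _ => norm_nonneg _) fun i _ => ?_
    rw [Real.exp_sum]
    refine (hle _ _).trans ?_
    rw [← Finset.mul_prod_erase Finset.univ _ (Finset.mem_univ i)]
    refine le_mul_of_one_le_right (Real.exp_pos _).le ?_
    exact Finset.prod_induction _ (fun x => 1 ≤ x) (fun _ _ => one_le_mul_of_one_le_of_one_le)
      le_rfl fun j _ => hone _ _
  have hdet : ‖A.det‖ ≤ M.factorial * Real.exp (∑ i, ∑ j, Real.posLog ‖A i j‖) := by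
    rw [Matrix.det_apply]
    refine (norm_sum_le _ _).trans ((Finset.sum_le_sum fun σ _ => hprod σ).trans_eq ?_)
    rw [Finset.sum_const, Finset.card_univ, Fintype.card_perm, Fintype.card_fin, nsmul_eq_mul]
  refine (Real.log_le_log (norm_pos_iff.2 hA) hdet).trans_eq ?_
  rw [Real.log_mul (by positivity) (by positivity), Real.log_exp]

/-- The coefficients depend on φ only and not on ψ, so the same triangular system serves all columns
of the Wronskian at once. -/
theorem exists_quotientNumerator_eq_sum {φ : ℂ → ℂ} (hφ : Differentiable ℂ φ) (l : ℕ) :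
    ∃ c : ℕ → ℂ → ℂ, (∀ k, Differentiable ℂ (c k)) ∧ (c l = fun z => φ z ^ l) ∧
      (∀ k, l < k → c k = 0) ∧ ∀ ψ : ℂ → ℂ, Differentiable ℂ ψ → ∀ z,
        quotientNumerator φ ψ l z = ∑ k ∈ Finset.range (l + 1), c k z * iteratedDeriv k ψ z := by
  induction l with
  | zero =>
    refine ⟨fun k => if k = 0 then 1 else 0, fun k => ?_, by ext; simp, fun k hk => by simp [hk.ne'],
      fun ψ _ z => by simp [quotientNumerator]⟩
    dsimp only
    split_ifs
    exacts [differentiable_const 1, differentiable_const 0]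
  | succ l ih =>
    obtain ⟨c, hc, hcl, hc0, hsum⟩ := ih
    let a : ℕ → ℂ → ℂ := fun k z => deriv (c k) z * φ z - (l + 1 : ℕ) * c k z * deriv φ z
    let b : ℕ → ℂ → ℂ := fun k => k.casesOn 0 fun k z => c k z * φ z
    have ha0 : ∀ k, l < k → a k = 0 := fun k hk => by
      funext z
      simp [a, hc0 k hk]
    refine ⟨fun k z => a k z + b k z, fun k => ?_, ?_, fun k hk => ?_, fun ψ hψ z => ?_⟩
    · refine (((hc k).deriv.mul hφ).sub (((hc k).const_mul _).mul hφ.deriv)).add ?_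
      cases k with
      | zero => exact differentiable_const 0
      | succ k => exact (hc k).mul hφ
    · funext z
      simp [ha0 (l + 1) (by omega), b, hcl, pow_succ]
    · funext z
      obtain ⟨k, rfl⟩ : ∃ j, k = j + 1 := ⟨k - 1, by omega⟩
      simp [ha0 (k + 1) (by omega), b, hc0 k (by omega)]
    · have hq : quotientNumerator φ ψ l =
          fun z => ∑ k ∈ Finset.range (l + 1), c k z * iteratedDeriv k ψ z := funext (hsum ψ hψ)
      have hd : deriv (quotientNumerator φ ψ l) z = ∑ k ∈ Finset.range (l + 1),
          (deriv (c k) z * iteratedDeriv k ψ z + c k z * iteratedDeriv (k + 1) ψ z) := by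
        rw [hq, deriv_fun_sum fun k _ => (hc k z).fun_mul (differentiable_iteratedDeriv hψ k z)]
        refine Finset.sum_congr rfl fun k _ => ?_
        rw [deriv_fun_mul (hc k z) (differentiable_iteratedDeriv hψ k z), iteratedDeriv_succ]
      simp only [add_mul]
      rw [Finset.sum_add_distrib, Finset.sum_range_succ _ (l + 1), ha0 (l + 1) (by omega),
        Finset.sum_range_succ' _ (l + 1)]
      change deriv (quotientNumerator φ ψ l) z * φ z -
        (l + 1 : ℕ) * quotientNumerator φ ψ l z * deriv φ z = _
      have hb0 : b 0 z = 0 := rfl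
      rw [hd, hsum ψ hψ, hb0]
      simp only [a, b, Finset.sum_mul, Finset.mul_sum, Pi.zero_apply, zero_mul, add_zero]
      rw [← Finset.sum_sub_distrib, ← Finset.sum_add_distrib]
      refine Finset.sum_congr rfl fun k _ => ?_
      ring

/-- The matrix is a lower triangular matrix with diagonal φ^i times the Wronskian matrix. It is the
denominator-free form of W(ψ_j/φ) = φ^(-M) W(ψ_j). -/
theorem det_quotientNumerator {M : ℕ} {φ : ℂ → ℂ} {ψ : Fin M → ℂ → ℂ} (hφ : Differentiable ℂ φ)
    (hψ : ∀ j, Differentiable ℂ (ψ j)) (z : ℂ) :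
    (Matrix.of fun i j : Fin M => quotientNumerator φ (ψ j) i z).det =
      (∏ i : Fin M, φ z ^ (i : ℕ)) * wronskianDet ψ z := by
  choose c hc hcl hc0 hsum using exists_quotientNumerator_eq_sum hφ
  have h1 : (Matrix.of fun i j : Fin M => quotientNumerator φ (ψ j) i z) =
      (Matrix.of fun i k : Fin M => c i k z) *
        Matrix.of fun k j : Fin M => iteratedDeriv k (ψ j) z := by
    ext i j
    rw [Matrix.mul_apply, Matrix.of_apply, hsum i (ψ j) (hψ j)]
    simp only [Matrix.of_apply]
    rw [Fin.sum_univ_eq_sum_range (fun k => c i k z * iteratedDeriv k (ψ j) z)]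
    refine Finset.sum_subset (Finset.range_subset_range.2 i.2) fun k _ hk => ?_
    rw [hc0 i k (by simpa using hk), Pi.zero_apply, zero_mul]
  rw [h1, Matrix.det_mul, Matrix.det_of_isLowerTriangular]
  · simp [hcl, wronskianDet]
  · intro i k hik
    rw [Matrix.of_apply, hc0 i k (by simpa using hik)]
    rfl

/-- The pointwise estimate of a Wronskian by logarithmic derivatives of quotients. -/
theorem log_norm_wronskianDet_le {M : ℕ} {φ : ℂ → ℂ} {ψ : Fin M → ℂ → ℂ} (hφ : Differentiable ℂ φ)
    (hψ : ∀ j, Differentiable ℂ (ψ j)) {z : ℂ} (hφ0 : φ z ≠ 0) (h0 : ∀ j, ψ j z ≠ 0)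
    (hW : wronskianDet ψ z ≠ 0) :
    Real.log ‖wronskianDet ψ z‖ ≤ ∑ j, Real.log ‖ψ j z‖ + Real.log (M.factorial) +
      ∑ i : Fin M, ∑ j, Real.posLog ‖quotientNumerator φ (ψ j) i z / (φ z ^ (i : ℕ) * ψ j z)‖ := by
  -- Dividing row i by φ^i and column j by ψ_j leaves the entries controlled by the lemma on higher
  -- logarithmic derivatives; the powers of φ cancel in the determinant.
  set A : Matrix (Fin M) (Fin M) ℂ :=
    Matrix.of fun i j => quotientNumerator φ (ψ j) i z / (φ z ^ (i : ℕ) * ψ j z) with hA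
  have e : wronskianDet ψ z = (∏ j, ψ j z) * A.det := by
    have hp : ∏ i : Fin M, φ z ^ (i : ℕ) ≠ 0 :=
      Finset.prod_ne_zero_iff.2 fun i _ => pow_ne_zero _ hφ0
    apply mul_left_cancel₀ hp
    rw [← det_quotientNumerator hφ hψ, ← Matrix.det_mul_row, ← Matrix.det_mul_column]
    congr 1
    ext i j
    simp only [hA, Matrix.of_apply]
    have h1 := h0 j
    have h2 := pow_ne_zero (i : ℕ) hφ0
    field_simp
  have hAdet : A.det ≠ 0 := fun h => hW (by rw [e, h, mul_zero])
  rw [e, norm_mul, norm_prod, Real.log_mul (Finset.prod_ne_zero_iff.2 fun j _ =>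
    norm_ne_zero_iff.2 (h0 j)) (norm_ne_zero_iff.2 hAdet),
    Real.log_prod fun j _ => norm_ne_zero_iff.2 (h0 j)]
  have := log_norm_det_le A hAdet
  simp only [hA, Matrix.of_apply] at this ⊢
  linarith

end Wronskian

/-! ### Weierstrass products and reduced representations of curves. -/

section ReducedRepresentation

open Metric Filter

/-- A zero-free holomorphic function on a disc has a holomorphic logarithm. -/
theorem exists_log_on_ball {p : ℂ → ℂ} (hp : Differentiable ℂ p) {r : ℝ}
    (h0 : ∀ z ∈ ball (0 : ℂ) r, p z ≠ 0) :
    ∃ l : ℂ → ℂ, DifferentiableOn ℂ l (ball 0 r) ∧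
      ∀ z ∈ ball (0 : ℂ) r, Complex.exp (l z) = p z := by
  rcases le_or_gt r 0 with hr | hr
  · refine ⟨fun _ => 0, by fun_prop, fun z hz => ?_⟩
    rw [ball_eq_empty.2 hr] at hz
    exact hz.elim
  have hd : DifferentiableOn ℂ (fun z => deriv p z / p z) (ball 0 r) := by
    have hp' : Differentiable ℂ (deriv p) := by
      have := differentiable_iteratedDeriv hp 1
      rwa [iteratedDeriv_one] at this
    exact hp'.differentiableOn.div hp.differentiableOn h0
  obtain ⟨l, hl0, hl⟩ := hd.isExactOn_ball.with_val_at 0 (Complex.log (p 0))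
  refine ⟨l, fun z hz => (hl z hz).differentiableAt.differentiableWithinAt, fun z hz => ?_⟩
  have h00 : (0 : ℂ) ∈ ball (0 : ℂ) r := mem_ball_self hr
  have hder : ∀ z ∈ ball (0 : ℂ) r,
      HasDerivAt (fun z => p z * Complex.exp (-l z)) 0 z := by
    intro z hz
    have h1 := (hp z).hasDerivAt.mul ((hl z hz).neg.cexp)
    refine h1.congr_deriv ?_
    have := h0 z hz
    field_simp
    ring
  have hconst : p z * Complex.exp (-l z) = p 0 * Complex.exp (-l 0) := by
    refine (convex_ball (0 : ℂ) r).is_const_of_fderivWithin_eq_zero (𝕜 := ℂ)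
      (f := fun z => p z * Complex.exp (-l z))
      (fun z hz => (hder z hz).differentiableAt.differentiableWithinAt) (fun z hz => ?_) hz h00
    rw [fderivWithin_of_isOpen isOpen_ball hz]
    have := (hder z hz).hasFDerivAt.fderiv
    rw [this]
    ext
    simp
  rw [hl0, Complex.exp_neg (Complex.log _), Complex.exp_log (h0 0 h00), mul_inv_cancel₀ (h0 0 h00),
    Complex.exp_neg] at hconst
  have := Complex.exp_ne_zero (l z)
  field_simp at hconst
  exact hconst.symm

/-- Approximation of a holomorphic function on a disc by entire functions. -/
theorem exists_entire_approx {l : ℂ → ℂ} {R r ε : ℝ} (hl : DifferentiableOn ℂ l (ball 0 R))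
    (hr : r < R) (hε : 0 < ε) :
    ∃ q : ℂ → ℂ, Differentiable ℂ q ∧ ∀ z ∈ ball (0 : ℂ) r, ‖l z - q z‖ ≤ ε := by
  rcases le_or_gt r 0 with hr0 | hr0
  · refine ⟨fun _ => 0, by fun_prop, fun z hz => ?_⟩
    rw [ball_eq_empty.2 hr0] at hz
    exact hz.elim
  obtain ⟨s, hrs, hsR⟩ := exists_between hr
  lift s to NNReal using (hr0.trans hrs).le
  lift r to NNReal using hr0.le
  have hd : DifferentiableOn ℂ l (closedBall 0 s) := hl.mono (closedBall_subset_ball hsR)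
  have hs0 : 0 < s := by
    have := hr0.trans hrs
    exact_mod_cast this
  have hp := hd.hasFPowerSeriesOnBall hs0
  have hu := hp.tendstoUniformlyOn' (r' := r) (by exact_mod_cast hrs)
  rw [Metric.tendstoUniformlyOn_iff] at hu
  obtain ⟨N, hN⟩ := (hu ε hε).exists
  refine ⟨fun y => (cauchyPowerSeries l 0 s).partialSum N (y - 0), ?_, fun z hz => ?_⟩
  · intro z
    have := ((cauchyPowerSeries l 0 s).partialSum_continuous N)
    unfold FormalMultilinearSeries.partialSum
    simp only [FormalMultilinearSeries.apply_eq_pow_smul_coeff]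
    fun_prop
  · have := hN z hz
    rw [dist_eq_norm] at this
    exact this.le

/-- Weierstrass: an infinite product of entire functions `p k` that are zero free on `ball 0 k`
converges after multiplication with zero free entire functions. -/
theorem exists_entire_prod {p : ℕ → ℂ → ℂ} (hp : ∀ k, Differentiable ℂ (p k))
    (h0 : ∀ k : ℕ, ∀ z ∈ ball (0 : ℂ) k, p k z ≠ 0) :
    ∃ w : ℂ → ℂ, Differentiable ℂ w ∧ ∀ K : ℕ, ∃ u : ℂ → ℂ, DifferentiableOn ℂ u (ball 0 K) ∧
      (∀ z ∈ ball (0 : ℂ) K, u z ≠ 0) ∧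
      ∀ z ∈ ball (0 : ℂ) K, w z = (∏ k ∈ Finset.range (K + 1), p k z) * u z := by
  choose l hl hlp using fun k => exists_log_on_ball (hp k) (h0 k)
  choose q hq hlq using fun k : ℕ =>
    exists_entire_approx (r := (k : ℝ) - 1) (hl k) (by linarith) (pow_pos one_half_pos k)
  -- On the disc of radius K the factors with index above K are exponentials exp (l - q), so their
  -- product is exp of this convergent tail. Moving one factor from the tail into the finite product
  -- gives W (K + 1) = W K there.
  let e : ℕ → ℂ → ℂ := fun K z => ∑' j, (l (j + (K + 1)) z - q (j + (K + 1)) z)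
  let W : ℕ → ℂ → ℂ := fun K z =>
    (∏ k ∈ Finset.range (K + 1), p k z * Complex.exp (-q k z)) * Complex.exp (e K z)
  have hsub : ∀ K j : ℕ, ball (0 : ℂ) K ⊆ ball 0 (((j + (K + 1) : ℕ) : ℝ) - 1) := fun K j =>
    ball_subset_ball (by push_cast; linarith [(Nat.cast_nonneg j : (0 : ℝ) ≤ j)])
  have hsub' : ∀ K j : ℕ, ball (0 : ℂ) K ⊆ ball 0 ((j + (K + 1) : ℕ) : ℝ) := fun K j =>
    ball_subset_ball (by push_cast; linarith [(Nat.cast_nonneg j : (0 : ℝ) ≤ j)])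
  have hbound : ∀ K j : ℕ, ∀ z ∈ ball (0 : ℂ) K,
      ‖l (j + (K + 1)) z - q (j + (K + 1)) z‖ ≤ (1 / 2 : ℝ) ^ j := fun K j z hz =>
    (hlq _ z (hsub K j hz)).trans
      (pow_le_pow_of_le_one (by norm_num) (by norm_num) (Nat.le_add_right _ _))
  have hgeo : Summable fun j : ℕ => (1 / 2 : ℝ) ^ j := summable_geometric_two
  have he : ∀ K : ℕ, DifferentiableOn ℂ (e K) (ball 0 K) := fun K =>
    Complex.differentiableOn_tsum_of_summable_norm hgeo
      (fun j => ((hl _).mono (hsub' K j)).sub (hq _).differentiableOn) isOpen_ball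
      (fun j z hz => hbound K j z hz)
  have hstep : ∀ K : ℕ, ∀ z ∈ ball (0 : ℂ) K, W (K + 1) z = W K z := by
    intro K z hz
    have hs : Summable fun j => l (j + (K + 1)) z - q (j + (K + 1)) z :=
      Summable.of_norm_bounded hgeo fun j => hbound K j z hz
    have h1 : e K z = (l (K + 1) z - q (K + 1) z) + e (K + 1) z := by
      simp only [e]
      rw [hs.tsum_eq_zero_add]
      simp only [zero_add]
      congr 2
      ext j
      rw [show j + 1 + (K + 1) = j + (K + 1 + 1) by ring]
    have h2 := hlp (K + 1) z (by simpa using hsub' K 0 hz)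
    simp only [W]
    rw [Finset.prod_range_succ _ (K + 1), h1, Complex.exp_add, sub_eq_add_neg, Complex.exp_add, h2]
    ring
  have hWK : ∀ K : ℕ, ∀ z ∈ ball (0 : ℂ) K, ∀ j : ℕ, W (K + j) z = W K z := by
    intro K z hz j
    induction j with
    | zero => rfl
    | succ j ih =>
      rw [← ih, ← hstep (K + j) z (ball_subset_ball (by push_cast; linarith
        [(Nat.cast_nonneg j : (0 : ℝ) ≤ j)]) hz), add_assoc]
  -- Any index above |z| gives the same value, so the local products glue.
  let w : ℂ → ℂ := fun z => W (⌊‖z‖⌋₊ + 1) z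
  have hw : ∀ K : ℕ, ∀ z ∈ ball (0 : ℂ) K, w z = W K z := by
    intro K z hz
    have h1 : z ∈ ball (0 : ℂ) ((⌊‖z‖⌋₊ + 1 : ℕ) : ℝ) := by
      simpa using Nat.lt_floor_add_one ‖z‖
    rw [← hWK K z hz (⌊‖z‖⌋₊ + 1), add_comm, hWK _ z h1]
  have hWd : ∀ K : ℕ, DifferentiableOn ℂ (W K) (ball 0 K) := fun K =>
    (DifferentiableOn.fun_finsetProd fun k _ =>
      ((hp k).mul (hq k).neg.cexp).differentiableOn).mul (he K).cexp
  refine ⟨w, fun z => ?_, fun K => ⟨fun z =>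
    (∏ k ∈ Finset.range (K + 1), Complex.exp (-q k z)) * Complex.exp (e K z), ?_, ?_, ?_⟩⟩
  · obtain ⟨K, hK⟩ := exists_nat_gt ‖z‖
    have hz : ball (0 : ℂ) K ∈ 𝓝 z := isOpen_ball.mem_nhds (by simpa using hK)
    exact ((hWd K).differentiableAt hz).congr_of_eventuallyEq
      (Filter.mem_of_superset hz fun y hy => hw K y hy)
  · exact (DifferentiableOn.fun_finsetProd fun k _ => (hq k).neg.cexp.differentiableOn).mul
      (he K).cexp
  · exact fun z _ => mul_ne_zero (Finset.prod_ne_zero_iff.2 fun k _ => Complex.exp_ne_zero _)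
      (Complex.exp_ne_zero _)
  · intro z hz
    rw [hw K z hz]
    simp only [W, Finset.prod_mul_distrib]
    ring

/-- Weierstrass: every effective divisor on the plane is the zero divisor of an entire function. -/
theorem exists_entire_of_divisor (m : ℂ → ℕ)
    (hm : ∀ r : ℝ, {a | a ∈ closedBall (0 : ℂ) r ∧ m a ≠ 0}.Finite) :
    ∃ w : ℂ → ℂ, Differentiable ℂ w ∧ ∀ a, ∃ v : ℂ → ℂ, AnalyticAt ℂ v a ∧ v a ≠ 0 ∧
      ∀ᶠ z in 𝓝 a, w z = (z - a) ^ m a * v z := by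
  have hfin : ∀ k : ℕ, {a : ℂ | (k : ℝ) ≤ ‖a‖ ∧ ‖a‖ < k + 1 ∧ m a ≠ 0}.Finite := fun k =>
    (hm (k + 1)).subset fun a ha => ⟨by simpa using ha.2.1.le, ha.2.2⟩
  -- The support is sorted into the annuli k ≤ |a| < k + 1, so that the k-th factor has no zeros in
  -- |z| < k.
  let S : ℕ → Finset ℂ := fun k => (hfin k).toFinset
  have hS : ∀ (k : ℕ) a, a ∈ S k ↔ (k : ℝ) ≤ ‖a‖ ∧ ‖a‖ < k + 1 ∧ m a ≠ 0 := fun k a => by simp [S]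
  let p : ℕ → ℂ → ℂ := fun k z => ∏ a ∈ S k, (z - a) ^ m a
  obtain ⟨w, hw, hwu⟩ := exists_entire_prod (p := p) (fun k => by fun_prop) (by
    intro k z hz
    refine Finset.prod_ne_zero_iff.2 fun a ha => pow_ne_zero _ (sub_ne_zero.2 ?_)
    rintro rfl
    exact absurd ((hS k z).1 ha).1 (not_le.2 (by simpa using hz)))
  refine ⟨w, hw, fun a => ?_⟩
  obtain ⟨K, hK⟩ := exists_nat_gt ‖a‖
  obtain ⟨u, hu, hu0, hwK⟩ := hwu K
  have haK : ball (0 : ℂ) K ∈ 𝓝 a := isOpen_ball.mem_nhds (by simpa using hK)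
  have hdisj : ((Finset.range (K + 1) : Finset ℕ) : Set ℕ).PairwiseDisjoint S := by
    intro i _ j _ hij
    rw [Function.onFun, Finset.disjoint_left]
    intro b hb hb'
    rw [hS] at hb hb'
    apply hij
    have h1 : (i : ℝ) < j + 1 := hb.1.trans_lt hb'.2.1
    have h2 : (j : ℝ) < i + 1 := hb'.1.trans_lt hb.2.1
    have h1' : i < j + 1 := by exact_mod_cast h1
    have h2' : j < i + 1 := by exact_mod_cast h2
    omega
  let T := (Finset.range (K + 1)).biUnion S
  have hT : ∀ z, ∏ k ∈ Finset.range (K + 1), p k z =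
      (z - a) ^ m a * ∏ b ∈ T.erase a, (z - b) ^ m b := by
    intro z
    simp only [p]
    rw [← Finset.prod_biUnion hdisj]
    by_cases haT : a ∈ T
    · exact (Finset.mul_prod_erase T (fun b => (z - b) ^ m b) haT).symm
    · have hma : m a = 0 := by
        by_contra h
        apply haT
        refine Finset.mem_biUnion.2 ⟨⌊‖a‖⌋₊, ?_, ?_⟩
        · rw [Finset.mem_range]
          exact Nat.lt_succ_of_lt ((Nat.floor_lt (norm_nonneg _)).2 hK)
        · rw [hS]
          exact ⟨Nat.floor_le (norm_nonneg _), Nat.lt_floor_add_one _, h⟩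
      rw [hma, Finset.erase_eq_of_notMem haT, pow_zero, one_mul]
  refine ⟨fun z => (∏ b ∈ T.erase a, (z - b) ^ m b) * u z, ?_, ?_, ?_⟩
  · have h1 : AnalyticAt ℂ (fun z => ∏ b ∈ T.erase a, (z - b) ^ m b) a :=
      Differentiable.analyticAt (by fun_prop) a
    exact h1.mul (hu.analyticAt haK)
  · refine mul_ne_zero (Finset.prod_ne_zero_iff.2 fun b hb => pow_ne_zero _ (sub_ne_zero.2 ?_))
      (hu0 a (mem_of_mem_nhds haK))
    exact (Finset.ne_of_mem_erase hb).symm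
  · filter_upwards [haK] with z hz
    rw [hwK z hz, hT]
    ring

theorem Projectivization.mk_rep_apply_mul {n : ℕ} (v : Fin (n + 1) → ℂ) (hv : v ≠ 0) :
    ∃ a : ℂ, a ≠ 0 ∧ ∀ i, (Projectivization.mk ℂ v hv).rep i = a * v i := by
  obtain ⟨a, ha⟩ := Projectivization.exists_smul_eq_mk_rep ℂ v hv
  exact ⟨a, a.ne_zero, fun i => by rw [← ha]; rfl⟩

/-- A coordinate of a holomorphic curve that is not identically zero has isolated zeros. -/
theorem ProjCurve.IsHolomorphicMap.eventually_rep_ne_zero {n : ℕ} {f : ℂ → PSpace n}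
    (hf : IsHolomorphicMap f) {i : Fin (n + 1)} (hi : (f 0).rep i ≠ 0) (z₀ : ℂ) :
    ∀ᶠ z in 𝓝[≠] z₀, (f z).rep i ≠ 0 := by
  -- The chosen representative need not depend continuously on z, but the vanishing of its
  -- coordinate is read off from any local holomorphic lift. The points near which the coordinate
  -- vanishes thus form an open and closed set.
  have key : ∀ z₀ : ℂ, (∀ᶠ z in 𝓝 z₀, (f z).rep i = 0) ∨ ∀ᶠ z in 𝓝[≠] z₀, (f z).rep i ≠ 0 := by
    intro z₀
    obtain ⟨F, hF, hfF⟩ := hf z₀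
    have hFi : AnalyticAt ℂ (fun z => F z i) z₀ := (analyticAt_pi_iff.1 hF) i
    have hiff : ∀ᶠ z in 𝓝 z₀, ((f z).rep i = 0 ↔ F z i = 0) := by
      filter_upwards [hfF] with z hz
      obtain ⟨h, hz⟩ := hz
      obtain ⟨a, ha, haF⟩ := Projectivization.mk_rep_apply_mul (F z) h
      rw [hz, haF]
      simp [ha]
    rcases hFi.eventually_eq_zero_or_eventually_ne_zero with h | h
    · left
      filter_upwards [h, hiff] with z h1 h2 using h2.2 h1
    · right
      filter_upwards [h, nhdsWithin_le_nhds hiff] with z h1 h2 using fun h3 => h1 (h2.1 h3)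
  let A : Set ℂ := {z₀ | ∀ᶠ z in 𝓝 z₀, (f z).rep i = 0}
  have hAo : IsOpen A := by
    rw [isOpen_iff_mem_nhds]
    intro z hz
    exact eventually_eventually_nhds.2 hz
  have hAc : IsClosed A := by
    rw [← isOpen_compl_iff, isOpen_iff_mem_nhds]
    intro z hz
    have h := (key z).resolve_left hz
    rw [eventually_nhdsWithin_iff] at h
    filter_upwards [h] with y hy
    intro hyA
    by_cases hyz : y = z
    · exact hz (hyz ▸ hyA)
    · exact hy hyz (show ∀ᶠ z in 𝓝 y, (f z).rep i = 0 from hyA).self_of_nhds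
  rcases isClopen_iff.1 ⟨hAc, hAo⟩ with h | h
  · refine (key z₀).resolve_left fun h' => ?_
    have : z₀ ∈ A := h'
    rw [h] at this
    exact this
  · have : (0 : ℂ) ∈ A := h ▸ Set.mem_univ _
    exact (hi (show ∀ᶠ z in 𝓝 (0 : ℂ), (f z).rep i = 0 from this).self_of_nhds).elim

/-- Every holomorphic curve in projective space has a reduced representation. -/
theorem ProjCurve.IsHolomorphicMap.exists_isReducedRepresentation {n : ℕ} {f : ℂ → PSpace n}
    (hf : IsHolomorphicMap f) : ∃ F, IsReducedRepresentation F f := by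
  obtain ⟨i₀, hi₀⟩ : ∃ i, (f 0).rep i ≠ 0 := by
    by_contra! h
    exact (f 0).rep_nonzero (funext h)
  have hne := hf.eventually_rep_ne_zero hi₀
  choose Φ hΦ hfΦ using hf
  have hΦi : ∀ z₀ i, AnalyticAt ℂ (fun z => Φ z₀ z i) z₀ := fun z₀ i => (analyticAt_pi_iff.1 (hΦ z₀)) i
  have hord : ∀ z₀, analyticOrderAt (fun z => Φ z₀ z i₀) z₀ ≠ ⊤ := by
    intro z₀ h
    rw [analyticOrderAt_eq_top] at h
    have h1 : ∀ᶠ z in 𝓝[≠] z₀, (f z).rep i₀ = 0 := nhdsWithin_le_nhds (by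
      filter_upwards [h, hfΦ z₀] with z h1 h2
      obtain ⟨h, hz⟩ := h2
      obtain ⟨a, ha, haF⟩ := Projectivization.mk_rep_apply_mul _ h
      rw [hz, haF, h1, mul_zero])
    obtain ⟨z, hz1, hz2⟩ := (h1.and (hne z₀)).exists
    exact hz2 hz1
  -- The zero order of coordinate i₀ in a local lift without common zeros: the exact power needed to
  -- clear the poles of f_i/f_{i₀}.
  let m : ℂ → ℕ := fun z₀ => analyticOrderNatAt (fun z => Φ z₀ z i₀) z₀
  have hm0 : ∀ z, (f z).rep i₀ ≠ 0 → m z = 0 := by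
    intro z hz
    obtain ⟨h, hz'⟩ := (hfΦ z).self_of_nhds
    obtain ⟨a, ha, haF⟩ := Projectivization.mk_rep_apply_mul _ h
    rw [hz', haF] at hz
    have := (hΦi z i₀).analyticOrderAt_eq_zero.2 (right_ne_zero_of_mul hz)
    simp [m, analyticOrderNatAt, this]
  have hmfin : ∀ r : ℝ, {a | a ∈ closedBall (0 : ℂ) r ∧ m a ≠ 0}.Finite := by
    intro r
    have : (closedBall (0 : ℂ) r ∩ {a | m a ≠ 0}).Finite := by
      refine (isCompact_closedBall (0 : ℂ) r).induction_on (p := fun s => (s ∩ {a | m a ≠ 0}).Finite)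
        (by simp) (fun s t hst ht => ht.subset (Set.inter_subset_inter_left _ hst))
        (fun s t hs ht => by rw [Set.union_inter_distrib_right]; exact hs.union ht) ?_
      intro x _
      have h := hne x
      rw [eventually_nhdsWithin_iff] at h
      refine ⟨_, nhdsWithin_le_nhds h, (Set.finite_singleton x).subset ?_⟩
      rintro y ⟨hy1, hy2⟩
      by_contra hyx
      exact hy2 (hm0 y (hy1 hyx))
    exact this
  obtain ⟨w, hw, hwm⟩ := exists_entire_of_divisor m hmfin
  -- The functions w · f_i/f_{i₀} involve ratios only, hence do not depend on representatives. The
  -- punctured limit fills the removable singularities.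
  let G : ℂ → Fin (n + 1) → ℂ := fun z i =>
    limUnder (𝓝[≠] z) fun y => w y * ((f y).rep i / (f y).rep i₀)
  have hG : ∀ z₀, ∃ h : ℂ → ℂ, AnalyticAt ℂ h z₀ ∧ h z₀ ≠ 0 ∧
      ∀ᶠ z in 𝓝 z₀, ∀ i, G z i = h z * Φ z₀ z i := by
    intro z₀
    obtain ⟨v, hv, hv0, hwv⟩ := hwm z₀
    obtain ⟨u, hu, hu0, hΦu⟩ := ((hΦi z₀ i₀).analyticOrderAt_ne_top).1 (hord z₀)
    -- Near z₀ both w and coordinate i₀ of the lift are (z - z₀)^m times a unit, so G is the lift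
    -- times the unit v/u.
    refine ⟨fun z => v z / u z, hv.div hu hu0, div_ne_zero hv0 hu0, ?_⟩
    have h1 : ∀ᶠ y in 𝓝 z₀, y ≠ z₀ → ∀ i,
        w y * ((f y).rep i / (f y).rep i₀) = v y / u y * Φ z₀ y i := by
      filter_upwards [hwv, hΦu, hfΦ z₀, hu.continuousAt.eventually_ne hu0] with y h1 h2 h3 h4 hy i
      obtain ⟨h, h3⟩ := h3
      obtain ⟨a, ha, haF⟩ := Projectivization.mk_rep_apply_mul _ h
      rw [h1, h3, haF, haF, h2]
      have : (y - z₀) ^ analyticOrderNatAt (fun z => Φ z₀ z i₀) z₀ ≠ 0 :=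
        pow_ne_zero _ (sub_ne_zero.2 hy)
      simp only [m, smul_eq_mul]
      field_simp
    have h2 : ∀ᶠ z in 𝓝 z₀, AnalyticAt ℂ v z ∧ AnalyticAt ℂ u z ∧ u z ≠ 0 ∧ AnalyticAt ℂ (Φ z₀) z :=
      hv.eventually_analyticAt.and (hu.eventually_analyticAt.and
        ((hu.continuousAt.eventually_ne hu0).and (hΦ z₀).eventually_analyticAt))
    filter_upwards [eventually_eventually_nhds.2 h1, h2] with z hz1 ⟨hvz, huz, hu0z, hΦz⟩ i
    have hc : ContinuousAt (fun y => v y / u y * Φ z₀ y i) z :=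
      (hvz.continuousAt.div huz.continuousAt hu0z).mul
        ((analyticAt_pi_iff.1 hΦz) i).continuousAt
    refine Tendsto.limUnder_eq ((hc.tendsto.mono_left nhdsWithin_le_nhds).congr' ?_)
    by_cases hzz : z = z₀
    · subst hzz
      filter_upwards [nhdsWithin_le_nhds hz1, self_mem_nhdsWithin] with y h1 h2
      exact (h1 h2 i).symm
    · filter_upwards [nhdsWithin_le_nhds hz1, nhdsWithin_le_nhds (eventually_ne_nhds hzz)]
        with y h1 h2
      exact (h1 h2 i).symm
  refine ⟨G, fun z₀ => ?_, fun z₀ => ?_⟩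
  · obtain ⟨h, hh, h0, hGh⟩ := hG z₀
    rw [differentiableAt_pi]
    intro i
    refine DifferentiableAt.congr_of_eventuallyEq (hh.mul (hΦi z₀ i)).differentiableAt ?_
    filter_upwards [hGh] with z hz using hz i
  · obtain ⟨h, hh, h0, hGh⟩ := hG z₀
    obtain ⟨hΦ0, hf0⟩ := (hfΦ z₀).self_of_nhds
    have hGz : G z₀ = h z₀ • Φ z₀ z₀ := funext fun i => hGh.self_of_nhds i
    have hne : G z₀ ≠ 0 := by
      rw [hGz]
      exact smul_ne_zero h0 hΦ0
    refine ⟨hne, ?_⟩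
    rw [hf0, Projectivization.mk_eq_mk_iff']
    refine ⟨(h z₀)⁻¹, ?_⟩
    rw [hGz, smul_smul, inv_mul_cancel₀ h0, one_smul]

end ReducedRepresentation

/-! ### Projective varieties, dimension and Krull's height theorem. -/

section ProjectiveGeometry

open MvPolynomial (eval)

variable {n : ℕ}

theorem MvPolynomial.IsHomogeneous.eval_smul {σ : Type*} {e : ℕ} {P : MvPolynomial σ ℂ}
    (hP : P.IsHomogeneous e) (t : ℂ) (v : σ → ℂ) : eval (t • v) P = t ^ e * eval v P := by
  rw [MvPolynomial.eval_eq, MvPolynomial.eval_eq, Finset.mul_sum]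
  refine Finset.sum_congr rfl fun m hm => ?_
  have hdeg : ∑ i ∈ m.support, m i = e := by
    have := hP (MvPolynomial.mem_support_iff.mp hm)
    simpa [Finsupp.weight_apply, Finsupp.sum] using this
  simp only [Pi.smul_apply, smul_eq_mul, mul_pow, Finset.prod_mul_distrib,
    Finset.prod_pow_eq_pow_sum, hdeg]
  ring

theorem ProjCurve.mem_vanishingIdeal_iff_subset {V : Set (PSpace n)} {P : Poly n} {e : ℕ}
    (hP : P.IsHomogeneous e) : P ∈ vanishingIdeal V ↔ V ⊆ zeroLocus {P} := by
  constructor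
  · intro h x hx Q hQ
    rw [Set.mem_singleton_iff.1 hQ]
    exact h x.rep x.rep_nonzero (by rwa [Projectivization.mk_rep])
  · intro h v hv hvV
    exact (vanishesAt_mk hP v hv).1 (h hvV P rfl)

/-- At a vector v over V, the polynomial t ↦ P(tv) vanishes for all t ≠ 0, hence has zero
coefficients; these are the values of the components at v. -/
theorem ProjCurve.homogeneousComponent_mem_vanishingIdeal {V : Set (PSpace n)} {P : Poly n}
    (hP : P ∈ vanishingIdeal V) (i : ℕ) :
    MvPolynomial.homogeneousComponent i P ∈ vanishingIdeal V := by
  intro v hv hvV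
  let p : Polynomial ℂ := ∑ j ∈ Finset.range (P.totalDegree + 1),
    Polynomial.C (eval v (MvPolynomial.homogeneousComponent j P)) * Polynomial.X ^ j
  have hp : ∀ t : ℂ, t ≠ 0 → p.IsRoot t := by
    intro t ht
    have h1 : eval (t • v) P = 0 := by
      refine hP (t • v) (smul_ne_zero ht hv) ?_
      convert! hvV using 1
      rw [Projectivization.mk_eq_mk_iff']
      exact ⟨t, rfl⟩
    rw [← MvPolynomial.sum_homogeneousComponent P, map_sum] at h1
    simp only [p, Polynomial.IsRoot.def, Polynomial.eval_finsetSum, Polynomial.eval_mul,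
      Polynomial.eval_C, Polynomial.eval_pow, Polynomial.eval_X]
    rw [← h1]
    refine Finset.sum_congr rfl fun j _ => ?_
    rw [(MvPolynomial.homogeneousComponent_isHomogeneous j P).eval_smul, mul_comm]
  have hp0 : p = 0 := by
    refine Polynomial.eq_zero_of_infinite_isRoot p ?_
    exact (Set.Infinite.mono (s := {0}ᶜ) (fun t ht => hp t ht) (Set.finite_singleton 0).infinite_compl)
  by_cases hi : i < P.totalDegree + 1
  · have := congrArg (Polynomial.coeff · i) hp0
    simpa [p, Polynomial.finsetSum_coeff, Polynomial.coeff_C_mul, Polynomial.coeff_X_pow, hi,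
      Nat.lt_succ_iff.1 hi] using this
  · rw [MvPolynomial.homogeneousComponent_eq_zero i P (by omega), map_zero]

theorem ProjCurve.isAlgebraicSet_zeroLocus_singleton {P : Poly n} {e : ℕ} (hP : P.IsHomogeneous e) :
    IsAlgebraicSet (zeroLocus {P}) :=
  ⟨{P}, fun Q hQ => ⟨e, by rwa [Set.mem_singleton_iff.1 hQ]⟩, rfl⟩

theorem ProjCurve.IsAlgebraicSet.inter {A B : Set (PSpace n)} (hA : IsAlgebraicSet A)
    (hB : IsAlgebraicSet B) : IsAlgebraicSet (A ∩ B) := by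
  obtain ⟨S, hS, rfl⟩ := hA
  obtain ⟨T, hT, rfl⟩ := hB
  refine ⟨S ∪ T, fun P hP => hP.elim (hS P) (hT P), ?_⟩
  ext x
  simp only [zeroLocus, Set.mem_inter_iff, Set.mem_ofPred_eq, Set.mem_union]
  exact ⟨fun h P hP => hP.elim (h.1 P) (h.2 P), fun h => ⟨fun P hP => h P (Or.inl hP),
    fun P hP => h P (Or.inr hP)⟩⟩

theorem ProjCurve.vanishingIdeal_anti {A B : Set (PSpace n)} (h : A ⊆ B) :
    vanishingIdeal B ≤ vanishingIdeal A := fun _ hP v hv hvA => hP v hv (h hvA)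

theorem ProjCurve.IsAlgebraicSet.subset_of_vanishingIdeal_le {A B : Set (PSpace n)}
    (hA : IsAlgebraicSet A) (h : vanishingIdeal A ≤ vanishingIdeal B) : B ⊆ A := by
  obtain ⟨S, hS, rfl⟩ := hA
  intro x hx P hP
  obtain ⟨e, he⟩ := hS P hP
  refine (mem_vanishingIdeal_iff_subset he).1 (h ((mem_vanishingIdeal_iff_subset he).2 ?_)) hx P rfl
  intro y hy Q hQ
  rw [Set.mem_singleton_iff.1 hQ]
  exact hy P hP

theorem ProjCurve.vanishingIdeal_lt {A B : Set (PSpace n)} (hA : IsAlgebraicSet A) (h : A ⊂ B) :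
    vanishingIdeal B < vanishingIdeal A :=
  lt_of_le_not_ge (vanishingIdeal_anti h.1) fun h' => h.2 (hA.subset_of_vanishingIdeal_le h')

/-- A proper homogeneous ideal is prime once this holds for homogeneous elements, and for two forms
it is irreducibility applied to their zero sets. -/
theorem ProjCurve.IsProjectiveVariety.isPrime {V : Set (PSpace n)} (hV : IsProjectiveVariety V) :
    (vanishingIdeal V).IsPrime := by
  let _ : GradedAlgebra (MvPolynomial.homogeneousSubmodule (Fin (n + 1)) ℂ) :=
    MvPolynomial.gradedAlgebra
  have hI : (vanishingIdeal V).IsHomogeneous (MvPolynomial.homogeneousSubmodule (Fin (n + 1)) ℂ) :=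
    fun i P hP => by
      have h := homogeneousComponent_mem_vanishingIdeal hP i
      rwa [← MvPolynomial.decomposition.decompose'_apply] at h
  refine hI.isPrime_of_homogeneous_mem_or_mem ?_ ?_
  · rw [Ideal.ne_top_iff_one]
    intro h
    obtain ⟨x, hx⟩ := hV.nonempty
    simpa using h x.rep x.rep_nonzero (by rwa [Projectivization.mk_rep])
  · rintro P Q ⟨i, hP⟩ ⟨j, hQ⟩ hPQ
    rw [MvPolynomial.mem_homogeneousSubmodule] at hP hQ
    rw [mem_vanishingIdeal_iff_subset hP, mem_vanishingIdeal_iff_subset hQ]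
    refine hV.irreducible _ _ (isAlgebraicSet_zeroLocus_singleton hP)
      (isAlgebraicSet_zeroLocus_singleton hQ) fun x hx => ?_
    have := hPQ x.rep x.rep_nonzero (by rwa [Projectivization.mk_rep])
    rw [map_mul, mul_eq_zero] at this
    simpa [zeroLocus, VanishesAt] using this

/-- The irrelevant ideal, as the ideal of the vertex of the affine cone. -/
theorem ProjCurve.vanishingIdeal_lt_vertex {V : Set (PSpace n)} (hV : V.Nonempty) :
    vanishingIdeal V < MvPolynomial.vanishingIdeal ℂ {(0 : Fin (n + 1) → ℂ)} := by
  obtain ⟨x, hx⟩ := hV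
  have hx' : Projectivization.mk ℂ x.rep x.rep_nonzero ∈ V := by rwa [Projectivization.mk_rep]
  refine lt_of_le_not_ge (fun P hP => ?_) fun h => ?_
  · rw [MvPolynomial.mem_vanishingIdeal_singleton_iff]
    have := homogeneousComponent_mem_vanishingIdeal hP 0 x.rep x.rep_nonzero hx'
    rw [MvPolynomial.homogeneousComponent_zero, MvPolynomial.eval_C] at this
    rw [← this]
    simp [MvPolynomial.aeval_zero, MvPolynomial.constantCoeff_eq]
  · refine x.rep_nonzero (funext fun i => ?_)
    have h1 : (MvPolynomial.X i : Poly n) ∈ vanishingIdeal V :=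
      h (by simp)
    simpa using h1 x.rep x.rep_nonzero hx'

/-- Fewer than `dim X + 1` forms of positive degree have a common zero on `X`. -/
theorem ProjCurve.length_lt_card_of_forall_not_vanish {X : Set (PSpace n)}
    (p : LTSeries {Z : Set (PSpace n) // IsProjectiveVariety Z ∧ Z ⊆ X}) (s : Finset (Poly n))
    (hs : ∀ P ∈ s, ∃ e, 0 < e ∧ P.IsHomogeneous e)
    (h0 : ∀ x ∈ X, ∃ P ∈ s, ¬ VanishesAt P x) : p.length + 1 ≤ s.card := by
  classical
  set V := p.last.1 with hVdef
  have hV : IsProjectiveVariety V := p.last.2.1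
  have hVX : V ⊆ X := p.last.2.2
  set I := vanishingIdeal V
  set m := MvPolynomial.vanishingIdeal ℂ {(0 : Fin (n + 1) → ℂ)}
  let π := Ideal.Quotient.mk I
  have hπ : Function.Surjective π := Ideal.Quotient.mk_surjective
  have hcomap : ∀ J : Ideal (Poly n), I ≤ J → (J.map π).comap π = J := fun J hJ => by
    rw [Ideal.comap_map_of_surjective π hπ, ← RingHom.ker_eq_comap_bot, Ideal.mk_ker,
      sup_eq_left.2 hJ]
  have hprime : ∀ J : Ideal (Poly n), J.IsPrime → I ≤ J → (J.map π).IsPrime := fun J hJ h =>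
    Ideal.map_isPrime_of_surjective hπ (by rwa [Ideal.mk_ker])
  have hlt : ∀ J J' : Ideal (Poly n), I ≤ J → J < J' → J.map π < J'.map π := fun J J' h h' =>
    lt_of_le_not_ge (Ideal.map_mono h'.le) fun h'' => h'.not_ge (by
      rw [← hcomap J h, ← hcomap J' (h.trans h'.le)]
      exact Ideal.comap_mono h'')
  have hIm : I < m := vanishingIdeal_lt_vertex hV.nonempty
  have hmp : (m.map π).IsPrime := hprime m inferInstance hIm.le
  have hle : ∀ i, I ≤ vanishingIdeal (p i).1 := fun i =>
    vanishingIdeal_anti (p.monotone (Fin.le_last i))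
  -- Read from the top, the chain of varieties becomes an ascending chain of primes above I(V). The
  -- ideal of the vertex of the cone lies strictly above all of them and adds one more step.
  have hchain : ∀ j : ℕ, ∀ hj : j ≤ p.length,
      (j : ℕ∞) ≤ ((vanishingIdeal (p ⟨p.length - j, by omega⟩).1).map π).height := by
    intro j
    induction j with
    | zero => simp
    | succ j ih =>
      intro hj
      have h1 := ih (by omega)
      have := hprime _ (p ⟨p.length - j, by omega⟩).2.1.isPrime (hle _)
      have := hprime _ (p ⟨p.length - (j + 1), by omega⟩).2.1.isPrime (hle _)
      have h2 : p ⟨p.length - (j + 1), by omega⟩ < p ⟨p.length - j, by omega⟩ :=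
        p.strictMono (by rw [Fin.lt_def]; simp only; omega)
      have h3 := Ideal.height_add_one_le_of_lt_of_isPrime (hlt _ _ (hle _)
        (vanishingIdeal_lt (p _).2.1.isAlgebraicSet
          (Subtype.coe_lt_coe.2 h2)))
      push_cast
      exact (add_le_add_left h1 1).trans h3
  have hm1 : ((p.length + 1 : ℕ) : ℕ∞) ≤ (m.map π).height := by
    have h1 := hchain p.length le_rfl
    have := hprime _ (p ⟨p.length - p.length, by omega⟩).2.1.isPrime (hle _)
    have h3 := Ideal.height_add_one_le_of_lt_of_isPrime (hlt _ m
      (hle ⟨p.length - p.length, Nat.lt_succ_of_le (Nat.sub_le _ _)⟩)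
      (vanishingIdeal_lt_vertex (p _).2.1.nonempty))
    push_cast
    exact (add_le_add_left h1 1).trans h3
  have hsm : ∀ P ∈ s, P ∈ m := by
    intro P hP
    obtain ⟨e, he, hPe⟩ := hs P hP
    have := hPe.eval_smul 0 0
    rw [zero_smul, zero_pow he.ne', zero_mul] at this
    rw [MvPolynomial.mem_vanishingIdeal_singleton_iff]
    exact this
  -- A prime containing I(V) and the forms has no zero in affine space except possibly the vertex,
  -- since the forms have no common zero on V. By the Nullstellensatz it contains the ideal of the
  -- vertex.
  have hmin : m.map π ∈ (Ideal.span ((s.image π : Finset _) : Set (Poly n ⧸ I))).minimalPrimes := by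
    refine ⟨⟨hmp, ?_⟩, ?_⟩
    · rw [Ideal.span_le]
      intro y hy
      obtain ⟨P, hP, rfl⟩ := Finset.mem_image.1 (Finset.mem_coe.1 hy)
      exact Ideal.mem_map_of_mem _ (hsm P hP)
    · rintro Q ⟨hQ, hsQ⟩ -
      rw [Ideal.map_le_iff_le_comap]
      have hQ' : (Q.comap π).IsPrime := hQ.comap π
      have hIQ : I ≤ Q.comap π := by
        intro P hP
        rw [Ideal.mem_comap, Ideal.Quotient.eq_zero_iff_mem.2 hP]
        exact Q.zero_mem
      have hz := hQ'.radical
      rw [← MvPolynomial.vanishingIdeal_zeroLocus_eq_radical (K := ℂ)] at hz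
      rw [← hz]
      refine MvPolynomial.vanishingIdeal_anti_mono fun v hv => ?_
      rw [Set.mem_singleton_iff]
      by_contra hv0
      have hvV : Projectivization.mk ℂ v hv0 ∈ V := by
        obtain ⟨S, hS, hVS⟩ := hV.isAlgebraicSet
        rw [hVS]
        intro P hP
        obtain ⟨e, he⟩ := hS P hP
        rw [vanishesAt_mk he]
        refine hv P (hIQ ((mem_vanishingIdeal_iff_subset he).2 ?_))
        rw [hVS]
        intro y hy P' hP'
        rw [Set.mem_singleton_iff.1 hP']
        exact hy P hP
      obtain ⟨P, hP, hPv⟩ := h0 _ (hVX hvV)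
      obtain ⟨e, -, he⟩ := hs P hP
      rw [vanishesAt_mk he] at hPv
      exact hPv (hv P (hsQ (Ideal.subset_span (Finset.mem_coe.2 (Finset.mem_image_of_mem _ hP)))))
  -- Krull's height theorem: a minimal prime over an ideal with s generators has height at most s.
  have hcard := (hm1.trans (Ideal.height_le_card_of_mem_minimalPrimes_span_finset hmin))
  exact (Nat.cast_le.1 hcard).trans Finset.card_image_le

/-- Every algebraic set is a finite union of varieties. -/
theorem ProjCurve.IsAlgebraicSet.exists_finite_cover {W : Set (PSpace n)} (hW : IsAlgebraicSet W) :
    ∃ t : Set (Set (PSpace n)), t.Finite ∧ (∀ Z ∈ t, IsProjectiveVariety Z ∧ Z ⊆ W) ∧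
      W ⊆ ⋃₀ t := by
  -- Noetherian induction: a smaller algebraic set has a strictly larger vanishing ideal.
  have hwf : WellFounded fun A B : Set (PSpace n) => vanishingIdeal B < vanishingIdeal A :=
    InvImage.wf vanishingIdeal (wellFounded_gt (α := Ideal (Poly n)))
  induction W using hwf.induction with
  | _ W ih =>
    rcases W.eq_empty_or_nonempty with rfl | hne
    · exact ⟨∅, Set.finite_empty, by simp, by simp⟩
    by_cases hirr : ∀ A B : Set (PSpace n), IsAlgebraicSet A → IsAlgebraicSet B →
        W ⊆ A ∪ B → W ⊆ A ∨ W ⊆ B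
    · exact ⟨{W}, Set.finite_singleton W, by
        rintro Z hZ
        rw [Set.mem_singleton_iff.1 hZ]
        exact ⟨⟨hW, hne, hirr⟩, subset_rfl⟩, by simp⟩
    · push Not at hirr
      obtain ⟨A, B, hA, hB, hAB, hWA, hWB⟩ := hirr
      have key : ∀ C, IsAlgebraicSet C → ¬ W ⊆ C →
          ∃ t : Set (Set (PSpace n)), t.Finite ∧ (∀ Z ∈ t, IsProjectiveVariety Z ∧ Z ⊆ W ∩ C) ∧
            W ∩ C ⊆ ⋃₀ t := fun C hC hWC =>
        ih _ (vanishingIdeal_lt (hW.inter hC) ⟨Set.inter_subset_left, fun h =>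
          hWC fun x hx => (h hx).2⟩) (hW.inter hC)
      obtain ⟨t₁, hf₁, ht₁, hc₁⟩ := key A hA hWA
      obtain ⟨t₂, hf₂, ht₂, hc₂⟩ := key B hB hWB
      refine ⟨t₁ ∪ t₂, hf₁.union hf₂, ?_, ?_⟩
      · rintro Z (hZ | hZ)
        · exact ⟨(ht₁ Z hZ).1, (ht₁ Z hZ).2.trans Set.inter_subset_left⟩
        · exact ⟨(ht₂ Z hZ).1, (ht₂ Z hZ).2.trans Set.inter_subset_left⟩
      · intro x hx
        rw [Set.sUnion_union]
        exact (hAB hx).imp (fun h => hc₁ ⟨hx, h⟩) (fun h => hc₂ ⟨hx, h⟩)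

/-- Otherwise each member of t has a polynomial vanishing on it but not on V. Their product vanishes
on V, against primality. -/
theorem ProjCurve.IsProjectiveVariety.subset_of_subset_sUnion {V : Set (PSpace n)}
    (hV : IsProjectiveVariety V) {t : Set (Set (PSpace n))} (ht : t.Finite)
    (hta : ∀ Z ∈ t, IsAlgebraicSet Z) (h : V ⊆ ⋃₀ t) : ∃ Z ∈ t, V ⊆ Z := by
  by_contra! hcon
  have hP : ∀ Z ∈ t, ∃ P : Poly n, P ∈ vanishingIdeal Z ∧ P ∉ vanishingIdeal V := fun Z hZ => by
    by_contra! h'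
    exact hcon Z hZ ((hta Z hZ).subset_of_vanishingIdeal_le h')
  choose! P hPZ hPV using hP
  have hprod : ∏ Z ∈ ht.toFinset, P Z ∈ vanishingIdeal V := by
    intro v hv hvV
    obtain ⟨Z, hZ, hvZ⟩ := h hvV
    rw [map_prod]
    exact Finset.prod_eq_zero (ht.mem_toFinset.2 hZ) (hPZ Z hZ v hv hvZ)
  have := hV.isPrime
  obtain ⟨Z, hZ, hZV⟩ := (Ideal.IsPrime.prod_mem_iff).1 hprod
  exact hPV Z (ht.mem_toFinset.1 hZ) hZV

/-- A linear form without zeros in a given finite set. -/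
theorem ProjCurve.exists_linearForm_not_vanish {t : Set (PSpace n)} (ht : t.Finite) :
    ∃ L : Poly n, L.IsHomogeneous 1 ∧ ∀ x ∈ t, ¬ VanishesAt L x := by
  have := ht.to_subtype
  obtain ⟨φ, hφ⟩ := Module.exists_dual_forall_apply_ne_zero (K := ℂ) (fun x : t => x.1.rep)
    (fun x => x.1.rep_nonzero)
  refine ⟨∑ i, MvPolynomial.C (φ (Pi.single i 1)) * MvPolynomial.X i,
    MvPolynomial.IsHomogeneous.sum _ _ _ fun i _ => MvPolynomial.isHomogeneous_C_mul_X _ _,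
    fun x hx h => hφ ⟨x, hx⟩ ?_⟩
  unfold VanishesAt at h
  rw [LinearMap.pi_apply_eq_sum_univ φ]
  refine Eq.trans ?_ h
  rw [map_sum]
  refine Finset.sum_congr rfl fun i _ => ?_
  rw [map_mul, MvPolynomial.eval_C, MvPolynomial.eval_X, smul_eq_mul, mul_comm]
  congr 2
  ext j
  simp [Pi.single_apply, eq_comm]

/-- An algebraic set of dimension less than `e` has no common point with `e` suitable
hyperplanes. -/
theorem ProjCurve.IsAlgebraicSet.exists_linearForms {W : Set (PSpace n)} (hW : IsAlgebraicSet W)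
    {e : ℕ} (hdim : ∀ p : LTSeries {Z : Set (PSpace n) // IsProjectiveVariety Z ∧ Z ⊆ W},
      p.length < e) :
    ∃ s : Finset (Poly n), s.card ≤ e ∧ (∀ P ∈ s, P.IsHomogeneous 1) ∧
      ∀ x ∈ W, ∃ P ∈ s, ¬ VanishesAt P x := by
  classical
  induction e generalizing W with
  | zero =>
    obtain ⟨t, -, ht, hc⟩ := hW.exists_finite_cover
    refine ⟨∅, by simp, by simp, fun x hx => ?_⟩
    obtain ⟨Z, hZ, -⟩ := hc hx
    exact absurd (hdim (RelSeries.singleton _ ⟨Z, ht Z hZ⟩)) (by simp)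
  | succ e ih =>
    obtain ⟨t, htf, ht, hc⟩ := hW.exists_finite_cover
    -- One point is marked on each variety of a finite cover. A hyperplane missing all of them
    -- contains no variety of the cover, so every chain in W ∩ {L = 0} can be lengthened at the top
    -- by one of these varieties.
    choose! y hy using fun Z (hZ : Z ∈ t) => (ht Z hZ).1.nonempty
    obtain ⟨L, hL, hLy⟩ := exists_linearForm_not_vanish (htf.image y)
    obtain ⟨s, hsc, hs, hs0⟩ := ih (hW.inter (isAlgebraicSet_zeroLocus_singleton hL)) (by
      intro p
      have hlast := p.last.2
      obtain ⟨Z, hZ, hlZ⟩ := hlast.1.subset_of_subset_sUnion htf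
        (fun Z hZ => (ht Z hZ).1.isAlgebraicSet) ((hlast.2.trans Set.inter_subset_left).trans hc)
      let ι : {Z : Set (PSpace n) // IsProjectiveVariety Z ∧ Z ⊆ W ∩ zeroLocus {L}} →
          {Z : Set (PSpace n) // IsProjectiveVariety Z ∧ Z ⊆ W} :=
        fun Z => ⟨Z.1, Z.2.1, Z.2.2.trans Set.inter_subset_left⟩
      have hι : StrictMono ι := fun A B h => h
      have hlt : (p.map ι hι).last < ⟨Z, ht Z hZ⟩ := by
        refine lt_of_le_not_ge ?_ fun h => ?_
        · simpa [ι] using hlZ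
        · have h1 : y Z ∈ p.last.1 := by
            have h2 : Z ⊆ p.last.1 := by simpa [ι] using h
            exact h2 (hy Z hZ)
          exact hLy _ (Set.mem_image_of_mem y hZ) ((hlast.2 h1).2 L rfl)
      have := hdim ((p.map ι hι).snoc ⟨Z, ht Z hZ⟩ hlt)
      simp only [RelSeries.snoc_length, LTSeries.map_length] at this
      omega)
    refine ⟨insert L s, (Finset.card_insert_le _ _).trans (by omega), ?_, fun x hx => ?_⟩
    · intro P hP
      rcases Finset.mem_insert.1 hP with rfl | hP
      exacts [hL, hs P hP]
    · by_cases hxL : VanishesAt L x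
      · obtain ⟨P, hP, hPx⟩ := hs0 x ⟨hx, fun Q hQ => by rwa [Set.mem_singleton_iff.1 hQ]⟩
        exact ⟨P, Finset.mem_insert_of_mem hP, hPx⟩
      · exact ⟨L, Finset.mem_insert_self _ _, hxL⟩

/-- A nonempty set that is cut out by `m` forms on a variety has codimension at most `m`. -/
theorem ProjCurve.codimIn_le_card {V W : Set (PSpace n)} (hV : IsProjectiveVariety V) {k : ℕ}
    (hk : dim V = k) (s : Finset (Poly n)) (hs : ∀ P ∈ s, ∃ e, 0 < e ∧ P.IsHomogeneous e)
    (hW : W.Nonempty) (hWs : ∀ x, x ∈ W ↔ x ∈ V ∧ ∀ P ∈ s, VanishesAt P x) :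
    codimIn V W ≤ s.card := by
  classical
  have hWV : W ⊆ V := fun x hx => ((hWs x).1 hx).1
  have hWa : IsAlgebraicSet W := by
    have : W = V ∩ zeroLocus (s : Set (Poly n)) := by
      ext x
      rw [hWs]
      rfl
    rw [this]
    exact hV.isAlgebraicSet.inter ⟨_, fun P hP => (hs P hP).imp fun e he => he.2, rfl⟩
  have hle : dim W ≤ k := by
    rw [← hk]
    exact Order.krullDim_le_of_strictMono
      (fun Z : {Z : Set (PSpace n) // IsProjectiveVariety Z ∧ Z ⊆ W} =>
        (⟨Z.1, Z.2.1, Z.2.2.trans hWV⟩ : {Z : Set (PSpace n) // IsProjectiveVariety Z ∧ Z ⊆ V}))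
      fun A B h => h
  have hbot : dim W ≠ ⊥ := by
    obtain ⟨t, -, ht, hc⟩ := hWa.exists_finite_cover
    obtain ⟨x, hx⟩ := hW
    obtain ⟨Z, hZ, -⟩ := hc hx
    have : Nonempty {Z : Set (PSpace n) // IsProjectiveVariety Z ∧ Z ⊆ W} := ⟨⟨Z, ht Z hZ⟩⟩
    exact Order.krullDim_ne_bot_iff.2 inferInstance
  obtain ⟨e, he⟩ : ∃ e : ℕ, dim W = e := by
    obtain ⟨a, ha⟩ := WithBot.ne_bot_iff_exists.1 hbot
    rw [← ha] at hle
    have hle' : a ≤ (k : ℕ∞) := by exact_mod_cast hle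
    obtain ⟨e, he⟩ := ENat.ne_top_iff_exists.1 (ne_top_of_le_ne_top (ENat.natCast_ne_top k) hle')
    exact ⟨e, by rw [← ha, ← he]; rfl⟩
  -- With e = dim W, at most e + 1 hyperplanes have no common point on W. Together with s they have
  -- no common zero on V, so k + 1 ≤ #s + e + 1.
  obtain ⟨s', hs'c, hs', hs'0⟩ := hWa.exists_linearForms (e := e + 1) (by
    intro p
    have h1 : (p.length : WithBot ℕ∞) ≤ dim W := Order.LTSeries.length_le_krullDim p
    rw [he] at h1
    have h2 : p.length ≤ e := by exact_mod_cast h1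
    omega)
  obtain ⟨p, hp⟩ := (Order.le_krullDim_iff (n := k)).1 hk.ge
  have h1 := length_lt_card_of_forall_not_vanish p (s ∪ s') (by
    intro P hP
    rcases Finset.mem_union.1 hP with hP | hP
    exacts [hs P hP, ⟨1, one_pos, hs' P hP⟩]) (by
    intro x hx
    by_cases hxW : x ∈ W
    · obtain ⟨P, hP, hPx⟩ := hs'0 x hxW
      exact ⟨P, Finset.mem_union_right _ hP, hPx⟩
    · rw [hWs] at hxW
      push Not at hxW
      obtain ⟨P, hP, hPx⟩ := hxW hx
      exact ⟨P, Finset.mem_union_left _ hP, hPx⟩)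
  have h2 := Finset.card_union_le s s'
  rw [codimIn, if_neg hW.ne_empty, hk, he]
  have h3 : k ≤ s.card + e := by omega
  have h4 : ((k : WithBot ℕ∞).unbotD 0 : ℕ∞) = k := rfl
  have h5 : ((e : WithBot ℕ∞).unbotD 0 : ℕ∞) = e := rfl
  rw [h4, h5, tsub_le_iff_right]
  exact_mod_cast h3

end ProjectiveGeometry

/-! ### The second main theorem for linear systems of entire functions. -/

section SecondMainTheorem

open Real Metric Filter

/-- A weighted selection of linearly independent vectors: if `#Γ ≤ δ #B` whenever `B` spans the same
space as `Γ`, then a nonnegative weight is controlled by its sum over an independent subset. -/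
theorem exists_linearIndepOn_sum_le {U ι : Type*} [AddCommGroup U] [Module ℂ U] [Fintype ι]
    (v : ι → U) {δ : ℝ} (hδ : 0 ≤ δ) (w : ι → ℝ) (hw : ∀ i, 0 ≤ w i)
    (h : ∀ Γ : Finset ι, Γ.Nonempty → (∀ i ∈ Γ, 0 < w i) → ∀ B ⊆ Γ,
      v '' Γ ⊆ Submodule.span ℂ (v '' B) → (Γ.card : ℝ) ≤ δ * B.card) :
    ∃ B : Finset ι, LinearIndepOn ℂ v (B : Set ι) ∧ (∀ i ∈ B, 0 < w i) ∧
      ∑ i, w i ≤ δ * ∑ i ∈ B, w i := by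
  classical
  -- Induction on the number of positive weights: lowering all of them by their minimum μ makes at
  -- least one vanish.
  induction hm : (Finset.univ.filter fun i => 0 < w i).card using Nat.strong_induction_on
    generalizing w with
  | _ m ih =>
  set Γ := Finset.univ.filter fun i => 0 < w i with hΓ
  have hmem : ∀ i, i ∈ Γ ↔ 0 < w i := fun i => by simp [hΓ]
  rcases Γ.eq_empty_or_nonempty with hemp | hne
  · refine ⟨∅, by simp, by simp, ?_⟩
    have : ∀ i, w i = 0 := fun i => le_antisymm (not_lt.1 fun hi => by
      have := (hmem i).2 hi
      simp [hemp] at this) (hw i)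
    simp [this]
  obtain ⟨i₀, hi₀, hmin⟩ := Γ.exists_min_image w hne
  set μ := w i₀
  have hμ : 0 < μ := (hmem i₀).1 hi₀
  let w' : ι → ℝ := fun i => if i ∈ Γ then w i - μ else 0
  have hw' : ∀ i, 0 ≤ w' i := fun i => by
    by_cases hi : i ∈ Γ
    · simpa [w', hi] using hmin i hi
    · simp [w', hi]
  have hw'w : ∀ i, 0 < w' i → 0 < w i := fun i hi => by
    by_contra hn
    have : i ∉ Γ := fun h' => hn ((hmem i).1 h')
    simp [w', this] at hi
  have hcard : (Finset.univ.filter fun i => 0 < w' i).card < m := by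
    rw [← hm]
    refine Finset.card_lt_card ⟨fun i hi => ?_, fun hsub => ?_⟩
    · exact (hmem i).2 (hw'w i (by simpa using hi))
    · have := hsub hi₀
      simp [w', hi₀, μ] at this
  obtain ⟨B', hB', hB'pos, hB'sum⟩ := ih _ hcard w' hw'
    (fun Γ' hΓ' hpos => h Γ' hΓ' fun i hi => hw'w i (hpos i hi)) rfl
  have hB'Γ : (B' : Set ι) ⊆ (Γ : Set ι) := fun i hi => (hmem i).2 (hw'w i (hB'pos i hi))
  -- The subset found for the lowered weights is enlarged to a basis of the span of Γ. Restoring μ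
  -- adds μ #Γ on the left and δμ #B on the right, and #Γ ≤ δ #B.
  obtain ⟨b, hbΓ, hB'b, hspan, hb⟩ := exists_linearIndepOn_extension hB' hB'Γ
  have hbf : b.Finite := Γ.finite_toSet.subset hbΓ
  set B := hbf.toFinset with hB
  have hBb : (B : Set ι) = b := by simp [hB]
  have hBΓ : B ⊆ Γ := by
    rw [← Finset.coe_subset, hBb]
    exact hbΓ
  have hB'B : B' ⊆ B := by
    rw [← Finset.coe_subset, hBb]
    exact hB'b
  have hΓB := h Γ hne (fun i hi => (hmem i).1 hi) B hBΓ (by rwa [hBb])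
  refine ⟨B, by rwa [hBb], fun i hi => (hmem i).1 (hBΓ hi), ?_⟩
  have hsum : ∑ i, w i = ∑ i, w' i + μ * Γ.card := by
    have h1 : ∀ i, w i = w' i + if i ∈ Γ then μ else 0 := fun i => by
      by_cases hi : i ∈ Γ
      · simp [w', hi]
      · have : w i = 0 := le_antisymm (not_lt.1 fun h' => hi ((hmem i).2 h')) (hw i)
        simp [w', hi, this]
    rw [Finset.sum_congr rfl fun i _ => h1 i, Finset.sum_add_distrib, Finset.sum_ite_mem]
    simp [mul_comm]
  have hsumB : ∑ i ∈ B, w i = ∑ i ∈ B, w' i + μ * B.card := by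
    have h1 : ∀ i ∈ B, w i = w' i + μ := fun i hi => by simp [w', hBΓ hi]
    rw [Finset.sum_congr rfl h1, Finset.sum_add_distrib]
    simp [mul_comm]
  have hle : ∑ i ∈ B', w' i ≤ ∑ i ∈ B, w' i :=
    Finset.sum_le_sum_of_subset_of_nonneg hB'B fun i _ _ => hw' i
  rw [hsum, hsumB]
  have h2 := mul_le_mul_of_nonneg_left hle hδ
  have h3 := mul_le_mul_of_nonneg_left hΓB hμ.le
  linarith

theorem exists_basis_extending {U ι : Type*} [AddCommGroup U] [Module ℂ U] [Module.Finite ℂ U]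
    {M : ℕ} (hM : Module.finrank ℂ U = M) {v : ι → U} {B : Finset ι}
    (hB : LinearIndepOn ℂ v (B : Set ι)) :
    ∃ (Ψ : Module.Basis (Fin M) ℂ U) (e : B ↪ Fin M), ∀ i, Ψ (e i) = v i := by
  classical
  have hs := hB.id_image
  let b := Module.Basis.extend hs
  have : Fintype (hs.extend (Set.subset_univ _)) := FiniteDimensional.fintypeBasisIndex b
  have hcard : Fintype.card (hs.extend (Set.subset_univ _)) = M := by
    rw [← hM, Module.finrank_eq_card_basis b]
  let E := Fintype.equivFinOfCardEq hcard
  have hmem : ∀ i : B, v i ∈ hs.extend (Set.subset_univ _) := fun i =>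
    hs.subset_extend _ (Set.mem_image_of_mem v i.2)
  refine ⟨b.reindex E, ⟨fun i => E ⟨v i, hmem i⟩, fun i j hij => ?_⟩, fun i => ?_⟩
  · have h1 := congrArg Subtype.val (E.injective hij)
    exact hB.injective h1
  · have : E.symm (E ⟨v i, hmem i⟩) = ⟨v i, hmem i⟩ := E.symm_apply_apply _
    rw [Module.Basis.reindex_apply, Module.Basis.extend_apply_self]
    exact congrArg Subtype.val this

variable {U : Type*} [AddCommGroup U] [Module ℂ U]

theorem wronskianDet_basis_change {M : ℕ} {A : U →ₗ[ℂ] ℂ → ℂ} (hA : ∀ u, Differentiable ℂ (A u))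
    (b Ψ : Module.Basis (Fin M) ℂ U) :
    ∃ p : ℂ, p ≠ 0 ∧
      ∀ z, wronskianDet (fun j => A (Ψ j)) z = p * wronskianDet (fun j => A (b j)) z := by
  refine ⟨(b.toMatrix Ψ).det, ?_, wronskianDet_change (fun j => hA (b j)) _ fun j z => ?_⟩
  · have := b.invertibleToMatrix Ψ
    exact (Matrix.isUnit_det_of_invertible _).ne_zero
  · conv_lhs => rw [← b.sum_toMatrix_smul_self Ψ j, map_sum]
    simp

theorem wronskianDet_basis_ne_zero {M : ℕ} {A : U →ₗ[ℂ] ℂ → ℂ} (hA : ∀ u, Differentiable ℂ (A u))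
    (hinj : ∀ u, A u = 0 → u = 0) (b : Module.Basis (Fin M) ℂ U) :
    wronskianDet (fun j => A (b j)) ≠ 0 := by
  intro h
  obtain ⟨c, hc, hsum⟩ := exists_relation_of_wronskianDet_eq_zero (fun j => hA (b j))
    fun z => congrFun h z
  apply hc
  have h1 : ∑ j, c j • b j = 0 := hinj _ (funext fun z => by simpa using hsum z)
  exact funext (Fintype.linearIndependent_iff.1 b.linearIndependent c h1)

/-- The pointwise estimate for an independent subfamily. -/
theorem exists_sum_sub_log_le [Module.Finite ℂ U] {ι : Type*} {M : ℕ} {A : U →ₗ[ℂ] ℂ → ℂ}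
    (hA : ∀ u, Differentiable ℂ (A u)) (b : Module.Basis (Fin M) ℂ U) {N : ℂ → ℝ}
    (hN : ∀ u, ∃ C : ℝ, ∀ z, A u z ≠ 0 → log ‖A u z‖ ≤ C + N z)
    {φ : ℂ → ℂ} (hφ : Differentiable ℂ φ) (v : ι → U) (B : Finset ι) :
    ∃ (Ψ : Module.Basis (Fin M) ℂ U) (C : ℝ), 0 ≤ C ∧ (LinearIndepOn ℂ v (B : Set ι) →
      (∀ a, ∀ n : ℕ → ℕ, ∑ i ∈ B, n (analyticOrderNatAt (A (v i)) a) ≤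
        ∑ j, n (analyticOrderNatAt (A (Ψ j)) a)) ∧
      ∀ z, φ z ≠ 0 → (∀ j, A (Ψ j) z ≠ 0) → wronskianDet (fun j => A (b j)) z ≠ 0 →
        ∑ i ∈ B, (N z - log ‖A (v i) z‖) ≤ M * N z - log ‖wronskianDet (fun j => A (b j)) z‖ + C +
          ∑ i : Fin M, ∑ j : Fin M,
            log⁺ ‖quotientNumerator φ (A (Ψ j)) i z / (φ z ^ (i : ℕ) * A (Ψ j) z)‖) := by
  classical
  -- Dependent sets receive dummy data, so that the basis and the constant can be chosen as
  -- functions of all B.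
  by_cases hB : LinearIndepOn ℂ v (B : Set ι)
  swap
  · exact ⟨b, 0, le_rfl, fun h => (hB h).elim⟩
  have hM : Module.finrank ℂ U = M := by simp [Module.finrank_eq_card_basis b]
  obtain ⟨Ψ, e, he⟩ := exists_basis_extending hM hB
  obtain ⟨p, hp, hW⟩ := wronskianDet_basis_change hA b Ψ
  choose C hC using fun j => hN (Ψ j)
  refine ⟨Ψ, ∑ j, |C j| + |log (M.factorial)| + |log ‖p‖|, by positivity, fun _ => ⟨?_, ?_⟩⟩
  · intro a n
    rw [← Finset.sum_coe_sort B, Finset.sum_congr rfl fun i (_ : i ∈ Finset.univ) => by rw [← he i],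
      ← Finset.sum_map Finset.univ e fun j => n (analyticOrderNatAt (A (Ψ j)) a)]
    exact Finset.sum_le_sum_of_subset (Finset.subset_univ _)
  · intro z hφz hΨz hWz
    have h1 := log_norm_wronskianDet_le (ψ := fun j => A (Ψ j)) hφ (fun j => hA _) hφz hΨz (by
      rw [hW]
      exact mul_ne_zero hp hWz)
    rw [hW, norm_mul, log_mul (norm_ne_zero_iff.2 hp) (norm_ne_zero_iff.2 hWz)] at h1
    -- Adding |C j| makes every term nonnegative, so the sum over B may be extended to the whole
    -- basis.
    have h2 : ∑ i ∈ B, (N z - log ‖A (v i) z‖) ≤ ∑ j, (|C j| + N z - log ‖A (Ψ j) z‖) := by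
      have h3 : ∀ j, N z - log ‖A (Ψ j) z‖ ≤ |C j| + N z - log ‖A (Ψ j) z‖ := fun j => by
        linarith [abs_nonneg (C j)]
      have h4 : ∀ j, 0 ≤ |C j| + N z - log ‖A (Ψ j) z‖ := fun j => by
        linarith [hC j z (hΨz j), le_abs_self (C j)]
      rw [← Finset.sum_coe_sort B, Finset.sum_congr rfl fun i (_ : i ∈ Finset.univ) => by rw [← he i],
        ← Finset.sum_map Finset.univ e fun j => N z - log ‖A (Ψ j) z‖]
      exact (Finset.sum_le_sum fun j _ => h3 j).trans
        (Finset.sum_le_sum_of_subset_of_nonneg (Finset.subset_univ _) fun j _ _ => h4 j)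
    simp only [Finset.sum_sub_distrib, Finset.sum_add_distrib, Finset.sum_const, Finset.card_univ,
      Fintype.card_fin, nsmul_eq_mul] at h2 ⊢
    have h5 := neg_abs_le (log ‖p‖)
    have h6 := le_abs_self (log (M.factorial : ℝ))
    linarith

/-- The second main theorem for linear combinations of entire functions in subgeneral position,
together with the truncation of the counting functions. -/
theorem exists_circleAverage_le_add_logDeriv [Module.Finite ℂ U] {ι : Type*} [Fintype ι] {M : ℕ}
    {A : U →ₗ[ℂ] ℂ → ℂ} (hA : ∀ u, Differentiable ℂ (A u)) (hinj : ∀ u, A u = 0 → u = 0)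
    (hM : Module.finrank ℂ U = M) (hM0 : M ≠ 0) {N : ℂ → ℝ} (hNc : Continuous N)
    (hN : ∀ u, ∃ C : ℝ, ∀ z, A u z ≠ 0 → log ‖A u z‖ ≤ C + N z)
    {φ : ℂ → ℂ} (hφ : Differentiable ℂ φ) (hφ0 : φ ≠ 0) (v : ι → U) {δ c : ℝ} (hδ : 0 ≤ δ)
    (hc : 0 < c) (hgood : ∀ z, ∀ Γ : Finset ι, Γ.Nonempty →
      (∀ i ∈ Γ, ‖A (v i) z‖ < c * exp (N z)) → ∀ B ⊆ Γ,
        v '' Γ ⊆ Submodule.span ℂ (v '' B) → (Γ.card : ℝ) ≤ δ * B.card)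
    {P : ℂ → ℂ} (hP : Differentiable ℂ P) (hP0 : P ≠ 0) {κ : ℝ}
    (hκ : ∀ a, ((Finset.univ.filter fun i => A (v i) a = 0).card : ℝ) ≤
      κ * analyticOrderNatAt P a) :
    ∃ (Ψ : Finset ι → Module.Basis (Fin M) ℂ U) (K : ℝ), 0 ≤ K ∧ ∀ r : ℝ, 1 ≤ r →
      (Fintype.card ι - δ * M) * circleAverage N 0 r ≤
        (M - 1) * κ * circleAverage (fun z => log ‖P z‖) 0 r + K +
          K * ∑ s : Finset ι × Fin M × Fin M, circleAverage (fun z => log⁺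
            ‖quotientNumerator φ (A (Ψ s.1 s.2.2)) s.2.1 z /
              (φ z ^ (s.2.1 : ℕ) * A (Ψ s.1 s.2.2) z)‖) 0 r := by
  classical
  obtain ⟨b⟩ : Nonempty (Module.Basis (Fin M) ℂ U) := ⟨Module.finBasisOfFinrankEq ℂ U hM⟩
  choose Ψ C hC0 hΨ using fun B : Finset ι => exists_sum_sub_log_le hA b hN hφ v B
  set W := wronskianDet fun j => A (b j) with hWdef
  have hW : Differentiable ℂ W := differentiable_wronskianDet fun j => hA _
  have hW0 : W ≠ 0 := wronskianDet_basis_ne_zero hA hinj b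
  -- If `v i` were 0, the hypothesis with Γ = {i} and B empty would read 1 ≤ 0.
  have hv0 : ∀ i, A (v i) ≠ 0 := by
    intro i h0
    have h1 := hinj _ h0
    have h2 := hgood 0 {i} (Finset.singleton_nonempty i) (by
      intro j hj
      rw [Finset.mem_singleton.1 hj, h0]
      simpa using by positivity) ∅ (Finset.empty_subset _) (by simp [h1])
    norm_num at h2
  have hΨ0 : ∀ B j, A (Ψ B j) ≠ 0 := fun B j h => (Ψ B).ne_zero j (hinj _ h)
  -- the counting functions
  have hord : ∀ a, ∑ i, (analyticOrderNatAt (A (v i)) a : ℝ) ≤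
      δ * analyticOrderNatAt W a + (M - 1) * κ * analyticOrderNatAt P a := by
    intro a
    let e : ι → ℕ := fun i => analyticOrderNatAt (A (v i)) a
    -- The weights are the excesses of the orders over M - 1. A positive excess forces vanishing at
    -- a, so the smallness required by `hgood` is trivial.
    obtain ⟨B, hB, hBpos, hBsum⟩ := exists_linearIndepOn_sum_le v hδ
      (fun i => ((e i - (M - 1) : ℕ) : ℝ)) (fun i => by positivity) (by
        intro Γ hΓ hpos
        refine hgood a Γ hΓ fun i hi => ?_
        have h1 : e i ≠ 0 := by
          have := hpos i hi
          have h2 : 0 < e i - (M - 1) := by exact_mod_cast this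
          omega
        have h3 := (analyticOrderNatAt_eq_zero_iff (hA (v i)) (hv0 i) a).not_left.1 h1
        rw [h3]
        simpa using by positivity)
    obtain ⟨p, hp, hWp⟩ := wronskianDet_basis_change hA b (Ψ B)
    have h1 := (hΨ B hB).1 a fun k => k - (M - 1)
    have h2 := sum_order_sub_le_order_wronskianDet (fun j => hA (Ψ B j)) (hΨ0 B)
      (wronskianDet_basis_ne_zero hA hinj (Ψ B)) a
    have h3 : analyticOrderNatAt (wronskianDet fun j => A (Ψ B j)) a = analyticOrderNatAt W a := by
      have : (wronskianDet fun j => A (Ψ B j)) = (fun _ => p) * W := funext hWp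
      rw [this, analyticOrderNatAt, analyticOrderAt_mul analyticAt_const (hW.analyticAt a),
        analyticAt_const.analyticOrderAt_eq_zero.2 hp, zero_add, analyticOrderNatAt]
    rw [h3] at h2
    have h4 : (∑ i ∈ B, ((e i - (M - 1) : ℕ) : ℝ)) ≤ analyticOrderNatAt W a := by
      exact_mod_cast h1.trans h2
    -- What truncation loses is at most M - 1 at each actual zero, and the number of such i at a is
    -- bounded through P.
    have h5 : ∀ i, (e i : ℝ) ≤ ((e i - (M - 1) : ℕ) : ℝ) +
        if A (v i) a = 0 then ((M : ℝ) - 1) else 0 := by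
      intro i
      have hM1 : ((M - 1 : ℕ) : ℝ) = (M : ℝ) - 1 := by
        rw [Nat.cast_sub (by omega), Nat.cast_one]
      split_ifs with hi
      · rw [← hM1, ← Nat.cast_add, Nat.cast_le]
        omega
      · have : e i = 0 := (analyticOrderNatAt_eq_zero_iff (hA (v i)) (hv0 i) a).2 hi
        simp [this]
    have h6 := Finset.sum_le_sum fun i (_ : i ∈ Finset.univ) => h5 i
    rw [Finset.sum_add_distrib, ← Finset.sum_filter, Finset.sum_const, nsmul_eq_mul] at h6
    have hM1 : 0 ≤ (M : ℝ) - 1 := by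
      have : (1 : ℝ) ≤ M := by exact_mod_cast Nat.one_le_iff_ne_zero.2 hM0
      linarith
    have h7 := mul_le_mul_of_nonneg_left (hκ a) hM1
    have h8 := mul_le_mul_of_nonneg_left h4 hδ
    simp only [e] at h6 hBsum h8
    linarith
  -- `hord` says that δ div W + (M - 1)κ div P - ∑ div A(v_i) is effective; Jensen's formula turns
  -- this into an inequality of means.
  obtain ⟨K₁, hK₁⟩ := exists_le_sum_circleAverage_log_norm Finset.univ
    (Sum.elim (fun i => A (v i)) fun t : Bool => if t then W else P)
    (Sum.elim (fun _ => -1) fun t : Bool => if t then δ else (M - 1) * κ)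
    (by
      rintro (i | t) _
      · exact hA _
      · cases t <;> simp [hW, hP])
    (by
      rintro (i | t) _
      · exact hv0 _
      · cases t <;> simp [hW0, hP0])
    (by
      intro a
      have := hord a
      simp only [Fintype.sum_sum_type, Sum.elim_inl, Sum.elim_inr, Fintype.sum_bool, if_true,
        Bool.false_eq_true, if_false, neg_one_mul, Finset.sum_neg_distrib]
      linarith)
  simp only [Fintype.sum_sum_type, Sum.elim_inl, Sum.elim_inr, Fintype.sum_bool, if_true,
    Bool.false_eq_true, if_false, neg_one_mul, Finset.sum_neg_distrib] at hK₁
  -- the proximity functions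
  let E : Finset ι × Fin M × Fin M → ℂ → ℝ := fun s z => log⁺
    ‖quotientNumerator φ (A (Ψ s.1 s.2.2)) s.2.1 z / (φ z ^ (s.2.1 : ℕ) * A (Ψ s.1 s.2.2) z)‖
  have hE0 : ∀ s z, 0 ≤ E s z := fun s z => posLog_nonneg
  have hEi : ∀ s r, CircleIntegrable (E s) 0 r := fun s r =>
    circleIntegrable_posLog_quotientNumerator hφ (hA _) _ r
  set K₂ : ℝ := Fintype.card ι * |log c| + δ * (Fintype.card ι * |log c| + ∑ B, C B) with hK₂
  have hsumC : 0 ≤ ∑ B, C B := Finset.sum_nonneg fun B _ => hC0 B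
  have hK₂0 : 0 ≤ K₂ := by positivity
  let Z : Set ℂ := {z | W z = 0} ∪ {z | φ z = 0} ∪ (⋃ i, {z | A (v i) z = 0}) ∪
    ⋃ B, ⋃ j, {z | A (Ψ B j) z = 0}
  have hZ : Z.Countable :=
    (((countable_zeros hW hW0).union (countable_zeros hφ hφ0)).union
      (Set.countable_iUnion fun i => countable_zeros (hA _) (hv0 i))).union
      (Set.countable_iUnion fun B => Set.countable_iUnion fun j => countable_zeros (hA _) (hΨ0 B j))
  have hpoint : ∀ z ∉ Z, Fintype.card ι * N z - ∑ i, log ‖A (v i) z‖ ≤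
      δ * M * N z - δ * log ‖W z‖ + K₂ + δ * ∑ s, E s z := by
    intro z hz
    simp only [Z, Set.mem_union, Set.mem_iUnion, Set.mem_ofPred_eq, not_or, not_exists] at hz
    obtain ⟨⟨⟨hzW, hzφ⟩, hzv⟩, hzΨ⟩ := hz
    -- The weight of i is positive exactly when |A(v_i)| < c exp N at z, the situation covered by
    -- `hgood`. Functions that are not small contribute only a constant.
    obtain ⟨B, hB, hBpos, hBsum⟩ := exists_linearIndepOn_sum_le v hδ
      (fun i => max 0 (log c + N z - log ‖A (v i) z‖)) (fun i => le_max_left _ _) (by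
        intro Γ hΓ hpos
        refine hgood z Γ hΓ fun i hi => ?_
        have h1 : 0 < log c + N z - log ‖A (v i) z‖ := by
          simpa using hpos i hi
        rw [← log_lt_log_iff (norm_pos_iff.2 (hzv i)) (by positivity),
          log_mul hc.ne' (exp_pos _).ne', log_exp]
        linarith)
    have h1 := (hΨ B hB).2 z hzφ (hzΨ B) hzW
    have h2 : ∑ i ∈ B, max 0 (log c + N z - log ‖A (v i) z‖) =
        B.card * log c + ∑ i ∈ B, (N z - log ‖A (v i) z‖) := by
      rw [← nsmul_eq_mul, ← Finset.sum_const, ← Finset.sum_add_distrib]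
      refine Finset.sum_congr rfl fun i hi => ?_
      have := hBpos i hi
      rw [max_eq_right ((lt_max_iff.1 this).resolve_left (lt_irrefl _)).le]
      ring
    have h3 : Fintype.card ι * log c + (Fintype.card ι * N z - ∑ i, log ‖A (v i) z‖) ≤
        ∑ i, max 0 (log c + N z - log ‖A (v i) z‖) := by
      have : Fintype.card ι * log c + (Fintype.card ι * N z - ∑ i, log ‖A (v i) z‖) =
          ∑ i, (log c + N z - log ‖A (v i) z‖) := by
        simp only [Finset.sum_sub_distrib, Finset.sum_add_distrib, Finset.sum_const,
          Finset.card_univ, nsmul_eq_mul]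
        ring
      rw [this]
      exact Finset.sum_le_sum fun i _ => le_max_right _ _
    have h4 : (B.card : ℝ) * log c ≤ Fintype.card ι * |log c| :=
      (mul_le_mul_of_nonneg_left (le_abs_self _) (by positivity)).trans
        (mul_le_mul_of_nonneg_right (by exact_mod_cast B.card_le_univ) (abs_nonneg _))
    have h5 : C B ≤ ∑ B, C B := Finset.single_le_sum (fun B _ => hC0 B) (Finset.mem_univ B)
    have h6 : ∑ i : Fin M, ∑ j : Fin M,
        log⁺ ‖quotientNumerator φ (A (Ψ B j)) i z / (φ z ^ (i : ℕ) * A (Ψ B j) z)‖ ≤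
        ∑ s, E s z := by
      rw [Fintype.sum_prod_type]
      refine le_trans (le_of_eq ?_) (Finset.single_le_sum (fun B _ => Finset.sum_nonneg
        fun s _ => hE0 (B, s) z) (Finset.mem_univ B))
      rw [Fintype.sum_prod_type]
    have h7 : -(Fintype.card ι * log c) ≤ Fintype.card ι * |log c| := by
      rw [← mul_neg]
      exact mul_le_mul_of_nonneg_left (neg_le_abs _) (by positivity)
    have h8 := mul_le_mul_of_nonneg_left (show
      ∑ i ∈ B, max 0 (log c + N z - log ‖A (v i) z‖) ≤ Fintype.card ι * |log c| +
        (M * N z - log ‖W z‖ + ∑ B, C B + ∑ s, E s z) by linarith) hδ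
    rw [hK₂]
    linarith
  refine ⟨Ψ, K₂ + |K₁| + δ, by positivity, fun r hr => ?_⟩
  have hr0 : r ≠ 0 := by linarith
  have hNi : CircleIntegrable N 0 r := hNc.continuousOn.circleIntegrable'
  have hvi : ∀ i, CircleIntegrable (fun z => log ‖A (v i) z‖) 0 r := fun i =>
    circleIntegrable_log_norm_entire (hA _) r
  have hvs : CircleIntegrable (fun z => ∑ i, log ‖A (v i) z‖) 0 r := by
    convert CircleIntegrable.sum Finset.univ fun i _ => hvi i using 1
    ext z; simp
  have hEs : CircleIntegrable (fun z => ∑ s, E s z) 0 r := by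
    convert CircleIntegrable.sum Finset.univ fun s _ => hEi s r using 1
    ext z; simp
  have hWi : CircleIntegrable (fun z => log ‖W z‖) 0 r := circleIntegrable_log_norm_entire hW r
  have hi1 : CircleIntegrable (fun z => (δ * M) • N z - δ • log ‖W z‖) 0 r :=
    hNi.const_smul.sub hWi.const_smul
  have hi2 : CircleIntegrable (fun z => (δ * M) • N z - δ • log ‖W z‖ + K₂) 0 r :=
    hi1.add (circleIntegrable_const _ _ _)
  have hmain := circleAverage_mono_off_countable
    (f := fun z => (Fintype.card ι : ℝ) • N z - ∑ i, log ‖A (v i) z‖)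
    (g := fun z => (δ * M) • N z - δ • log ‖W z‖ + K₂ + δ • ∑ s, E s z) hr0
    (hNi.const_smul.sub hvs) (hi2.add hEs.const_smul) hZ fun z hz _ => by
      simpa only [smul_eq_mul] using hpoint z hz
  rw [circleAverage_fun_sub (f₁ := fun z => (Fintype.card ι : ℝ) • N z) hNi.const_smul hvs,
    circleAverage_fun_add (f₂ := fun z => δ • ∑ s, E s z) hi2 hEs.const_smul,
    circleAverage_fun_add hi1 (circleIntegrable_const _ _ _),
    circleAverage_fun_sub (f₁ := fun z => (δ * M) • N z) (f₂ := fun z => δ • log ‖W z‖)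
      hNi.const_smul hWi.const_smul,
    circleAverage_fun_smul, circleAverage_fun_smul, circleAverage_fun_smul, circleAverage_fun_smul,
    circleAverage_const, circleAverage_fun_sum fun i _ => hvi i,
    circleAverage_fun_sum fun s _ => hEi s r] at hmain
  simp only [smul_eq_mul] at hmain
  have h1 := hK₁ r hr
  have hEavg : 0 ≤ ∑ s, circleAverage (E s) 0 r := Finset.sum_nonneg fun s _ =>
    circleAverage_nonneg_of_nonneg fun z _ => hE0 s z
  have h2 : δ * ∑ s, circleAverage (E s) 0 r ≤ (K₂ + |K₁| + δ) * ∑ s, circleAverage (E s) 0 r :=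
    mul_le_mul_of_nonneg_right (by linarith [abs_nonneg K₁]) hEavg
  change _ ≤ _ + (K₂ + |K₁| + δ) * ∑ s, circleAverage (E s) 0 r
  have h3 := neg_abs_le K₁
  linarith

end SecondMainTheorem

/-! ### Evaluation of I_d(V) along a curve, and the distributive constant. -/

section CoordinateRing

open Metric Filter
open MvPolynomial (eval)

variable {n : ℕ}

theorem MvPolynomial.differentiable_eval_comp {σ : Type*} [Fintype σ] {F : ℂ → σ → ℂ}
    (hF : Differentiable ℂ F) (Q : MvPolynomial σ ℂ) : Differentiable ℂ fun z => eval (F z) Q := by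
  have hFi := differentiable_pi.1 hF
  simp only [MvPolynomial.eval_eq]
  exact Differentiable.fun_sum fun m _ => (Differentiable.fun_finsetProd fun i _ =>
    (hFi i).pow _).const_mul _

theorem MvPolynomial.IsHomogeneous.exists_norm_eval_le {σ : Type*} [Fintype σ] {e : ℕ}
    {Q : MvPolynomial σ ℂ} (hQ : Q.IsHomogeneous e) :
    ∃ C : ℝ, 0 < C ∧ ∀ w : σ → ℂ, ‖eval w Q‖ ≤ C * ‖w‖ ^ e := by
  refine ⟨∑ m ∈ Q.support, ‖Q.coeff m‖ + 1, by positivity, fun w => ?_⟩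
  rw [MvPolynomial.eval_eq]
  refine (norm_sum_le _ _).trans ?_
  rw [add_mul, Finset.sum_mul]
  refine le_add_of_le_of_nonneg (Finset.sum_le_sum fun m hm => ?_) (by positivity)
  rw [norm_mul, norm_prod]
  refine mul_le_mul_of_nonneg_left ?_ (norm_nonneg _)
  have hdeg : ∑ i ∈ m.support, m i = e := by
    have := hQ (MvPolynomial.mem_support_iff.mp hm)
    simpa [Finsupp.weight_apply, Finsupp.sum] using this
  rw [← hdeg, ← Finset.prod_pow_eq_pow_sum]
  refine Finset.prod_le_prod (fun i _ => norm_nonneg _) fun i _ => ?_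
  rw [norm_pow]
  exact pow_le_pow_left₀ (norm_nonneg _) (norm_le_pi_norm w i) _

theorem ProjCurve.exists_section (V : Set (PSpace n)) (d : ℕ) :
    ∃ σ : CoordPart V d →ₗ[ℂ] Forms n d,
      ∀ u, (Submodule.Quotient.mk (σ u) : CoordPart V d) = u := by
  obtain ⟨σ, hσ⟩ := (vanishingForms V d).mkQ.exists_rightInverse_of_surjective
    (Submodule.range_mkQ _)
  exact ⟨σ, fun u => LinearMap.congr_fun hσ u⟩

/-- Evaluation of the classes of forms along a curve, by means of chosen representatives. -/
noncomputable def ProjCurve.evalAlong {V : Set (PSpace n)} {d : ℕ}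
    (σ : CoordPart V d →ₗ[ℂ] Forms n d) (F : ℂ → Fin (n + 1) → ℂ) :
    CoordPart V d →ₗ[ℂ] ℂ → ℂ where
  toFun u z := eval (F z) (σ u : Poly n)
  map_add' u v := by ext z; simp
  map_smul' c u := by ext z; simp

theorem ProjCurve.eval_eq_of_mk_eq {V : Set (PSpace n)} {d : ℕ} {Q Q' : Forms n d}
    (h : (Submodule.Quotient.mk Q : CoordPart V d) = Submodule.Quotient.mk Q')
    {w : Fin (n + 1) → ℂ} (hw : w ≠ 0) (hwV : Projectivization.mk ℂ w hw ∈ V) :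
    eval w (Q : Poly n) = eval w (Q' : Poly n) := by
  have h1 : (Q - Q' : Forms n d) ∈ vanishingForms V d := (Submodule.Quotient.eq _).1 h
  have h2 : ((Q - Q' : Forms n d) : Poly n) ∈ vanishingIdeal V := h1
  have h3 := h2 w hw hwV
  rw [Submodule.coe_sub, map_sub, sub_eq_zero] at h3
  exact h3

theorem ProjCurve.evalAlong_mk {V : Set (PSpace n)} {d : ℕ}
    {σ : CoordPart V d →ₗ[ℂ] Forms n d}
    (hσ : ∀ u, (Submodule.Quotient.mk (σ u) : CoordPart V d) = u) {f : ℂ → PSpace n}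
    {F : ℂ → Fin (n + 1) → ℂ} (hF : IsReducedRepresentation F f) (hfV : ∀ z, f z ∈ V)
    (Q : Forms n d) (z : ℂ) :
    evalAlong σ F (Submodule.Quotient.mk Q) z = eval (F z) (Q : Poly n) := by
  obtain ⟨hw, hz⟩ := hF.2 z
  exact eval_eq_of_mk_eq (hσ _) hw (hz ▸ hfV z)

/-- Nondegeneracy over I_d(V) enters the second main theorem in this form: it makes the Wronskian of
a basis nonzero. -/
theorem ProjCurve.evalAlong_injective {V : Set (PSpace n)} {d : ℕ}
    {σ : CoordPart V d →ₗ[ℂ] Forms n d}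
    (hσ : ∀ u, (Submodule.Quotient.mk (σ u) : CoordPart V d) = u) {f : ℂ → PSpace n}
    {F : ℂ → Fin (n + 1) → ℂ} (hF : IsReducedRepresentation F f)
    (hnd : NondegenerateOver V d f) (u : CoordPart V d) (hu : evalAlong σ F u = 0) : u = 0 := by
  by_contra hne
  exact hnd ⟨σ u, by rwa [hσ u], (vanishesAlong_iff hF (σ u)).2 fun z => congrFun hu z⟩

instance ProjCurve.finite_forms (n d : ℕ) : Module.Finite ℂ (Forms n d) :=
  Module.Finite.iff_fg.2 (MvPolynomial.homogeneousSubmodule_fg (Fin (n + 1)) ℂ d)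

theorem ProjCurve.hilbertFunction_ne_zero {V : Set (PSpace n)} (hV : V.Nonempty) (d : ℕ) :
    hilbertFunction V d ≠ 0 := by
  obtain ⟨x, hx⟩ := hV
  obtain ⟨i, hi⟩ : ∃ i, x.rep i ≠ 0 := by
    by_contra! h
    exact x.rep_nonzero (funext h)
  let Q : Forms n d := ⟨MvPolynomial.X i ^ d, by
    simpa using (MvPolynomial.isHomogeneous_X ℂ i).pow d⟩
  have hQ : (Submodule.Quotient.mk Q : CoordPart V d) ≠ 0 := by
    intro h
    have h1 := eval_eq_of_mk_eq (Q' := 0) (by rw [h]; rfl) x.rep_nonzero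
      (by rwa [Projectivization.mk_rep])
    simp [Q, hi] at h1
  have : Nontrivial (CoordPart V d) := ⟨_, _, hQ⟩
  exact Module.finrank_pos.ne'

/-- A compactness argument: forms that are simultaneously small at a point of the cone have a
common zero. -/
theorem ProjCurve.exists_pos_forall_exists_common_zero {V : Set (PSpace n)} (hV : IsAlgebraicSet V)
    {d : ℕ} {ι : Type*} [Finite ι] (Q : ι → Forms n d) :
    ∃ c : ℝ, 0 < c ∧ ∀ (w : Fin (n + 1) → ℂ) (hw : w ≠ 0), Projectivization.mk ℂ w hw ∈ V →
      ∀ Γ : Finset ι, Γ.Nonempty → (∀ i ∈ Γ, ‖eval w (Q i : Poly n)‖ < c * ‖w‖ ^ d) →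
        ∃ x ∈ V, ∀ i ∈ Γ, VanishesAt (Q i : Poly n) x := by
  obtain ⟨S, hS, hVS⟩ := hV
  let K : Set (Fin (n + 1) → ℂ) := sphere 0 1 ∩ ⋂ P ∈ S, {w | eval w P = 0}
  have hK : IsCompact K := by
    refine (isCompact_sphere _ _).inter_right (isClosed_biInter fun P _ => ?_)
    exact isClosed_eq (MvPolynomial.continuous_eval P) continuous_const
  have hKV : ∀ w : Fin (n + 1) → ℂ, ∀ hw : w ≠ 0,
      (∀ P ∈ S, eval w P = 0) ↔ Projectivization.mk ℂ w hw ∈ V := by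
    intro w hw
    rw [hVS]
    refine forall₂_congr fun P hP => ?_
    obtain ⟨e, he⟩ := hS P hP
    exact (vanishesAt_mk he w hw).symm
  have hone : ∀ Γ : Finset ι, ∃ c : ℝ, 0 < c ∧ (Γ.Nonempty →
      ∀ w ∈ K, (∀ i ∈ Γ, ‖eval w (Q i : Poly n)‖ < c) →
        ∃ x ∈ V, ∀ i ∈ Γ, VanishesAt (Q i : Poly n) x) := by
    intro Γ
    by_cases hx : ∃ x ∈ V, ∀ i ∈ Γ, VanishesAt (Q i : Poly n) x
    -- If the forms of Γ have a common zero, any constant will do. Otherwise the sum of their norms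
    -- has a positive minimum on the compact set of unit vectors of the cone.
    · exact ⟨1, one_pos, fun _ _ _ _ => hx⟩
    rcases K.eq_empty_or_nonempty with hKe | hKne
    · exact ⟨1, one_pos, fun _ w hw => by simp [hKe] at hw⟩
    let h : (Fin (n + 1) → ℂ) → ℝ := fun w => ∑ i ∈ Γ, ‖eval w (Q i : Poly n)‖
    have hc : Continuous h := continuous_finsetSum _ fun i _ =>
      (MvPolynomial.continuous_eval _).norm
    obtain ⟨w₀, hw₀, hmin⟩ := hK.exists_isMinOn hKne hc.continuousOn
    have hpos : 0 < h w₀ := by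
      refine lt_of_le_of_ne (Finset.sum_nonneg fun i _ => norm_nonneg _) fun h0 => hx ?_
      have hne : w₀ ≠ 0 := by
        rintro rfl
        simpa using hw₀.1
      refine ⟨_, (hKV w₀ hne).1 (by simpa using hw₀.2), fun i hi => ?_⟩
      have := (Finset.sum_eq_zero_iff_of_nonneg fun i _ => norm_nonneg _).1 h0.symm i hi
      rw [vanishesAt_mk (Q i).2]
      exact norm_eq_zero.1 this
    refine ⟨h w₀ / (Γ.card + 1), by positivity, fun hΓ w hw hlt => ?_⟩
    have h1 : h w < h w₀ := by
      have h2 := Finset.sum_lt_sum_of_nonempty hΓ hlt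
      refine h2.trans_le ?_
      rw [Finset.sum_const, nsmul_eq_mul, ← mul_div_assoc, div_le_iff₀ (by positivity)]
      nlinarith
    exact absurd (hmin hw) (not_le.2 h1)
  choose c hc0 hc using hone
  have hev : ∀ᶠ t in 𝓝[>] (0 : ℝ), ∀ Γ : Finset ι, t ≤ c Γ := by
    cases nonempty_fintype ι
    rw [eventually_all]
    exact fun Γ => nhdsWithin_le_nhds (eventually_le_nhds (hc0 Γ))
  obtain ⟨t, ht, ht0⟩ := (hev.and self_mem_nhdsWithin).exists
  refine ⟨t, ht0, fun w hw hwV Γ hΓ hlt => ?_⟩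
  have hnw : 0 < ‖w‖ := norm_pos_iff.2 hw
  let a : ℂ := ((‖w‖⁻¹ : ℝ) : ℂ)
  have ha : ‖a‖ = ‖w‖⁻¹ := by simp [a]
  refine hc Γ hΓ (a • w) ⟨?_, ?_⟩ fun i hi => ?_
  · rw [mem_sphere_zero_iff_norm, norm_smul, ha, inv_mul_cancel₀ hnw.ne']
  · refine Set.mem_iInter₂.2 fun P hP => ?_
    obtain ⟨e, he⟩ := hS P hP
    rw [Set.mem_ofPred_eq, he.eval_smul, (hKV w hw).2 hwV P hP, mul_zero]
  · have h1 : (Q i : Poly n).IsHomogeneous d := (Q i).2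
    rw [h1.eval_smul, norm_mul, norm_pow, ha, inv_pow, inv_mul_lt_iff₀ (by positivity), mul_comm]
    exact (hlt i hi).trans_le (mul_le_mul_of_nonneg_right (ht Γ) (by positivity))

/-- The distributive constant controls the number of hypersurfaces through a point by the rank of
their classes. -/
theorem ProjCurve.card_le_distributiveConstant_mul {q k d : ℕ} {V : Set (PSpace n)}
    (hV : IsProjectiveVariety V) (hk : dim V = (k : WithBot ℕ∞)) (D : Fin q → Hypersurface n)
    (hΔ : distributiveConstant V D ≠ ⊤) (hd : 0 < d) {Q : Fin q → Forms n d}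
    (hQ : ∀ i x, VanishesAt (Q i : Poly n) x ↔ x ∈ (D i).locus) {Γ : Finset (Fin q)}
    (hΓ : Γ.Nonempty) {x : PSpace n} (hxV : x ∈ V) (hx : ∀ i ∈ Γ, x ∈ (D i).locus) :
    (Γ.card : ℝ) ≤ (distributiveConstant V D).toReal * k ∧
      ∀ B ⊆ Γ, (fun i => (Submodule.Quotient.mk (Q i) : CoordPart V d)) '' Γ ⊆
        Submodule.span ℂ ((fun i => (Submodule.Quotient.mk (Q i) : CoordPart V d)) '' B) →
        (Γ.card : ℝ) ≤ (distributiveConstant V D).toReal * B.card := by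
  classical
  set W := (⋂ j ∈ Γ, (D j).locus) ∩ V with hW
  have hWx : x ∈ W := ⟨Set.mem_iInter₂.2 hx, hxV⟩
  have hcodim : ∀ B ⊆ Γ, (fun i => (Submodule.Quotient.mk (Q i) : CoordPart V d)) '' Γ ⊆
        Submodule.span ℂ ((fun i => (Submodule.Quotient.mk (Q i) : CoordPart V d)) '' B) →
        codimIn V W ≤ B.card := by
    intro B hB hspan
    refine (codimIn_le_card hV hk (B.image fun i => (Q i : Poly n)) (fun P hP => ?_) ⟨x, hWx⟩
      fun y => ?_).trans (by exact_mod_cast Finset.card_image_le)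
    · obtain ⟨i, -, rfl⟩ := Finset.mem_image.1 hP
      exact ⟨d, hd, (Q i).2⟩
    · simp only [hW, Set.mem_inter_iff, Set.mem_iInter, Finset.mem_image, forall_exists_index,
        and_imp, forall_apply_eq_imp_iff₂, hQ]
      refine ⟨fun h => ⟨h.2, fun i hi => h.1 i (hB hi)⟩, fun h => ⟨fun i hi => ?_, h.1⟩⟩
      have hyV : Projectivization.mk ℂ y.rep y.rep_nonzero ∈ V := by
        rw [Projectivization.mk_rep]
        exact h.1
      -- Evaluation at a point of V descends to I_d(V). Vanishing on the classes of B, it vanishes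
      -- on their span, so the forms of B alone cut out W.
      let ℓ : CoordPart V d →ₗ[ℂ] ℂ := (vanishingForms V d).liftQ
        ((MvPolynomial.aeval y.rep).toLinearMap ∘ₗ (Forms n d).subtype) (fun P hP => by
          have h1 : (P : Poly n) ∈ vanishingIdeal V := hP
          exact h1 y.rep y.rep_nonzero hyV)
      have hℓ : ∀ j, ℓ (Submodule.Quotient.mk (Q j)) = eval y.rep (Q j : Poly n) := fun j => rfl
      have hker : Submodule.span ℂ ((fun i => (Submodule.Quotient.mk (Q i) : CoordPart V d)) '' B) ≤
          LinearMap.ker ℓ := by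
        rw [Submodule.span_le]
        rintro _ ⟨j, hj, rfl⟩
        exact (hQ j y).2 (h.2 j hj)
      exact (hQ i y).1 (hker (hspan (Set.mem_image_of_mem _ hi)))
  have hΓle : (Γ.card : ℝ≥0∞) / (codimIn V W : ℝ≥0∞) ≤ distributiveConstant V D :=
    le_iSup (fun Γ : {Γ : Finset (Fin q) // Γ.Nonempty} =>
      (Γ.1.card : ℝ≥0∞) / (codimIn V ((⋂ j ∈ Γ.1, (D j).locus) ∩ V) : ℝ≥0∞)) ⟨Γ, hΓ⟩
  have hck : codimIn V W ≤ k := by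
    rw [codimIn, if_neg (Set.Nonempty.ne_empty ⟨x, hWx⟩), hk]
    exact tsub_le_self
  obtain ⟨c, hc⟩ := ENat.ne_top_iff_exists.1 (ne_top_of_le_ne_top (ENat.natCast_ne_top k) hck)
  rw [← hc] at hΓle hck hcodim
  -- Codimension 0 would make the quotient for Γ, and hence the distributive constant, infinite.
  have hc0 : c ≠ 0 := by
    rintro rfl
    apply hΔ
    rw [eq_top_iff]
    refine le_trans (le_of_eq ?_) hΓle
    simp [ENNReal.div_zero, hΓ.ne_empty]
  have hmul : (Γ.card : ℝ) ≤ (distributiveConstant V D).toReal * c := by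
    have h1 : (Γ.card : ℝ≥0∞) ≤ distributiveConstant V D * c := by
      rw [← ENNReal.div_le_iff (by simpa using hc0) (by simp)]
      simpa using hΓle
    have h2 := ENNReal.toReal_mono (ENNReal.mul_ne_top hΔ (by simp)) h1
    simpa using h2
  have hle : ∀ m : ℕ, (c : ℕ∞) ≤ m → (Γ.card : ℝ) ≤ (distributiveConstant V D).toReal * m :=
    fun m hm => hmul.trans (mul_le_mul_of_nonneg_left (by exact_mod_cast hm) ENNReal.toReal_nonneg)
  exact ⟨hle k hck, fun B hB hspan => hle _ (hcodim B hB hspan)⟩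

end CoordinateRing

/-! ### The characteristic function of a curve. -/

section Characteristic

open Real Metric Filter

theorem circleAverage_log_norm_le {h : ℂ → ℂ} (hh : Differentiable ℂ h) (h0 : h ≠ 0) {N : ℂ → ℝ}
    (hNc : Continuous N) {C : ℝ} (hC : ∀ z, h z ≠ 0 → log ‖h z‖ ≤ C + N z) {r : ℝ} (hr : r ≠ 0) :
    circleAverage (fun z => log ‖h z‖) 0 r ≤ C + circleAverage N 0 r := by
  have hN : CircleIntegrable N 0 r := hNc.continuousOn.circleIntegrable'
  calc _ ≤ circleAverage (fun z => C + N z) 0 r :=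
        circleAverage_mono_off_countable hr (circleIntegrable_log_norm_entire hh r)
          ((circleIntegrable_const _ _ _).add hN) (countable_zeros hh h0) fun z hz _ => hC z hz
    _ = _ := by
        rw [circleAverage_fun_add (circleIntegrable_const _ _ _) hN, circleAverage_const]

/-- Off the zeros, log⁺ |ψ/φ| = max (log |ψ|, log |φ|) - log |φ|. The maximum is at most C + N, and
the mean of log |φ| is bounded below by Jensen's formula. -/
theorem exists_circleAverage_posLog_div_le {ψ φ : ℂ → ℂ} (hψ : Differentiable ℂ ψ) (hψ0 : ψ ≠ 0)
    (hφ : Differentiable ℂ φ) (hφ0 : φ ≠ 0) {N : ℂ → ℝ} (hNc : Continuous N) {C : ℝ}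
    (hCψ : ∀ z, ψ z ≠ 0 → log ‖ψ z‖ ≤ C + N z) (hCφ : ∀ z, φ z ≠ 0 → log ‖φ z‖ ≤ C + N z) :
    ∃ C' : ℝ, ∀ r, 1 ≤ r →
      circleAverage (fun z => log⁺ ‖ψ z / φ z‖) 0 r ≤ circleAverage N 0 r + C' := by
  obtain ⟨L, hL⟩ := exists_le_circleAverage_log_norm hφ hφ0
  refine ⟨C - L, fun r hr => ?_⟩
  have hN : CircleIntegrable N 0 r := hNc.continuousOn.circleIntegrable'
  have hCN : CircleIntegrable (fun z => C + N z) 0 r := (circleIntegrable_const _ _ _).add hN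
  have hl := circleIntegrable_log_norm_entire hφ r
  have h1 : circleAverage (fun z => log⁺ ‖ψ z / φ z‖) 0 r ≤
      circleAverage (fun z => (C + N z) - log ‖φ z‖) 0 r := by
    refine circleAverage_mono_off_countable (by positivity)
      (circleIntegrable_posLog_norm_div hψ hφ r) (hCN.sub hl)
      ((countable_zeros hψ hψ0).union (countable_zeros hφ hφ0)) fun z hz _ => ?_
    simp only [Set.mem_union, Set.mem_ofPred_eq, not_or] at hz
    change max 0 (log ‖ψ z / φ z‖) ≤ _
    rw [norm_div, log_div (norm_ne_zero_iff.2 hz.1) (norm_ne_zero_iff.2 hz.2)]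
    exact max_le (sub_nonneg.2 (hCφ z hz.2)) (sub_le_sub_right (hCψ z hz.1) _)
  rw [circleAverage_fun_sub hCN hl, circleAverage_fun_add (circleIntegrable_const _ _ _) hN,
    circleAverage_const] at h1
  linarith [hL r hr]

variable {n : ℕ}

theorem continuous_log_norm {F : ℂ → Fin (n + 1) → ℂ} (hF : Differentiable ℂ F)
    (hF0 : ∀ z, F z ≠ 0) : Continuous fun z => log ‖F z‖ :=
  hF.continuous.norm.log fun z => norm_ne_zero_iff.2 (hF0 z)

theorem exists_le_circleAverage_log_norm_curve {F : ℂ → Fin (n + 1) → ℂ}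
    (hF : Differentiable ℂ F) (hF0 : ∀ z, F z ≠ 0) :
    ∃ C : ℝ, ∀ r, 1 ≤ r → C ≤ circleAverage (fun z => log ‖F z‖) 0 r := by
  obtain ⟨i, hi⟩ := Function.ne_iff.1 (hF0 0)
  have hFi := differentiable_pi.1 hF i
  have hi0 : (fun z => F z i) ≠ 0 := fun h => hi (congrFun h 0)
  obtain ⟨C, hC⟩ := exists_le_circleAverage_log_norm hFi hi0
  refine ⟨C, fun r hr => (hC r hr).trans ?_⟩
  have := circleAverage_log_norm_le hFi hi0 (continuous_log_norm hF hF0) (C := 0)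
    (fun z hz => by
      rw [zero_add]
      exact log_le_log (norm_pos_iff.2 hz) (norm_le_pi_norm _ i)) (r := r) (by positivity)
  rwa [zero_add] at this

theorem bddAbove_circleAverage {N : ℂ → ℝ} (hN : Continuous N) (R : ℝ) :
    BddAbove ((fun r => circleAverage N 0 r) '' Set.Icc 1 R) := by
  obtain ⟨B, hB⟩ := (isCompact_closedBall (0 : ℂ) R).bddAbove_image hN.continuousOn
  refine ⟨B, ?_⟩
  rintro _ ⟨r, hr, rfl⟩
  refine circleAverage_mono_on_of_le_circle hN.continuousOn.circleIntegrable' fun z hz => ?_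
  refine hB (Set.mem_image_of_mem _ ?_)
  rw [abs_of_nonneg (by linarith [hr.1])] at hz
  exact sphere_subset_closedBall.trans (closedBall_subset_closedBall hr.2) hz

/-- The characteristic function of a nonconstant curve is unbounded. -/
theorem exists_le_circleAverage_log_norm_of_nonconstant {F : ℂ → Fin (n + 1) → ℂ}
    (hF : Differentiable ℂ F) (hF0 : ∀ z, F z ≠ 0) {z₁ z₂ : ℂ} {i j : Fin (n + 1)}
    (h12 : F z₁ i * F z₂ j - F z₁ j * F z₂ i ≠ 0) (B : ℝ) :
    ∃ r, 1 ≤ r ∧ B ≤ circleAverage (fun z => log ‖F z‖) 0 r := by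
  have hFi := differentiable_pi.1 hF
  -- This combination vanishes at z₁ but not at z₂; a single zero already forces its mean to grow
  -- like log r.
  let h : ℂ → ℂ := fun z => F z₁ i * F z j - F z₁ j * F z i
  have hh : Differentiable ℂ h := ((hFi j).const_mul _).sub ((hFi i).const_mul _)
  have h0 : h ≠ 0 := fun e => h12 (congrFun e z₂)
  have hz₁ : h z₁ = 0 := by simp only [h]; ring
  have hpos : 0 < ‖F z₁‖ := norm_pos_iff.2 (hF0 z₁)
  have hlog : ∀ z, h z ≠ 0 → log ‖h z‖ ≤ log (2 * ‖F z₁‖) + log ‖F z‖ := by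
    intro z hz
    rw [← log_mul (by positivity) (norm_ne_zero_iff.2 (hF0 z))]
    refine log_le_log (norm_pos_iff.2 hz) ((norm_sub_le _ _).trans ?_)
    rw [norm_mul, norm_mul, two_mul, add_mul]
    gcongr <;> exact norm_le_pi_norm _ _
  set L := log ‖meromorphicTrailingCoeffAt h 0‖
  -- On the circle of radius R exp X, the zero z₁ contributes at least X to Jensen's formula, which
  -- exceeds B after the constants are removed.
  set X := |B + log (2 * ‖F z₁‖) - L|
  set R := max 1 ‖z₁‖
  have hR : 1 ≤ R := le_max_left _ _
  have hX : 0 ≤ X := abs_nonneg _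
  have hRρ : R ≤ R * exp X := le_mul_of_one_le_right (by positivity) (one_le_exp hX)
  refine ⟨R * exp X, hR.trans hRρ, ?_⟩
  have h1 := sum_order_mul_log_le_of_subset hh h0 hR hRρ {z₁} (by simp [R])
  rw [Finset.sum_singleton, mul_div_cancel_left₀ _ (by positivity), log_exp] at h1
  have h2 : (1 : ℝ) ≤ analyticOrderNatAt h z₁ := by
    have := (analyticOrderNatAt_eq_zero_iff hh h0 z₁).not_left.2 hz₁
    exact_mod_cast Nat.one_le_iff_ne_zero.2 this
  have h3 := circleAverage_log_norm_le hh h0 (continuous_log_norm hF hF0) hlog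
    (r := R * exp X) (by positivity)
  have h4 : X ≤ analyticOrderNatAt h z₁ * X := le_mul_of_one_le_left hX h2
  have h5 : B + log (2 * ‖F z₁‖) - L ≤ X := le_abs_self _
  linarith

end Characteristic

/-! ### Equality of points through minors, and nonconstancy. -/

section Points

variable {n : ℕ}

theorem Projectivization.mk_eq_mk_iff_forall {v w : Fin (n + 1) → ℂ} (hv : v ≠ 0) (hw : w ≠ 0) :
    Projectivization.mk ℂ v hv = Projectivization.mk ℂ w hw ↔
      ∀ i j, v i * w j - v j * w i = 0 := by
  rw [Projectivization.mk_eq_mk_iff']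
  refine ⟨?_, fun h => ?_⟩
  · rintro ⟨a, rfl⟩ i j
    simp only [Pi.smul_apply, smul_eq_mul]
    ring
  · obtain ⟨i, hi⟩ := Function.ne_iff.1 hw
    rw [Pi.zero_apply] at hi
    refine ⟨v i / w i, funext fun j => ?_⟩
    simp only [Pi.smul_apply, smul_eq_mul]
    field_simp
    linear_combination h i j

/-- A nondegenerate curve is not constant, unless it maps to a single point. -/
theorem ProjCurve.NondegenerateOver.exists_ne {V : Set (PSpace n)} {d : ℕ} (hd : 0 < d)
    {f : ℂ → PSpace n} (hnd : NondegenerateOver V d f) {y : PSpace n} (hy : y ∈ V) (z₁ : ℂ)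
    (hne : f z₁ ≠ y) : ∃ z₂, f z₁ ≠ f z₂ := by
  by_contra! hconst
  set v := (f z₁).rep
  have hv : v ≠ 0 := (f z₁).rep_nonzero
  have hvw := (Projectivization.mk_eq_mk_iff_forall hv y.rep_nonzero).not.1 (by
    rwa [Projectivization.mk_rep, Projectivization.mk_rep])
  push Not at hvw
  obtain ⟨i, j, hij⟩ := hvw
  -- A linear form vanishing at the supposed constant value but not at y. Its d-th power is nonzero
  -- in I_d(V) and vanishes along f.
  let ℓ : Poly n :=
    MvPolynomial.C (v i) * MvPolynomial.X j - MvPolynomial.C (v j) * MvPolynomial.X i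
  have hℓ : ℓ.IsHomogeneous 1 :=
    ((MvPolynomial.isHomogeneous_C_mul_X _ _).sub (MvPolynomial.isHomogeneous_C_mul_X _ _))
  let Q : Forms n d := ⟨ℓ ^ d, by simpa using hℓ.pow d⟩
  have hev : ∀ w : Fin (n + 1) → ℂ, MvPolynomial.eval w (Q : Poly n) =
      (v i * w j - v j * w i) ^ d := by
    intro w
    simp [Q, ℓ]
  refine hnd ⟨Q, fun h => ?_, fun z => ?_⟩
  · have h1 := eval_eq_of_mk_eq (Q' := 0) (by rw [h]; rfl) y.rep_nonzero
      (by rwa [Projectivization.mk_rep])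
    rw [hev] at h1
    exact hij (eq_zero_of_pow_eq_zero (n := d) (by simpa using h1))
  · rw [VanishesAt, ← hconst z, hev]
    rw [show v i * (f z₁).rep j - v j * (f z₁).rep i = 0 by simp only [v]; ring,
      zero_pow hd.ne']

end Points

/-! ### The second main theorem for curves and the comparison of two curves. -/

section Uniqueness

open Real Metric Filter
open MvPolynomial (eval)

variable {n : ℕ}

theorem ProjCurve.Hypersurface.exists_form (D : Hypersurface n) {d : ℕ} (hd : 0 < d)
    (hdvd : D.degree ∣ d) :
    ∃ Q : Forms n d, ∀ x, VanishesAt (Q : Poly n) x ↔ x ∈ D.locus := by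
  obtain ⟨m, rfl⟩ := hdvd
  refine ⟨⟨D.poly ^ m, D.isHomogeneous.pow m⟩, fun x => ?_⟩
  have hm : m ≠ 0 := (Nat.pos_of_mul_pos_left hd).ne'
  simp [VanishesAt, Hypersurface.locus, hm]

/-- The second main theorem for one nondegenerate curve, with the logarithmic derivatives kept as
an error term. -/
theorem ProjCurve.NondegenerateOver.exists_circleAverage_le {q k d : ℕ} {V : Set (PSpace n)}
    (hV : IsProjectiveVariety V) (hk : dim V = (k : WithBot ℕ∞)) (D : Fin q → Hypersurface n)
    (hΔ : distributiveConstant V D ≠ ⊤) (hd : 0 < d) (hdvd : ∀ i, (D i).degree ∣ d)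
    {f : ℂ → PSpace n} {F : ℂ → Fin (n + 1) → ℂ} (hF : IsReducedRepresentation F f)
    (hfV : ∀ z, f z ∈ V) (hnd : NondegenerateOver V d f)
    {P : ℂ → ℂ} (hP : Differentiable ℂ P) (hP0 : P ≠ 0) {κ : ℝ}
    (hκ : ∀ a, ({i | f a ∈ (D i).locus}.ncard : ℝ) ≤ κ * analyticOrderNatAt P a) :
    ∃ (φ : ℂ → ℂ) (ψ : Finset (Fin q) × Fin (hilbertFunction V d) × Fin (hilbertFunction V d) →
        ℂ → ℂ) (C K : ℝ), Differentiable ℂ φ ∧ φ ≠ 0 ∧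
      (∀ s, Differentiable ℂ (ψ s)) ∧ (∀ s, ψ s ≠ 0) ∧ 0 ≤ K ∧
      (∀ s r, 1 ≤ r → circleAverage (fun z => log⁺ ‖ψ s z / φ z‖) 0 r ≤
        d * circleAverage (fun z => log ‖F z‖) 0 r + C) ∧
      (∀ r, 1 ≤ r → circleAverage (fun z => log ‖φ z‖) 0 r ≤
        d * circleAverage (fun z => log ‖F z‖) 0 r + C) ∧
      ∀ r, 1 ≤ r → (q - (distributiveConstant V D).toReal * hilbertFunction V d) *
          (d * circleAverage (fun z => log ‖F z‖) 0 r) ≤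
        (hilbertFunction V d - 1) * κ * circleAverage (fun z => log ‖P z‖) 0 r + K +
          K * ∑ s, circleAverage (fun z => log⁺
            ‖quotientNumerator φ (ψ s) s.2.1 z / (φ z ^ (s.2.1 : ℕ) * ψ s z)‖) 0 r := by
  classical
  have hF0 : ∀ z, F z ≠ 0 := fun z => (hF.2 z).1
  choose Q hQ using fun i => (D i).exists_form hd (hdvd i)
  obtain ⟨σ, hσ⟩ := exists_section V d
  set A := evalAlong σ F with hAdef
  have hA : ∀ u, Differentiable ℂ (A u) := fun u =>
    MvPolynomial.differentiable_eval_comp hF.1 (σ u : Poly n)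
  have hinj : ∀ u, A u = 0 → u = 0 := evalAlong_injective hσ hF hnd
  set N : ℂ → ℝ := fun z => d * log ‖F z‖ with hN
  have hNc : Continuous N := continuous_const.mul (continuous_log_norm hF.1 hF0)
  have hNexp : ∀ z, exp (N z) = ‖F z‖ ^ d := by
    intro z
    simp only [hN]
    rw [mul_comm, exp_mul, exp_log (norm_pos_iff.2 (hF0 z)), rpow_natCast]
  have hNavg : ∀ r, circleAverage N 0 r = d * circleAverage (fun z => log ‖F z‖) 0 r := by
    intro r
    have := circleAverage_fun_smul (a := (d : ℝ)) (f := fun z => log ‖F z‖) (c := 0) (R := r)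
    simpa [smul_eq_mul] using this
  have hNu : ∀ u, ∃ C : ℝ, ∀ z, A u z ≠ 0 → log ‖A u z‖ ≤ C + N z := by
    intro u
    have hu : (σ u : Poly n).IsHomogeneous d := (σ u).2
    obtain ⟨C, hC0, hC⟩ := hu.exists_norm_eval_le
    refine ⟨log C, fun z hz => ?_⟩
    rw [log_le_iff_le_exp (norm_pos_iff.2 hz), exp_add, exp_log hC0, hNexp]
    exact hC (F z)
  have hM0 := hilbertFunction_ne_zero hV.nonempty d
  have : Nontrivial (CoordPart V d) := Module.nontrivial_of_finrank_pos (R := ℂ)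
    (Nat.pos_of_ne_zero hM0)
  -- Any nonzero class supplies the common denominator of the quotients whose logarithmic
  -- derivatives are estimated.
  obtain ⟨u₀, hu₀⟩ := _root_.exists_ne (0 : CoordPart V d)
  have hφ0 : A u₀ ≠ 0 := fun h => hu₀ (hinj _ h)
  obtain ⟨c, hc, hcQ⟩ := exists_pos_forall_exists_common_zero hV.isAlgebraicSet Q
  have hAv : ∀ i z, A (Submodule.Quotient.mk (Q i)) z = eval (F z) (Q i : Poly n) :=
    fun i z => evalAlong_mk hσ hF hfV (Q i) z
  have hzero : ∀ i z, A (Submodule.Quotient.mk (Q i)) z = 0 ↔ f z ∈ (D i).locus := by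
    intro i z
    obtain ⟨hw, hz⟩ := hF.2 z
    rw [hAv, ← hQ, hz, vanishesAt_mk (Q i).2 _ hw]
  obtain ⟨Ψ, K, hK, hmain⟩ := exists_circleAverage_le_add_logDeriv hA hinj
    (M := hilbertFunction V d) rfl hM0 hNc hNu (hA u₀) hφ0
    (fun i => (Submodule.Quotient.mk (Q i) : CoordPart V d))
    (δ := (distributiveConstant V D).toReal) ENNReal.toReal_nonneg hc
    -- Forms that are small together at F(z) have a common zero x on V; x need not be f(z). The
    -- distributive constant is applied at x.
    (fun z Γ hΓ hlt => by
      obtain ⟨hw, hz⟩ := hF.2 z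
      obtain ⟨x, hxV, hx⟩ := hcQ (F z) hw (hz ▸ hfV z) Γ hΓ fun i hi => by
        rw [← hAv, ← hNexp]
        exact hlt i hi
      exact (card_le_distributiveConstant_mul hV hk D hΔ hd hQ hΓ hxV
        fun i hi => (hQ i x).1 (hx i hi)).2)
    hP hP0 (κ := κ) (fun a => by
      refine le_trans (le_of_eq ?_) (hκ a)
      rw [Set.ncard_eq_toFinset_card']
      simp [hzero])
  have hψ0 : ∀ s : Finset (Fin q) × Fin (hilbertFunction V d) × Fin (hilbertFunction V d),
    A (Ψ s.1 s.2.2) ≠ 0 := fun s h => (Ψ s.1).ne_zero _ (hinj _ h)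
  choose C hC using hNu
  have hdiv : ∀ s : Finset (Fin q) × Fin (hilbertFunction V d) × Fin (hilbertFunction V d),
      ∃ C' : ℝ, ∀ r, 1 ≤ r → circleAverage (fun z => log⁺ ‖A (Ψ s.1 s.2.2) z / A u₀ z‖) 0 r ≤
        circleAverage N 0 r + C' := fun s =>
    exists_circleAverage_posLog_div_le (hA _) (hψ0 s) (hA u₀) hφ0 hNc
      (C := max (C (Ψ s.1 s.2.2)) (C u₀))
      (fun z hz => (hC _ z hz).trans (by gcongr; exact le_max_left _ _))
      (fun z hz => (hC _ z hz).trans (by gcongr; exact le_max_right _ _))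
  choose C' hC' using hdiv
  refine ⟨A u₀, fun s => A (Ψ s.1 s.2.2), |C u₀| + ∑ s, |C' s|, K, hA _, hφ0, fun s => hA _, hψ0, hK,
    fun s r hr => ?_, fun r hr => ?_, fun r hr => ?_⟩
  · rw [← hNavg]
    refine (hC' s r hr).trans ?_
    gcongr
    exact (le_abs_self _).trans ((Finset.single_le_sum (f := fun s => |C' s|)
      (fun _ _ => abs_nonneg _) (Finset.mem_univ s)).trans (le_add_of_nonneg_left (abs_nonneg _)))
  · rw [← hNavg]
    refine (circleAverage_log_norm_le (hA u₀) hφ0 hNc (hC u₀) (by positivity)).trans ?_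
    rw [add_comm]
    gcongr
    exact (le_abs_self _).trans
      (le_add_of_nonneg_right (Finset.sum_nonneg fun _ _ => abs_nonneg _))
  · rw [← hNavg]
    simpa using hmain r hr

/-- Two nondegenerate curves that agree on the preimages of sufficiently many hypersurfaces
coincide. -/
theorem ProjCurve.NondegenerateOver.eq_of_two_mul_lt {q k d : ℕ} {V : Set (PSpace n)}
    (hV : IsProjectiveVariety V) (hk : dim V = (k : WithBot ℕ∞)) (D : Fin q → Hypersurface n)
    (hΔ : distributiveConstant V D ≠ ⊤) (hd : 0 < d) (hdvd : ∀ i, (D i).degree ∣ d)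
    {f g : ℂ → PSpace n} (hf : IsHolomorphicMap f) (hg : IsHolomorphicMap g)
    (hfV : ∀ z, f z ∈ V) (hgV : ∀ z, g z ∈ V)
    (hf_nd : NondegenerateOver V d f) (hg_nd : NondegenerateOver V d g)
    (hfg : Set.EqOn f g (⋃ i, (f ⁻¹' (D i).locus ∪ g ⁻¹' (D i).locus)))
    {κ : ℝ} (hκ0 : 0 ≤ κ) (hκ : ∀ a, f a = g a → ({i | f a ∈ (D i).locus}.ncard : ℝ) ≤ κ)
    (hq : 2 * (hilbertFunction V d - 1) * κ <
      (q - (distributiveConstant V D).toReal * hilbertFunction V d) * d) : f = g := by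
  by_contra hne
  obtain ⟨z₀, hz₀⟩ := Function.ne_iff.1 hne
  obtain ⟨F, hF⟩ := hf.exists_isReducedRepresentation
  obtain ⟨G, hG⟩ := hg.exists_isReducedRepresentation
  have hF0 : ∀ z, F z ≠ 0 := fun z => (hF.2 z).1
  have hG0 : ∀ z, G z ≠ 0 := fun z => (hG.2 z).1
  have hFi := differentiable_pi.1 hF.1
  have hGi := differentiable_pi.1 hG.1
  have hFf : ∀ z, f z = Projectivization.mk ℂ (F z) (hF0 z) := fun z => (hF.2 z).2
  have hGg : ∀ z, g z = Projectivization.mk ℂ (G z) (hG0 z) := fun z => (hG.2 z).2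
  have hij := hz₀
  rw [hFf, hGg, Ne, Projectivization.mk_eq_mk_iff_forall] at hij
  push Not at hij
  obtain ⟨i, j, hij⟩ := hij
  -- A minor that is nonzero at z₀. It vanishes at every coincidence point of f and g, so each of
  -- these is counted at least once by its divisor.
  set P : ℂ → ℂ := fun z => F z i * G z j - F z j * G z i with hPdef
  have hP : Differentiable ℂ P := ((hFi i).mul (hGi j)).sub ((hFi j).mul (hGi i))
  have hP0 : P ≠ 0 := fun h => hij (congrFun h z₀)
  have hPfg : ∀ a, f a = g a → κ ≤ κ * analyticOrderNatAt P a := by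
    intro a ha
    have h1 : P a = 0 := by
      rw [hFf, hGg, Projectivization.mk_eq_mk_iff_forall] at ha
      exact ha i j
    refine le_mul_of_one_le_right hκ0 ?_
    exact_mod_cast Nat.one_le_iff_ne_zero.2
      ((analyticOrderNatAt_eq_zero_iff hP hP0 a).not_left.2 h1)
  have hκf : ∀ a, ({i | f a ∈ (D i).locus}.ncard : ℝ) ≤ κ * analyticOrderNatAt P a := by
    intro a
    by_cases ha : f a = g a
    · exact (hκ a ha).trans (hPfg a ha)
    · have : {i | f a ∈ (D i).locus} = ∅ := Set.eq_empty_of_forall_notMem fun i hi =>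
        ha (hfg (Set.mem_iUnion.2 ⟨i, Or.inl hi⟩))
      rw [this, Set.ncard_empty]
      push_cast
      positivity
  have hκg : ∀ a, ({i | g a ∈ (D i).locus}.ncard : ℝ) ≤ κ * analyticOrderNatAt P a := by
    intro a
    by_cases ha : f a = g a
    · rw [← ha]
      exact hκf a
    · have : {i | g a ∈ (D i).locus} = ∅ := Set.eq_empty_of_forall_notMem fun i hi =>
        ha (hfg (Set.mem_iUnion.2 ⟨i, Or.inr hi⟩))
      rw [this, Set.ncard_empty]
      push_cast
      positivity
  obtain ⟨φ₁, ψ₁, C₁, K₁, hφ₁, hφ₁0, hψ₁, hψ₁0, hK₁, hψT₁, hφT₁, hm₁⟩ :=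
    hf_nd.exists_circleAverage_le hV hk D hΔ hd hdvd hF hfV hP hP0 hκf
  obtain ⟨φ₂, ψ₂, C₂, K₂, hφ₂, hφ₂0, hψ₂, hψ₂0, hK₂, hψT₂, hφT₂, hm₂⟩ :=
    hg_nd.exists_circleAverage_le hV hk D hΔ hd hdvd hG hgV hP hP0 hκg
  obtain ⟨L₁, hL₁⟩ := exists_le_circleAverage_log_norm_curve hF.1 hF0
  obtain ⟨L₂, hL₂⟩ := exists_le_circleAverage_log_norm_curve hG.1 hG0
  have hFc := continuous_log_norm hF.1 hF0
  have hGc := continuous_log_norm hG.1 hG0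
  set T₁ : ℝ → ℝ := fun r => circleAverage (fun z => log ‖F z‖) 0 r with hT₁
  set T₂ : ℝ → ℝ := fun r => circleAverage (fun z => log ‖G z‖) 0 r with hT₂
  have hFGc : Continuous fun z => log ‖F z‖ + log ‖G z‖ := hFc.add hGc
  have hT₁₂ : ∀ r, circleAverage (fun z => log ‖F z‖ + log ‖G z‖) 0 r = T₁ r + T₂ r := fun r =>
    circleAverage_fun_add hFc.continuousOn.circleIntegrable' hGc.continuousOn.circleIntegrable'
  -- The sum of the two characteristic functions, shifted so as to be nonnegative and to dominate
  -- each of them for r ≥ 1.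
  set T : ℝ → ℝ := fun r => circleAverage (fun z => (|L₁| + |L₂|) + (log ‖F z‖ + log ‖G z‖)) 0 r
    with hTdef
  have hT : ∀ r, T r = |L₁| + |L₂| + (T₁ r + T₂ r) := by
    intro r
    simp only [hTdef]
    rw [circleAverage_fun_add (circleIntegrable_const _ _ _)
      hFGc.continuousOn.circleIntegrable', circleAverage_const, hT₁₂]
  have hT₁T : ∀ r, 1 ≤ r → T₁ r ≤ T r := fun r hr => by
    rw [hT]; linarith [hL₂ r hr, abs_nonneg L₁, neg_abs_le L₂]
  have hT₂T : ∀ r, 1 ≤ r → T₂ r ≤ T r := fun r hr => by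
    rw [hT]; linarith [hL₁ r hr, abs_nonneg L₂, neg_abs_le L₁]
  have hT0 : ∀ r, 1 ≤ r → 0 ≤ T r := fun r hr => by
    rw [hT]; linarith [hL₁ r hr, hL₂ r hr, neg_abs_le L₁, neg_abs_le L₂]
  have hunb : ∀ B, ∃ r, 1 ≤ r ∧ B ≤ T r := by
    -- The point g(z₀) of V differs from f(z₀), so V is not a single point and f cannot be constant.
    obtain ⟨z₂, hz₂⟩ := hf_nd.exists_ne hd (hgV z₀) z₀ hz₀
    rw [hFf, hFf, Ne, Projectivization.mk_eq_mk_iff_forall] at hz₂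
    push Not at hz₂
    obtain ⟨a, b, hab⟩ := hz₂
    intro B
    obtain ⟨r, hr, hB⟩ := exists_le_circleAverage_log_norm_of_nonconstant hF.1 hF0 hab B
    exact ⟨r, hr, hB.trans (hT₁T r hr)⟩
  have hbdd : ∀ R, BddAbove (T '' Set.Icc 1 R) :=
    bddAbove_circleAverage (continuous_const.add hFGc)
  have hPT : ∀ r, 1 ≤ r → circleAverage (fun z => log ‖P z‖) 0 r ≤ log 2 + (T₁ r + T₂ r) := by
    intro r hr
    rw [← hT₁₂]
    refine circleAverage_log_norm_le hP hP0 hFGc (fun z hz => ?_) (by positivity)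
    have h1 := norm_ne_zero_iff.2 (hF0 z)
    have h2 := norm_ne_zero_iff.2 (hG0 z)
    rw [← log_mul h1 h2, ← log_mul two_ne_zero (mul_ne_zero h1 h2)]
    refine log_le_log (norm_pos_iff.2 hz) ((norm_sub_le _ _).trans ?_)
    rw [norm_mul, norm_mul, two_mul]
    gcongr <;> exact norm_le_pi_norm _ _
  have hM1 : (0 : ℝ) ≤ hilbertFunction V d - 1 := by
    rw [sub_nonneg]
    exact_mod_cast Nat.one_le_iff_ne_zero.2 (hilbertFunction_ne_zero hV.nonempty d)
  set A : ℝ := d + |C₁| + |C₂| with hA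
  have hAT : ∀ r, 1 ≤ r → ∀ t C, t ≤ T r → |C| ≤ |C₁| + |C₂| → d * t + C ≤ A * T r + A := by
    intro r hr t C ht hC
    have h1 : (d : ℝ) * t ≤ d * T r := mul_le_mul_of_nonneg_left ht (Nat.cast_nonneg d)
    have h2 : 0 ≤ (|C₁| + |C₂|) * T r := mul_nonneg (by positivity) (hT0 r hr)
    have h3 := le_abs_self C
    have h4 : (0 : ℝ) ≤ d := Nat.cast_nonneg d
    rw [hA]
    linarith
  have hAT₁ : ∀ r, 1 ≤ r → d * T₁ r + C₁ ≤ A * T r + A := fun r hr =>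
    hAT r hr _ _ (hT₁T r hr) (le_add_of_nonneg_right (abs_nonneg _))
  have hAT₂ : ∀ r, 1 ≤ r → d * T₂ r + C₂ ≤ A * T r + A := fun r hr =>
    hAT r hr _ _ (hT₂T r hr) (le_add_of_nonneg_left (abs_nonneg _))
  set c : ℝ := (q - (distributiveConstant V D).toReal * hilbertFunction V d) * d -
    2 * (hilbertFunction V d - 1) * κ with hc
  have hc0 : 0 < c := sub_pos.2 hq
  -- Absorbs the two log 2 terms from the bound on P and the shift in T.
  set E : ℝ := 2 * ((hilbertFunction V d - 1) * κ * log 2) + c * (|L₁| + |L₂|) with hE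
  have hE0 : 0 ≤ E := by
    have : 0 ≤ log 2 := log_nonneg one_le_two
    positivity
  -- The disjoint union of both index sets gives one radius that is good for f and g simultaneously.
  obtain ⟨r, hr, hlt⟩ := exists_add_sum_logDeriv_lt
    (Finset.univ : Finset ((Finset (Fin q) × Fin (hilbertFunction V d) × Fin (hilbertFunction V d)) ⊕
      (Finset (Fin q) × Fin (hilbertFunction V d) × Fin (hilbertFunction V d))))
    (Sum.elim (fun _ => φ₁) (fun _ => φ₂)) (Sum.elim ψ₁ ψ₂)
    (Sum.elim (fun s => (s.2.1 : ℕ)) (fun s => (s.2.1 : ℕ))) hbdd hunb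
    (by rintro (s | s) - <;> simpa) (by rintro (s | s) - <;> simp [hψ₁, hψ₂])
    (by rintro (s | s) - <;> simpa) (by rintro (s | s) - <;> simp [hψ₁0, hψ₂0])
    (A := A) (by positivity)
    (by
      rintro (s | s) - r hr
      · exact ⟨(hψT₁ s r hr).trans (hAT₁ r hr), (hφT₁ r hr).trans (hAT₁ r hr)⟩
      · exact ⟨(hψT₂ s r hr).trans (hAT₂ r hr), (hφT₂ r hr).trans (hAT₂ r hr)⟩)
    hc0 (K := K₁ + K₂ + E) (by positivity)
  rw [Fintype.sum_sum_type] at hlt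
  simp only [Sum.elim_inl, Sum.elim_inr] at hlt
  have h1 := hm₁ r hr
  have h2 := hm₂ r hr
  set S₁ := ∑ s, circleAverage (fun z => log⁺
    ‖quotientNumerator φ₁ (ψ₁ s) s.2.1 z / (φ₁ z ^ (s.2.1 : ℕ) * ψ₁ s z)‖) 0 r
  set S₂ := ∑ s, circleAverage (fun z => log⁺
    ‖quotientNumerator φ₂ (ψ₂ s) s.2.1 z / (φ₂ z ^ (s.2.1 : ℕ) * ψ₂ s z)‖) 0 r
  have hS₁ : 0 ≤ S₁ := Finset.sum_nonneg fun s _ => circleAverage_nonneg_of_nonneg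
    fun z _ => posLog_nonneg
  have hS₂ : 0 ≤ S₂ := Finset.sum_nonneg fun s _ => circleAverage_nonneg_of_nonneg
    fun z _ => posLog_nonneg
  have h3 := mul_le_mul_of_nonneg_left (hPT r hr) (mul_nonneg hM1 hκ0)
  have h4 : 0 ≤ (K₂ + E) * S₁ := by positivity
  have h5 : 0 ≤ (K₁ + E) * S₂ := by positivity
  rw [hT] at hlt
  change _ * (d * T₁ r) ≤ _ at h1
  change _ * (d * T₂ r) ≤ _ at h2
  rw [hc] at hlt hE
  nlinarith

end Uniqueness

/-- The distributive constant bounds the number of hypersurfaces through a point of `V`. -/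
theorem ProjCurve.ncard_le_distributiveConstant_mul {n q k d : ℕ} {V : Set (PSpace n)}
    (hV : IsProjectiveVariety V) (hk : dim V = (k : WithBot ℕ∞)) (D : Fin q → Hypersurface n)
    (hΔ : distributiveConstant V D ≠ ⊤) (hd : 0 < d) (hdvd : ∀ i, (D i).degree ∣ d)
    {x : PSpace n} (hx : x ∈ V) :
    ({i | x ∈ (D i).locus}.ncard : ℝ) ≤ (distributiveConstant V D).toReal * k := by
  classical
  choose Q hQ using fun i => (D i).exists_form hd (hdvd i)
  rw [Set.ncard_eq_toFinset_card']
  rcases Finset.eq_empty_or_nonempty {i | x ∈ (D i).locus}.toFinset with h | h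
  · rw [h, Finset.card_empty]
    push_cast
    positivity
  · exact (card_le_distributiveConstant_mul hV hk D hΔ hd hQ h hx fun i hi => by simpa using hi).1

theorem theorem1p2 {n q k : ℕ} (V : Set (PSpace n)) (hV : IsProjectiveVariety V)
    (hk : dim V = (k : WithBot ℕ∞))
    (D : Fin q → Hypersurface n)
    (d : ℕ) (hd : d = Finset.univ.lcm fun i => (D i).degree)
    (f g : ℂ → PSpace n) (hf : IsHolomorphicMap f) (hg : IsHolomorphicMap g)
    (hfV : ∀ z, f z ∈ V) (hgV : ∀ z, g z ∈ V)
    (hf_nd : NondegenerateOver V d f) (hg_nd : NondegenerateOver V d g)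
    (hfg : Set.EqOn f g (⋃ i, (f ⁻¹' (D i).locus ∪ g ⁻¹' (D i).locus))) :
    (distributiveConstant V D *
        (2 * (k : ℝ≥0∞) * ((hilbertFunction V d : ℝ≥0∞) - 1) / (d : ℝ≥0∞)
          + (hilbertFunction V d : ℝ≥0∞)) < (q : ℝ≥0∞) → f = g) ∧
    ((∀ i j : Fin q, i < j → f ⁻¹' ((D i).locus ∩ (D j).locus) = ∅) →
      2 * ((hilbertFunction V d : ℝ≥0∞) - 1) / (d : ℝ≥0∞)
          + distributiveConstant V D * (hilbertFunction V d : ℝ≥0∞) < (q : ℝ≥0∞) → f = g) := by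
  have hdvd : ∀ i, (D i).degree ∣ d := fun i => hd ▸ Finset.dvd_lcm (Finset.mem_univ i)
  have hd0 : 0 < d := by
    rw [hd, Nat.pos_iff_ne_zero, Ne, Finset.lcm_eq_zero_iff]
    rintro ⟨i, -, hi⟩
    exact (D i).degree_pos.ne' hi
  have hM0 := hilbertFunction_ne_zero hV.nonempty d
  obtain ⟨m, hm⟩ := Nat.exists_eq_succ_of_ne_zero hM0
  -- Since H_V(d) ≥ 1, the truncated subtraction is the true one.
  have hm1 : (hilbertFunction V d : ℝ≥0∞) - 1 = m := by
    rw [hm, Nat.succ_eq_add_one, Nat.cast_add, Nat.cast_one]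
    exact ENNReal.add_sub_cancel_right ENNReal.one_ne_top
  have hm2 : (hilbertFunction V d : ℝ) - 1 = m := by
    rw [hm]
    push_cast
    ring
  have hdR : (0 : ℝ) < d := by exact_mod_cast hd0
  have hdE : (d : ℝ≥0∞) ≠ 0 := by exact_mod_cast hd0.ne'
  have hME : (hilbertFunction V d : ℝ≥0∞) ≠ 0 := by exact_mod_cast hM0
  rw [hm1]
  constructor
  · intro h
    -- An infinite Δ would make the left side infinite, because its other factor is at least H_V(d)
    -- > 0.
    have hΔ : distributiveConstant V D ≠ ⊤ := by
      intro htop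
      rw [htop, ENNReal.top_mul (by simp [hME])] at h
      exact not_top_lt h
    have hfin : 2 * (k : ℝ≥0∞) * (m : ℝ≥0∞) / (d : ℝ≥0∞) ≠ ⊤ :=
      ENNReal.div_ne_top (by finiteness) hdE
    have hlt := ENNReal.toReal_strict_mono (ENNReal.natCast_ne_top q) h
    rw [ENNReal.toReal_mul, ENNReal.toReal_add hfin (by simp), ENNReal.toReal_div,
      ENNReal.toReal_mul, ENNReal.toReal_mul] at hlt
    simp only [ENNReal.toReal_natCast, ENNReal.toReal_ofNat] at hlt
    -- At most Δk hypersurfaces pass through a point of V, since codimensions of nonempty sets are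
    -- at most k.
    refine hf_nd.eq_of_two_mul_lt hV hk D hΔ hd0 hdvd hf hg hfV hgV hg_nd hfg
      (κ := (distributiveConstant V D).toReal * k) (by positivity) (fun a _ =>
        ncard_le_distributiveConstant_mul hV hk D hΔ hd0 hdvd (hfV a)) ?_
    rw [hm2]
    have := mul_lt_mul_of_pos_right hlt hdR
    rw [mul_add, add_mul, mul_assoc _ (_ / _), div_mul_cancel₀ _ hdR.ne'] at this
    linarith
  · intro hij h
    have hΔ : distributiveConstant V D ≠ ⊤ := by
      intro htop
      rw [htop, ENNReal.top_mul hME, add_top] at h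
      exact not_top_lt h
    have hfin : 2 * (m : ℝ≥0∞) / (d : ℝ≥0∞) ≠ ⊤ := ENNReal.div_ne_top (by finiteness) hdE
    have hlt := ENNReal.toReal_strict_mono (ENNReal.natCast_ne_top q) h
    rw [ENNReal.toReal_add hfin (by finiteness), ENNReal.toReal_div, ENNReal.toReal_mul,
      ENNReal.toReal_mul] at hlt
    simp only [ENNReal.toReal_natCast, ENNReal.toReal_ofNat] at hlt
    -- Here f(a) lies on at most one hypersurface, so κ = 1.
    refine hf_nd.eq_of_two_mul_lt hV hk D hΔ hd0 hdvd hf hg hfV hgV hg_nd hfg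
      (κ := 1) zero_le_one (fun a _ => ?_) ?_
    · have hsub : {i | f a ∈ (D i).locus}.Subsingleton := by
        intro i hi j hj
        by_contra hne
        rcases lt_or_gt_of_ne hne with hlt | hlt
        · exact Set.eq_empty_iff_forall_notMem.1 (hij i j hlt) a ⟨hi, hj⟩
        · exact Set.eq_empty_iff_forall_notMem.1 (hij j i hlt) a ⟨hj, hi⟩
      exact_mod_cast Set.ncard_le_one_iff_subsingleton.2 hsub
    · rw [hm2]
      have := mul_lt_mul_of_pos_right hlt hdR
      rw [add_mul, div_mul_cancel₀ _ hdR.ne'] at this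
      linarith
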